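/- Let $1<k<\ell$ be integers, $q=e^{2\pi i/\ell}$, $[m]=\frac{\sin(\pi m/\ell)}{\sin(\pi/\ell)}$ and $a(d)=\frac{[d+1]}{[2][d]}$. A $(k,\ell)$-diagram is a Young diagram $\lambda$ with $\lambda_{k+1}=0$ and $\lambda_1-\lambda_k\le \ell-k$; a $(k,\ell)$-tableau with $n$ boxes is a standard Young tableau $t$ such that for every $m\le n$ the boxes numbered $1,\dots,m$ form a $(k,\ell)$-diagram. Let $r_i(t)$ and $c_i(t)$ be the row and the column of $i$ in $t$, and $d_i(t)=c_i(t)-c_{i+1}(t)-(r_i(t)-r_{i+1}(t))$. Let $V$ be the Hilbert space with orthonormal basis $|t\rangle$, $t$ running over the $(k,\ell)$-tableaux with $n$ boxes, and define operators $E_i$ on $V$ for $1\le i<n$ as follows. If exchanging $i$ and $i+1$ in $t$ gives a $(k,\ell)$-tableau $s_i(t)$, then, with $d=d_i(t)$, $$E_i|t\rangle=a(d)|t\rangle+\sqrt{a(d)a(-d)}\,|s_i(t)\rangle;$$ otherwise $E_i|t\rangle=0$ if $i,i+1$ are in the same row of $t$, and $E_i|t\rangle=|t\rangle$ if they are not.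 There are constants $C,D$, not depending on $n,k,\ell$, such that for all $n$ and all $1<k<\ell$ the following holds. 1. $\sigma_i\mapsto q-(1+q)E_i$ defines a unitary representation $\pi=\pi_n^{(k,\ell)}$ of the braid group $B_n$ on $V$ (the Jones–Wenzl representation). 2. $|t\rangle\mapsto |r(t)\rangle=|r_1(t)\rangle\otimes\cdots\otimes|r_n(t)\rangle$ defines a unitary map $\Phi$ from $V$ onto the subspace $\mathcal K$ of $(\mathbb C^k)^{\otimes n}$ spanned by the vectors $|r(t)\rangle$ (the computational subspace). 3. Encode each factor $\mathbb C^k$ in $\lceil\log_2 k\rceil$ qubits by writing the basis labels (as $0,\dots,k-1$) in binary. There are a number $a\le C\,n\log n$ of ancilla qubits, and, for every $1\le i<n$, a quantum circuit on the line of $n\lceil \log_2 k\rceil+a$ qubits (register qubits first, then ancillas), consisting of at most $C(n+k)^D$ unitary two-qubit gates on adjacent qubits, with overall operator $U_i$, and a unitary representation $\rho=\rho_n^{(k,\ell)}$ of $B_n$ on $\mathcal K$, such that $$U_i\big(v\otimes|0\cdots0\rangle\big)=\rho(\sigma_i)v\otimes|0\cdots0\rangle\qquad(v\in\mathcal K,\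 1\le i<n),$$ and more generally $U_{i_m}^{x_m}\cdots U_{i_1}^{x_1}(v\otimes|0\cdots0\rangle)=\rho(b)v\otimes|0\cdots0\rangle$ for every braid word $b=\sigma_{i_m}^{x_m}\cdots\sigma_{i_1}^{x_1}$, $x_j=\pm1$. 4. $\rho$ is isomorphic to $\pi$ via $\Phi$: $\rho(b)\Phi=\Phi\,\pi(b)$ for all $b\in B_n$. -/

import Mathlib

open scoped Matrix

noncomputable section

/-! ### The braid group -/

/-- The relations of the braid group on `n` strands, on the generators `σ₁, …, σ_{n-1}`
(numbered here from `0`). -/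
inductive BraidRel (n : ℕ) : FreeGroup (Fin (n - 1)) → Prop
  | braid (i j : Fin (n - 1)) (h : i.val + 1 = j.val) :
      BraidRel n (.of i * .of j * .of i * (.of j * .of i * .of j)⁻¹)
  | comm (i j : Fin (n - 1)) (h : i.val + 1 < j.val) :
      BraidRel n (.of i * .of j * (.of j * .of i)⁻¹)

/-- The braid group `B_n`. -/
abbrev BraidGroup (n : ℕ) : Type := PresentedGroup {w | BraidRel n w}

/-- The generator `σ_{i+1}` of `B_n`, which exchanges the strands `i+1` and `i+2`. -/
def BraidGroup.gen {n : ℕ} (i : Fin (n - 1)) : BraidGroup n := PresentedGroup.of i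

/-- A letter `σ_i` (`true`) or `σ_i⁻¹` (`false`) of a braid word. -/
def BraidGroup.letter {n : ℕ} (p : Fin (n - 1) × Bool) : BraidGroup n :=
  if p.2 then BraidGroup.gen p.1 else (BraidGroup.gen p.1)⁻¹

/-- The braid `b = σ_{i_m}^{x_m} ⋯ σ_{i_1}^{x_1}` of the word `[(i_1, x_1), …, (i_m, x_m)]`. -/
def BraidGroup.ofWord {n : ℕ} (w : List (Fin (n - 1) × Bool)) : BraidGroup n :=
  (w.reverse.map BraidGroup.letter).prod

/-! ### Tableaux -/

/-- A standard Young tableau with `n` boxes: `box i` is the (row, column) of the number `i + 1`,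
rows and columns being counted from `0`. The boxes form a Young diagram, and the numbers increase
strictly along each row and each column. -/
@[ext] structure StandardTableau (n : ℕ) where
  box : Fin n → ℕ × ℕ
  box_injective : Function.Injective box
  isLowerSet : IsLowerSet (Set.range box)
  row_strict : ∀ i j, (box i).1 = (box j).1 → (box i).2 < (box j).2 → i < j
  col_strict : ∀ i j, (box i).2 = (box j).2 → (box i).1 < (box j).1 → i < j

/-- A smaller box of a standard tableau carries a smaller number. -/
theorem StandardTableau.le_of_box_le {n : ℕ} (t : StandardTableau n) {i j : Fin n}
    (h : t.box i ≤ t.box j) : i ≤ j := by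
  obtain ⟨h1, h2⟩ := h
  obtain ⟨l, hl⟩ : ((t.box i).1, (t.box j).2) ∈ Set.range t.box :=
    t.isLowerSet (show ((t.box i).1, (t.box j).2) ≤ t.box j from ⟨h1, le_rfl⟩) ⟨j, rfl⟩
  have e1 : (t.box l).1 = (t.box i).1 := by rw [hl]
  have e2 : (t.box l).2 = (t.box j).2 := by rw [hl]
  have a : i ≤ l := by
    rcases h2.lt_or_eq with h | h
    · exact (t.row_strict i l e1.symm (by rw [e2]; exact h)).le
    · exact (t.box_injective (Prod.ext e1.symm (by rw [e2]; exact h))).le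
  have b : l ≤ j := by
    rcases h1.lt_or_eq with h | h
    · exact (t.col_strict l j e2 (by rw [e1]; exact h)).le
    · exact (t.box_injective (Prod.ext (by rw [e1]; exact h) e2)).le
  exact a.trans b

/-- The diagram that is formed by the boxes of the numbers `1, …, m`. -/
def StandardTableau.shapeAt {n : ℕ} (t : StandardTableau n) (m : ℕ) : YoungDiagram where
  cells := (Finset.univ.filter fun i : Fin n => i.val < m).image t.box
  isLowerSet := by
    intro a b hba ha
    simp only [Finset.coe_image, Finset.coe_filter, Finset.mem_univ, true_and, Set.mem_image,
      Set.mem_ofPred_eq] at ha ⊢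
    obtain ⟨i, hi, rfl⟩ := ha
    obtain ⟨j, rfl⟩ := t.isLowerSet hba ⟨i, rfl⟩
    exact ⟨j, lt_of_le_of_lt (t.le_of_box_le hba) hi, rfl⟩

/-- `(k, ℓ)`-diagrams: `λ_{k+1} = 0` and `λ_1 - λ_k ≤ ℓ - k`. -/
def IsKLDiagram (k ℓ : ℕ) (lam : YoungDiagram) : Prop :=
  lam.rowLen k = 0 ∧ (lam.rowLen 0 : ℤ) - lam.rowLen (k - 1) ≤ (ℓ : ℤ) - k

/-- `(k, ℓ)`-tableaux: deleting the largest numbers one by one always leaves a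
`(k, ℓ)`-diagram. -/
@[ext] structure KLTableau (k ℓ n : ℕ) extends StandardTableau n where
  isKL : ∀ m ≤ n, IsKLDiagram k ℓ (toStandardTableau.shapeAt m)

namespace KLTableau

variable {k ℓ n : ℕ}

theorem row_lt (t : KLTableau k ℓ n) (i : Fin n) : (t.box i).1 < k := by
  by_contra h
  have hm : t.box i ∈ t.shapeAt n := by
    rw [← YoungDiagram.mem_cells]
    exact Finset.mem_image_of_mem _ (by simp)
  have hk : (k, (t.box i).2) ∈ t.shapeAt n :=
    (t.shapeAt n).isLowerSet (show (k, (t.box i).2) ≤ t.box i from ⟨not_lt.1 h, le_rfl⟩) hm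
  rw [YoungDiagram.mem_iff_lt_rowLen, (t.isKL n le_rfl).1] at hk
  exact absurd hk (Nat.not_lt_zero _)

theorem col_lt (t : KLTableau k ℓ n) (i : Fin n) : (t.box i).2 < n := by
  have h : ∀ c : Fin ((t.box i).2 + 1), ∃ j, t.box j = ((t.box i).1, c.val) := fun c =>
    t.isLowerSet (show ((t.box i).1, c.val) ≤ t.box i from ⟨le_rfl, Nat.lt_succ_iff.1 c.2⟩)
      ⟨i, rfl⟩
  choose f hf using h
  have hinj : Function.Injective f := fun c c' hc => by
    have := (hf c).symm.trans ((congrArg t.box hc).trans (hf c'))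
    exact Fin.ext (Prod.ext_iff.1 this).2
  simpa using Fintype.card_le_of_injective f hinj

theorem box_inj {s t : KLTableau k ℓ n} (h : s.box = t.box) : s = t :=
  KLTableau.ext h

instance : Finite (KLTableau k ℓ n) :=
  Finite.of_injective
    (fun t i => ((⟨(t.box i).1, t.row_lt i⟩ : Fin k), (⟨(t.box i).2, t.col_lt i⟩ : Fin n)))
    fun s t h => box_inj <| funext fun i => by
      have := congrFun h i
      simp only [Prod.mk.injEq, Fin.mk.injEq] at this
      exact Prod.ext this.1 this.2

instance : Fintype (KLTableau k ℓ n) := Fintype.ofFinite _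

instance : DecidableEq (KLTableau k ℓ n) := Classical.decEq _

/-- The word `r(t) = r_1(t) ⋯ r_n(t)` of row numbers, counted from `0`. -/
def rowWord (t : KLTableau k ℓ n) (i : Fin n) : Fin k := ⟨(t.box i).1, t.row_lt i⟩

end KLTableau

/-- The first of the two (0-based) positions `i, i + 1` in `Fin n` for `i : Fin (n - 1)`. -/
def leftPos {n : ℕ} (i : Fin (n - 1)) : Fin n := ⟨i.val, by omega⟩

/-- The second of the two (0-based) positions `i, i + 1` in `Fin n` for `i : Fin (n - 1)`. -/
def rightPos {n : ℕ} (i : Fin (n - 1)) : Fin n := ⟨i.val + 1, by omega⟩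

namespace KLTableau

variable {k ℓ n : ℕ}

/-- `d_i(t) = c_i(t) - c_{i+1}(t) - (r_i(t) - r_{i+1}(t))`. -/
def axialDist (t : KLTableau k ℓ n) (i : Fin (n - 1)) : ℤ :=
  ((t.box (leftPos i)).2 : ℤ) - (t.box (rightPos i)).2
    - (((t.box (leftPos i)).1 : ℤ) - (t.box (rightPos i)).1)

/-- `s` results from `t` by exchanging the numbers `i` and `i + 1`. -/
def IsSwap (i : Fin (n - 1)) (s t : KLTableau k ℓ n) : Prop :=
  s.box = t.box ∘ Equiv.swap (leftPos i) (rightPos i)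

end KLTableau

/-! ### The Jones–Wenzl representation -/

/-- `[m]_ℓ = sin(π m / ℓ) / sin(π / ℓ)`. -/
def qInt (ℓ : ℕ) (m : ℤ) : ℝ := Real.sin (Real.pi * m / ℓ) / Real.sin (Real.pi / ℓ)

/-- `a_ℓ(d) = [d + 1]_ℓ / ([2]_ℓ [d]_ℓ)`. -/
def aCoeff (ℓ : ℕ) (d : ℤ) : ℝ := qInt ℓ (d + 1) / (qInt ℓ 2 * qInt ℓ d)

/-- `q = exp(2πi / ℓ)`. -/
def qRoot (ℓ : ℕ) : ℂ := Complex.exp (2 * Real.pi * Complex.I / ℓ)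

open Classical in
/-- The matrix of the projection `π(e_i)` in the basis of `(k, ℓ)`-tableaux; the entry at
`s, t` is the coefficient of `|s⟩` in `π(e_i)|t⟩`. If exchanging `i` and `i + 1` in `t` gives a
`(k, ℓ)`-tableau `s_i(t)`, then
`π(e_i)|t⟩ = a_ℓ(d)|t⟩ + √(a_ℓ(d) a_ℓ(-d)) |s_i(t)⟩`, where `d = d_i(t)`. Otherwise
`π(e_i)|t⟩` is `0` if `i` and `i + 1` are in the same row of `t`, and `|t⟩` if they are not. -/
def jwProj (k ℓ n : ℕ) (i : Fin (n - 1)) : Matrix (KLTableau k ℓ n) (KLTableau k ℓ n) ℂ :=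
  fun s t =>
    if s = t then
      if ∃ t', KLTableau.IsSwap i t' t then (aCoeff ℓ (t.axialDist i) : ℂ)
      else if (t.box (leftPos i)).1 = (t.box (rightPos i)).1 then 0 else 1
    else if KLTableau.IsSwap i s t then
      (Real.sqrt (aCoeff ℓ (t.axialDist i) * aCoeff ℓ (-t.axialDist i)) : ℂ)
    else 0

/-- The matrix `π(g_i) = q - (1 + q) π(e_i)`. -/
def jwMatrix (k ℓ n : ℕ) (i : Fin (n - 1)) : Matrix (KLTableau k ℓ n) (KLTableau k ℓ n) ℂ :=
  qRoot ℓ • (1 : Matrix (KLTableau k ℓ n) (KLTableau k ℓ n) ℂ) - (1 + qRoot ℓ) • jwProj k ℓ n i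

/-! ### Quantum circuits on a line of qubits -/

/-- A two-qubit gate on the adjacent qubits `pos, pos + 1` of a line of `N` qubits. -/
structure Gate (N : ℕ) where
  pos : Fin (N - 1)
  U : Matrix.unitaryGroup (Bool × Bool) ℂ

/-- The operator of a gate on `(ℂ²)^{⊗N}`, in the computational basis `{0,1}^N`. -/
def Gate.toMatrix {N : ℕ} (g : Gate N) : Matrix (Fin N → Bool) (Fin N → Bool) ℂ :=
  fun x y =>
    if ∀ j, j ≠ leftPos g.pos → j ≠ rightPos g.pos → x j = y j then
      (g.U : Matrix (Bool × Bool) (Bool × Bool) ℂ)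
        (x (leftPos g.pos), x (rightPos g.pos)) (y (leftPos g.pos), y (rightPos g.pos))
    else 0

/-- A circuit is the sequence of its gates, the first entry being performed first; its length is
the number of its gates. -/
abbrev Circuit (N : ℕ) : Type := List (Gate N)

/-- The operator `U_m ⋯ U_2 U_1` of the circuit `[U_1, …, U_m]`. -/
def Circuit.toMatrix {N : ℕ} (c : Circuit N) : Matrix (Fin N → Bool) (Fin N → Bool) ℂ :=
  (c.reverse.map Gate.toMatrix).prod

/-- The circuit `[U_m⁻¹, …, U_1⁻¹]`. -/
def Circuit.inverse {N : ℕ} (c : Circuit N) : Circuit N :=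
  c.reverse.map fun g => ⟨g.pos, g.U⁻¹⟩

/-- The circuit of a braid word, given circuits for the generators. -/
def Circuit.ofWord {n N : ℕ} (c : Fin (n - 1) → Circuit N)
    (w : List (Fin (n - 1) × Bool)) : Circuit N :=
  w.flatMap fun p => if p.2 then c p.1 else (c p.1).inverse

/-- The bit string of `n` registers with contents `r_1, …, r_n ∈ {0, …, k - 1}`, each written in
binary on `⌈log₂ k⌉` qubits, followed by `a` ancillas in state `0`. -/
def encodeBits {n k : ℕ} (a : ℕ) (r : Fin n → Fin k) : Fin (n * Nat.clog 2 k + a) → Bool :=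
  Fin.append (fun p => (r p.divNat).val.testBit p.modNat.val) (fun _ => false)

/-- The linear extension `(ℂ^k)^{⊗n} → (ℂ²)^{⊗(n⌈log₂ k⌉ + a)}` of `encodeBits`. -/
def encodeState {n k : ℕ} (a : ℕ) (v : EuclideanSpace ℂ (Fin n → Fin k)) :
    EuclideanSpace ℂ (Fin (n * Nat.clog 2 k + a) → Bool) :=
  ∑ r, v r • EuclideanSpace.single (encodeBits a r) 1

/-- The computational subspace of `(ℂ^k)^{⊗n}`, spanned by the basis states `|r(t)⟩`. -/
def compSubspace (k ℓ n : ℕ) : Submodule ℂ (EuclideanSpace ℂ (Fin n → Fin k)) :=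
  Submodule.span ℂ (Set.range fun t : KLTableau k ℓ n => EuclideanSpace.single t.rowWord 1)

end

/-!
The proof reads a `(k, ℓ)`-tableau `t` as the word `r(t)` of its row numbers. The word determines
`t` (`KLTableau.rowWord_injective`), so `|t⟩ ↦ |r(t)⟩` is an isometry onto the computational
subspace. The coefficients of `π(e_i)|t⟩` depend only on the content of the rows `r_i(t)` and
`r_{i+1}(t)` after `i - 1` boxes, which can be read off from the number of occurrences of a letter
in a prefix of the word. The same formulas therefore define projections `wordProj` on *all* words,
and `wordProj_mul_wordEmbedding` says that they restrict to the `π(e_i)`; it rests on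
`KLTableau.exists_isSwap`: where the exchange of two numbers in different rows fails, the axial
distance is `1` or `1 - ℓ`, and the formula gives `a(d) = 1` and `a(d) a(-d) = 0`, which are the
prescribed values.

**Unitary representation.** On words the projections are self-adjoint, because
`a(d) + a(-d) = 1` and `a(d) a(-d) ≥ 0` for `[d] ≠ 0`, and distant ones commute. The braid
relation is equivalent to `e₁e₂e₁ - τe₁ = e₂e₁e₂ - τe₂` with `τ = [2]⁻² = q / (1 + q)²`. It involves
three letters only (`threeLetter_relation`), and its matrix entries are trigonometric identities
for the coefficients (`aCoeff_triangle`, `aCoeff_mul_neg_succ`), which hold as long as the contents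
of different rows are incongruent modulo `ℓ`. For words of `(k, ℓ)`-tableaux they are, since
`λ_1 - λ_k ≤ ℓ - k` (`KLTableau.qInt_wordContent_ne_zero`).

**Circuits.** On words the generator is `q ∏ (1 - (1 + q⁻¹) e_i)`, the product being over the pairs
of letters `x < y`, the factor of a pair acting only on the words with the letters `x`, `y` in some
order at `i`, `i + 1` (`genOp`). Such a factor (`pairOp`) is realized with `2n + 2` ancillas, a
unary register of `2n + 1` places that carries a single token, and a flag.
A reversible classical computation (`prepSteps`) puts the token on the place `0`, moves it by `2`,
`0` or `1` places for every letter `x`, `y` or other letter before `i`, and exchanges the contents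
`y`, `x` of the registers for `x`, `y` with a raised flag. Now the token tells the axial distance,
and the two words that are mixed by `e_i` differ in the flag only, so that one controlled one-qubit
gate on the flag for each place of the token is enough (`tokenCtrl`). Finally the classical
computation is undone. Every operation has at most `2⌈log₂ k⌉ + 1` controls. Splitting
off one control at a time (`ctrl_and_eq`) costs a factor `3` for each, hence a factor polynomial in
`k` altogether (`realizable_ctrl`), and a gate with a single control is carried out on adjacent
qubits after exchanges of neighbours (`realizable_ctrl_single`).

For `n ≤ 1` there are no generators and the bound `C n log n` allows no ancillas; for `n ≥ 2` it
exceeds `2n + 2`.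
-/

noncomputable section

/-! ### Basis states -/

/-- The computational basis state `|x⟩`. -/
def ket {ι : Type*} [DecidableEq ι] (x : ι) : ι → ℂ := Pi.single x 1

theorem ket_apply {ι : Type*} [DecidableEq ι] (x y : ι) : ket x y = if y = x then 1 else 0 := by
  simp [ket, Pi.single_apply]

theorem mulVec_ket_apply {ι κ : Type*} [Fintype ι] [DecidableEq ι] (A : Matrix κ ι ℂ) (x : ι)
    (z : κ) : (A *ᵥ ket x) z = A z x := by
  simp [ket]

theorem Matrix.ext_ket {ι κ : Type*} [Fintype ι] [DecidableEq ι] {A B : Matrix κ ι ℂ}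
    (h : ∀ x, A *ᵥ ket x = B *ᵥ ket x) : A = B := by
  ext z x
  rw [← mulVec_ket_apply A, ← mulVec_ket_apply B, h]

theorem Matrix.conjTranspose_mulVec_of_unitary {ι : Type*} [Fintype ι]
    [DecidableEq ι] {A : Matrix ι ι ℂ} (hA : A ∈ Matrix.unitaryGroup ι ℂ)
    {v w : ι → ℂ} (h : A *ᵥ v = w) :
    Aᴴ *ᵥ w = v := by
  have h1 : Aᴴ * A = 1 := Matrix.mem_unitaryGroup_iff'.1 hA
  rw [← h, Matrix.mulVec_mulVec, h1, Matrix.one_mulVec]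

/-! ### Operators realized by circuits -/

theorem Gate.toMatrix_conjTranspose {N : ℕ} (g : Gate N) :
    (Gate.toMatrix ⟨g.pos, g.U⁻¹⟩ : Matrix (Fin N → Bool) (Fin N → Bool) ℂ) = g.toMatrixᴴ := by
  ext x y
  have hc : (∀ j, j ≠ leftPos g.pos → j ≠ rightPos g.pos → x j = y j) ↔
      ∀ j, j ≠ leftPos g.pos → j ≠ rightPos g.pos → y j = x j :=
    forall_congr' fun j => forall_congr' fun _ => forall_congr' fun _ => eq_comm
  simp only [Gate.toMatrix, Matrix.conjTranspose_apply, hc]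
  split_ifs <;> simp [Matrix.star_apply]

/-- The state with the qubit `f` in the state `ψ` and all others as in `y`. -/
def qubitState {N : ℕ} (f : Fin N) (y : Fin N → Bool) (ψ : Bool → ℂ) : (Fin N → Bool) → ℂ :=
  ψ false • ket (Function.update y f false) + ψ true • ket (Function.update y f true)

theorem ket_eq_qubitState {N : ℕ} (f : Fin N) (y : Fin N → Bool) :
    ket y = qubitState f y (ket (y f)) := by
  cases h : y f <;> simp [qubitState, ket_apply, ← h]

theorem qubitState_apply {N : ℕ} (f : Fin N) (y : Fin N → Bool) (ψ : Bool → ℂ)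
    (x : Fin N → Bool) :
    qubitState f y ψ x = if ∀ j, j ≠ f → x j = y j then ψ (x f) else 0 := by
  have key : ∀ b, x = Function.update y f b ↔ ((∀ j, j ≠ f → x j = y j) ∧ x f = b) := by
    intro b
    constructor
    · rintro rfl
      exact ⟨fun j hj => by simp [hj], by simp⟩
    · rintro ⟨h1, h2⟩
      funext j
      by_cases hj : j = f
      · subst hj; simp [h2]
      · simp [hj, h1 j hj]
  simp only [qubitState, Pi.add_apply, Pi.smul_apply, ket_apply, key]
  by_cases h : ∀ j, j ≠ f → x j = y j
  · simp only [fun b => and_iff_right (b := x f = b) h, if_pos h]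
    cases x f <;> simp
  · rw [if_neg h]
    simp [mt And.left h]

theorem qubitState_congr {N : ℕ} {f : Fin N} {y y' : Fin N → Bool} (ψ : Bool → ℂ)
    (h : ∀ j, j ≠ f → y j = y' j) : qubitState f y ψ = qubitState f y' ψ := by
  ext x
  simp only [qubitState_apply]
  have : (∀ j, j ≠ f → x j = y j) ↔ (∀ j, j ≠ f → x j = y' j) :=
    forall_congr' fun j => forall_congr' fun hj => by rw [h j hj]
  simp only [this]

open Classical in
/-- The one-qubit operator `W` on the qubit `f`, performed on the basis states which satisfy `P`
(a condition on the other qubits). -/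
def ctrl {N : ℕ} (P : (Fin N → Bool) → Prop) (f : Fin N) (W : Matrix Bool Bool ℂ) :
    Matrix (Fin N → Bool) (Fin N → Bool) ℂ :=
  fun x y => if ∀ j, j ≠ f → x j = y j then (if P y then W else 1) (x f) (y f) else 0

theorem ctrl_mulVec_qubitState {N : ℕ} {P : (Fin N → Bool) → Prop} {f : Fin N}
    (W : Matrix Bool Bool ℂ) {y : Fin N → Bool} (hP : ∀ b, P (Function.update y f b) ↔ P y)
    [Decidable (P y)] (ψ : Bool → ℂ) :
    ctrl P f W *ᵥ qubitState f y ψ = qubitState f y (if P y then W *ᵥ ψ else ψ) := by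
  ext x
  rw [qubitState_apply]
  simp only [qubitState, Matrix.mulVec_add, Matrix.mulVec_smul, Pi.add_apply, Pi.smul_apply,
    mulVec_ket_apply, ctrl, hP]
  have hc : ∀ b, (∀ j, j ≠ f → x j = Function.update y f b j) ↔ ∀ j, j ≠ f → x j = y j :=
    fun b => forall_congr' fun j => forall_congr' fun hj => by simp [hj]
  simp only [hc]
  by_cases h : ∀ j, j ≠ f → x j = y j
  · by_cases hy : P y
    · simp only [if_pos h, if_pos hy]
      simp [Matrix.mulVec, dotProduct, mul_comm, add_comm]
    · simp only [if_pos h, if_neg hy]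
      cases x f <;> simp [Matrix.one_apply]
  · simp [h]

theorem ctrl_mulVec_qubitState_pos {N : ℕ} {P : (Fin N → Bool) → Prop} {f : Fin N}
    (W : Matrix Bool Bool ℂ) {y : Fin N → Bool} (hP : ∀ b, P (Function.update y f b) ↔ P y)
    (h : P y) (ψ : Bool → ℂ) :
    ctrl P f W *ᵥ qubitState f y ψ = qubitState f y (W *ᵥ ψ) := by
  classical
  rw [ctrl_mulVec_qubitState W hP, if_pos h]

theorem ctrl_mulVec_qubitState_neg {N : ℕ} {P : (Fin N → Bool) → Prop} {f : Fin N}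
    (W : Matrix Bool Bool ℂ) {y : Fin N → Bool} (hP : ∀ b, P (Function.update y f b) ↔ P y)
    (h : ¬ P y) (ψ : Bool → ℂ) :
    ctrl P f W *ᵥ qubitState f y ψ = qubitState f y ψ := by
  classical
  rw [ctrl_mulVec_qubitState W hP, if_neg h]

/-- `Realizable L A`: the operator `A` is that of a circuit of at most `L` gates. -/
def Realizable {N : ℕ} (L : ℕ) (A : Matrix (Fin N → Bool) (Fin N → Bool) ℂ) : Prop :=
  ∃ c : Circuit N, c.length ≤ L ∧ c.toMatrix = A

namespace Realizable

variable {N L M : ℕ} {A B : Matrix (Fin N → Bool) (Fin N → Bool) ℂ}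

theorem one : Realizable 0 (1 : Matrix (Fin N → Bool) (Fin N → Bool) ℂ) :=
  ⟨[], le_rfl, by simp [Circuit.toMatrix]⟩

theorem mul (hA : Realizable L A) (hB : Realizable M B) : Realizable (L + M) (A * B) := by
  obtain ⟨c, hc, rfl⟩ := hA
  obtain ⟨d, hd, rfl⟩ := hB
  exact ⟨d ++ c, by rw [List.length_append]; omega, by simp [Circuit.toMatrix]⟩

theorem mono (hA : Realizable L A) (h : L ≤ M) : Realizable M A := by
  obtain ⟨c, hc, rfl⟩ := hA
  exact ⟨c, hc.trans h, rfl⟩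

theorem gate (g : Gate N) : Realizable 1 g.toMatrix :=
  ⟨[g], le_rfl, by simp [Circuit.toMatrix]⟩

theorem _root_.Circuit.toMatrix_inverse (c : Circuit N) :
    c.inverse.toMatrix = c.toMatrixᴴ := by
  induction c with
  | nil => simp [Circuit.toMatrix, Circuit.inverse]
  | cons g c ih =>
    have h : Circuit.toMatrix (Circuit.inverse (g :: c)) =
        Gate.toMatrix ⟨g.pos, g.U⁻¹⟩ * Circuit.toMatrix (Circuit.inverse c) := by
      simp [Circuit.toMatrix, Circuit.inverse]
    have h' : Circuit.toMatrix (g :: c) = Circuit.toMatrix c * g.toMatrix := by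
      simp [Circuit.toMatrix]
    rw [h, h', ih, Gate.toMatrix_conjTranspose, Matrix.conjTranspose_mul]

theorem conjTranspose (hA : Realizable L A) : Realizable L Aᴴ := by
  obtain ⟨c, hc, rfl⟩ := hA
  exact ⟨c.inverse, by simpa [Circuit.inverse] using hc, c.toMatrix_inverse⟩

theorem listProd {ι : Type*} (l : List ι) (F : ι → Matrix (Fin N → Bool) (Fin N → Bool) ℂ)
    (h : ∀ i ∈ l, Realizable L (F i)) : Realizable (l.length * L) (l.map F).prod := by
  induction l with
  | nil => simpa using one
  | cons i l ih =>
    rw [List.map_cons, List.prod_cons]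
    refine ((h i (by simp)).mul (ih fun j hj => h j (by simp [hj]))).mono ?_
    rw [List.length_cons]
    ring_nf
    rfl

end Realizable

theorem leftPos_ne_rightPos {n : ℕ} (i : Fin (n - 1)) : leftPos i ≠ rightPos i := by
  simp [leftPos, rightPos, Fin.ext_iff]

theorem Gate.mulVec_ket {N : ℕ} (g : Gate N) (y : Fin N → Bool) :
    g.toMatrix *ᵥ ket y = ∑ b : Bool × Bool,
      (g.U : Matrix (Bool × Bool) (Bool × Bool) ℂ) b (y (leftPos g.pos), y (rightPos g.pos)) •
        ket (Function.update (Function.update y (leftPos g.pos) b.1) (rightPos g.pos) b.2) := by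
  classical
  ext x
  have hne := leftPos_ne_rightPos g.pos
  have key : ∀ b : Bool × Bool,
      (x = Function.update (Function.update y (leftPos g.pos) b.1) (rightPos g.pos) b.2) ↔
      ((∀ j, j ≠ leftPos g.pos → j ≠ rightPos g.pos → x j = y j) ∧
        (x (leftPos g.pos), x (rightPos g.pos)) = b) := by
    rintro ⟨b1, b2⟩
    constructor
    · rintro rfl
      refine ⟨fun j h1 h2 => by simp [h1, h2], by simp [hne]⟩
    · rintro ⟨h1, h2⟩
      simp only [Prod.mk.injEq] at h2
      funext j
      by_cases hj : j = rightPos g.pos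
      · subst hj; simp [h2.2]
      · by_cases hj' : j = leftPos g.pos
        · subst hj'; simp [hj, h2.1]
        · simp [hj, hj', h1 j hj' hj]
  rw [mulVec_ket_apply]
  simp only [Finset.sum_apply, Pi.smul_apply, ket_apply, key, Gate.toMatrix]
  by_cases h : ∀ j, j ≠ leftPos g.pos → j ≠ rightPos g.pos → x j = y j
  · simp only [fun b => and_iff_right (b := (x (leftPos g.pos), x (rightPos g.pos)) = b) h,
      if_pos h]
    simp
  · rw [if_neg h]
    simp only [fun b => if_neg (α := ℂ) (t := 1) (e := 0)
      (mt (And.left (b := (x (leftPos g.pos), x (rightPos g.pos)) = b)) h), smul_zero,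
      Finset.sum_const_zero]

theorem Gate.toMatrix_mem_unitaryGroup {N : ℕ} (g : Gate N) :
    g.toMatrix ∈ Matrix.unitaryGroup (Fin N → Bool) ℂ := by
  rw [Matrix.mem_unitaryGroup_iff']
  have hne := leftPos_ne_rightPos g.pos
  have hU : (g.U : Matrix (Bool × Bool) (Bool × Bool) ℂ)ᴴ * (g.U : Matrix _ _ ℂ) = 1 :=
    Matrix.mem_unitaryGroup_iff'.1 g.U.2
  change g.toMatrixᴴ * g.toMatrix = 1
  refine Matrix.ext_ket fun y => ?_
  rw [← Matrix.mulVec_mulVec, Gate.mulVec_ket, Matrix.mulVec_sum, Matrix.one_mulVec]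
  simp only [Matrix.mulVec_smul, ← Gate.toMatrix_conjTranspose]
  simp only [Gate.mulVec_ket, Finset.smul_sum]
  rw [Finset.sum_comm]
  have hupd : ∀ b c : Bool × Bool, Function.update (Function.update (Function.update
      (Function.update y (leftPos g.pos) b.1) (rightPos g.pos) b.2) (leftPos g.pos) c.1)
      (rightPos g.pos) c.2 = Function.update (Function.update y (leftPos g.pos) c.1)
      (rightPos g.pos) c.2 := by
    intro b c
    funext j
    by_cases h1 : j = rightPos g.pos
    · subst h1; simp
    · by_cases h2 : j = leftPos g.pos <;> simp [h1, h2, Function.update_apply]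
  simp only [hupd, Function.update_self, Function.update_of_ne hne, smul_smul, ← Finset.sum_smul]
  have h2 : ∀ c, (∑ b, (g.U : Matrix (Bool × Bool) (Bool × Bool) ℂ) b
      (y (leftPos g.pos), y (rightPos g.pos)) * ((g.U⁻¹ : Matrix.unitaryGroup _ ℂ) :
        Matrix (Bool × Bool) (Bool × Bool) ℂ) c (b.1, b.2)) =
        if c = (y (leftPos g.pos), y (rightPos g.pos)) then 1 else 0 := by
    intro c
    have := congrFun (congrFun hU c) (y (leftPos g.pos), y (rightPos g.pos))
    rw [Matrix.mul_apply, Matrix.one_apply] at this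
    rw [← this]
    refine Finset.sum_congr rfl fun b _ => ?_
    rw [mul_comm]
    simp [Matrix.star_apply]
  simp only [h2]
  simp

theorem Circuit.toMatrix_mem_unitaryGroup {N : ℕ} (c : Circuit N) :
    c.toMatrix ∈ Matrix.unitaryGroup (Fin N → Bool) ℂ := by
  refine Submonoid.list_prod_mem _ fun A hA => ?_
  obtain ⟨g, -, rfl⟩ := List.mem_map.1 hA
  exact g.toMatrix_mem_unitaryGroup

theorem Realizable.mem_unitaryGroup {N L : ℕ} {A : Matrix (Fin N → Bool) (Fin N → Bool) ℂ}
    (hA : Realizable L A) : A ∈ Matrix.unitaryGroup (Fin N → Bool) ℂ := by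
  obtain ⟨c, -, rfl⟩ := hA
  exact c.toMatrix_mem_unitaryGroup

/-! ### Controlled one-qubit gates on arbitrary qubits -/

theorem ctrl_mulVec_ket {N : ℕ} {P : (Fin N → Bool) → Prop} {f : Fin N}
    (W : Matrix Bool Bool ℂ) {y : Fin N → Bool} (hP : ∀ b, P (Function.update y f b) ↔ P y)
    [Decidable (P y)] :
    ctrl P f W *ᵥ ket y = qubitState f y (if P y then W *ᵥ ket (y f) else ket (y f)) := by
  rw [ket_eq_qubitState f y, ctrl_mulVec_qubitState W hP]

/-- The gate on two qubits that performs `W` on the second one if the first one is `v`. -/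
def ctrlGate (v : Bool) (W : Matrix.unitaryGroup Bool ℂ) :
    Matrix.unitaryGroup (Bool × Bool) ℂ :=
  ⟨.of fun a b =>
      if a.1 = b.1 then (if b.1 = v then (W : Matrix Bool Bool ℂ) else 1) a.2 b.2 else 0,
    by
      have h : (W : Matrix Bool Bool ℂ)ᴴ * (W : Matrix Bool Bool ℂ) = 1 :=
        Matrix.mem_unitaryGroup_iff'.1 W.2
      have h' : ∀ u : Bool, (if u = v then (W : Matrix Bool Bool ℂ) else 1)ᴴ *
          (if u = v then (W : Matrix Bool Bool ℂ) else 1) = 1 := by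
        intro u
        split_ifs <;> simp [h]
      rw [Matrix.mem_unitaryGroup_iff']
      ext ⟨a, b⟩ ⟨c, d⟩
      have h2 := congrFun (congrFun (h' c) b) d
      rw [Matrix.mul_apply] at h2
      rw [Matrix.mul_apply, Fintype.sum_prod_type]
      rw [Finset.sum_eq_single c (fun u _ hu => by simp [hu, Matrix.star_apply]) (by simp)]
      by_cases hac : c = a
      · subst hac
        simp only [Matrix.star_apply, Matrix.of_apply, if_true]
        refine h2.trans ?_
        simp [Matrix.one_apply]
      · simp [Matrix.star_apply, hac, Ne.symm hac]⟩

/-- The gate `U` with the roles of its two qubits exchanged. -/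
def flipGate (U : Matrix.unitaryGroup (Bool × Bool) ℂ) : Matrix.unitaryGroup (Bool × Bool) ℂ :=
  ⟨(U : Matrix (Bool × Bool) (Bool × Bool) ℂ).submatrix (Equiv.prodComm _ _) (Equiv.prodComm _ _),
    by
      rw [Matrix.mem_unitaryGroup_iff', Matrix.star_eq_conjTranspose,
        Matrix.conjTranspose_submatrix, Matrix.submatrix_mul_equiv, ← Matrix.star_eq_conjTranspose,
        Matrix.mem_unitaryGroup_iff'.1 U.2, Matrix.submatrix_one_equiv]⟩

/-- The gate that exchanges two qubits. -/
def swapGate : Matrix.unitaryGroup (Bool × Bool) ℂ :=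
  ⟨(1 : Matrix (Bool × Bool) (Bool × Bool) ℂ).submatrix (Equiv.prodComm _ _) id,
    by
      rw [Matrix.mem_unitaryGroup_iff', Matrix.star_eq_conjTranspose,
        Matrix.conjTranspose_submatrix, Matrix.submatrix_mul_equiv]
      simp⟩

theorem forall_ne_right_iff {N : ℕ} (p : Fin (N - 1)) (x y : Fin N → Bool) :
    (∀ j, j ≠ rightPos p → x j = y j) ↔
      (∀ j, j ≠ leftPos p → j ≠ rightPos p → x j = y j) ∧ x (leftPos p) = y (leftPos p) := by
  have hne := leftPos_ne_rightPos p
  constructor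
  · exact fun h => ⟨fun j _ hj => h j hj, h _ hne⟩
  · rintro ⟨h1, h2⟩ j hj
    by_cases hj' : j = leftPos p
    · rw [hj', h2]
    · exact h1 j hj' hj

theorem forall_ne_left_iff {N : ℕ} (p : Fin (N - 1)) (x y : Fin N → Bool) :
    (∀ j, j ≠ leftPos p → x j = y j) ↔
      (∀ j, j ≠ leftPos p → j ≠ rightPos p → x j = y j) ∧ x (rightPos p) = y (rightPos p) := by
  have hne := leftPos_ne_rightPos p
  constructor
  · exact fun h => ⟨fun j hj _ => h j hj, h _ hne.symm⟩
  · rintro ⟨h1, h2⟩ j hj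
    by_cases hj' : j = rightPos p
    · rw [hj', h2]
    · exact h1 j hj hj'

theorem ctrlGate_toMatrix {N : ℕ} (p : Fin (N - 1)) (v : Bool)
    (W : Matrix.unitaryGroup Bool ℂ) :
    Gate.toMatrix ⟨p, ctrlGate v W⟩ = ctrl (fun y => y (leftPos p) = v) (rightPos p) W := by
  ext x y
  simp only [Gate.toMatrix, ctrl, ctrlGate, forall_ne_right_iff, Matrix.of_apply]
  split_ifs <;> simp_all

theorem flipGate_ctrlGate_toMatrix {N : ℕ} (p : Fin (N - 1)) (v : Bool)
    (W : Matrix.unitaryGroup Bool ℂ) :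
    Gate.toMatrix ⟨p, flipGate (ctrlGate v W)⟩ =
      ctrl (fun y => y (rightPos p) = v) (leftPos p) W := by
  ext x y
  simp only [Gate.toMatrix, ctrl, ctrlGate, flipGate, forall_ne_left_iff, Matrix.submatrix_apply,
    Equiv.prodComm_apply, Prod.swap_prod_mk, Matrix.of_apply]
  split_ifs <;> simp_all

theorem swapGate_mulVec_ket {N : ℕ} (p : Fin (N - 1)) (y : Fin N → Bool) :
    Gate.toMatrix ⟨p, swapGate⟩ *ᵥ ket y = ket (y ∘ Equiv.swap (leftPos p) (rightPos p)) := by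
  rw [Gate.mulVec_ket, Finset.sum_eq_single (y (rightPos p), y (leftPos p))]
  · have : Function.update (Function.update y (leftPos p) (y (rightPos p))) (rightPos p)
        (y (leftPos p)) = y ∘ Equiv.swap (leftPos p) (rightPos p) := by
      funext j
      have hne := leftPos_ne_rightPos p
      by_cases h1 : j = rightPos p
      · subst h1; simp
      · by_cases h2 : j = leftPos p
        · subst h2; simp [hne]
        · simp [h1, h2, Equiv.swap_apply_of_ne_of_ne h2 h1]
    simp [swapGate, Matrix.one_apply, this]
  · rintro ⟨b1, b2⟩ - hb
    have : ¬ (b2, b1) = (y (leftPos p), y (rightPos p)) := by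
      intro h
      simp only [Prod.mk.injEq] at h
      exact hb (by rw [h.1, h.2])
    simp [swapGate, this]
  · simp

theorem swapGate_mulVec_qubitState {N : ℕ} (p : Fin (N - 1)) (f : Fin N) (y : Fin N → Bool)
    (ψ : Bool → ℂ) :
    Gate.toMatrix ⟨p, swapGate⟩ *ᵥ qubitState f y ψ =
      qubitState (Equiv.swap (leftPos p) (rightPos p) f)
        (y ∘ Equiv.swap (leftPos p) (rightPos p)) ψ := by
  simp only [qubitState, Matrix.mulVec_add, Matrix.mulVec_smul, swapGate_mulVec_ket]
  rw [Function.update_comp_equiv, Function.update_comp_equiv]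
  simp

/-- Exchanging two neighbours before and after a controlled gate moves its qubits. -/
theorem swapGate_conj_ctrl {N : ℕ} (p : Fin (N - 1)) {c f : Fin N} (hcf : c ≠ f) (v : Bool)
    (W : Matrix Bool Bool ℂ) :
    Gate.toMatrix ⟨p, swapGate⟩ * ctrl (fun y => y c = v) f W * Gate.toMatrix ⟨p, swapGate⟩ =
      ctrl (fun y => y (Equiv.swap (leftPos p) (rightPos p) c) = v)
        (Equiv.swap (leftPos p) (rightPos p) f) W := by
  refine Matrix.ext_ket fun y => ?_
  have hcf' : Equiv.swap (leftPos p) (rightPos p) c ≠ Equiv.swap (leftPos p) (rightPos p) f :=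
    fun h => hcf ((Equiv.swap _ _).injective h)
  rw [← Matrix.mulVec_mulVec, ← Matrix.mulVec_mulVec, swapGate_mulVec_ket,
    ctrl_mulVec_ket W (by simp [Function.update_of_ne hcf]), swapGate_mulVec_qubitState,
    ctrl_mulVec_ket W (by simp [Function.update_of_ne hcf'])]
  have : (y ∘ Equiv.swap (leftPos p) (rightPos p)) ∘ Equiv.swap (leftPos p) (rightPos p) = y := by
    funext j; simp
  rw [this]
  simp

/-- A controlled gate is moved to adjacent qubits by exchanging neighbours. -/
theorem realizable_ctrl_single_of_dist {N : ℕ} (v : Bool) (W : Matrix.unitaryGroup Bool ℂ)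
    (m : ℕ) : ∀ c f : Fin N, (c.val = f.val + m + 1 ∨ f.val = c.val + m + 1) →
    Realizable (2 * m + 1) (ctrl (fun y => y c = v) f W) := by
  induction m with
  | zero =>
    rintro c f (h | h)
    · have := flipGate_ctrlGate_toMatrix (N := N) ⟨f.val, by omega⟩ v W
      have h1 : rightPos (⟨f.val, by omega⟩ : Fin (N - 1)) = c := Fin.ext (by simp [rightPos, h])
      have h2 : leftPos (⟨f.val, by omega⟩ : Fin (N - 1)) = f := rfl
      rw [h1, h2] at this
      rw [← this]
      exact Realizable.gate _
    · have := ctrlGate_toMatrix (N := N) ⟨c.val, by omega⟩ v W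
      have h1 : rightPos (⟨c.val, by omega⟩ : Fin (N - 1)) = f := Fin.ext (by simp [rightPos, h])
      have h2 : leftPos (⟨c.val, by omega⟩ : Fin (N - 1)) = c := rfl
      rw [h1, h2] at this
      rw [← this]
      exact Realizable.gate _
  | succ m ih =>
    rintro c f (h | h)
    · have hR := ih ⟨c.val - 1, by omega⟩ f (Or.inl (by simp; omega))
      have hc := swapGate_conj_ctrl (N := N) ⟨c.val - 1, by omega⟩
        (c := ⟨c.val - 1, by omega⟩) (f := f) (by simp [Fin.ext_iff]; omega) v W
      have h1 : rightPos (⟨c.val - 1, by omega⟩ : Fin (N - 1)) = c :=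
        Fin.ext (by simp [rightPos]; omega)
      have h2 : leftPos (⟨c.val - 1, by omega⟩ : Fin (N - 1)) = ⟨c.val - 1, by omega⟩ := rfl
      rw [h1, h2, Equiv.swap_apply_left, Equiv.swap_apply_of_ne_of_ne (x := f)
        (by simp [Fin.ext_iff]; omega) (by simp [Fin.ext_iff]; omega)] at hc
      rw [← hc]
      exact (((Realizable.gate _).mul hR).mul (Realizable.gate _)).mono (by omega)
    · have hR := ih ⟨c.val + 1, by omega⟩ f (Or.inr (by simp; omega))
      have hc := swapGate_conj_ctrl (N := N) ⟨c.val, by omega⟩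
        (c := ⟨c.val + 1, by omega⟩) (f := f) (by simp [Fin.ext_iff]; omega) v W
      have h1 : rightPos (⟨c.val, by omega⟩ : Fin (N - 1)) = ⟨c.val + 1, by omega⟩ := rfl
      have h2 : leftPos (⟨c.val, by omega⟩ : Fin (N - 1)) = c := rfl
      rw [h1, h2, Equiv.swap_apply_right, Equiv.swap_apply_of_ne_of_ne (x := f)
        (by simp [Fin.ext_iff]; omega) (by simp [Fin.ext_iff]; omega)] at hc
      rw [← hc]
      exact (((Realizable.gate _).mul hR).mul (Realizable.gate _)).mono (by omega)

/-- A gate with one control needs at most `N - 2` exchanges of neighbours before it, and as many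
after it. -/
theorem realizable_ctrl_single {N : ℕ} (v : Bool) (W : Matrix.unitaryGroup Bool ℂ) {c f : Fin N}
    (h : c ≠ f) : Realizable (2 * N) (ctrl (fun y => y c = v) f W) := by
  have hne : c.val ≠ f.val := fun h' => h (Fin.ext h')
  rcases Nat.lt_or_gt_of_ne hne with hlt | hlt
  · exact (realizable_ctrl_single_of_dist v W (f.val - c.val - 1) c f
      (Or.inr (by omega))).mono (by omega)
  · exact (realizable_ctrl_single_of_dist v W (c.val - f.val - 1) c f
      (Or.inl (by omega))).mono (by omega)

/-! ### Gates with several controls -/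

/-- The operator with eigenvalue `z` on the range of the projection `E` and `1` on its kernel. -/
def phaseGate (E : Matrix Bool Bool ℂ) (z : ℂ) : Matrix Bool Bool ℂ := (1 - E) + z • E

theorem phaseGate_mul {E : Matrix Bool Bool ℂ} (hE : IsStarProjection E) (z w : ℂ) :
    phaseGate E z * phaseGate E w = phaseGate E (z * w) := by
  have h : E * E = E := hE.isIdempotentElem
  simp only [phaseGate, add_mul, mul_add, sub_mul, mul_sub, Matrix.smul_mul, Matrix.mul_smul, h,
    one_mul, mul_one, smul_smul, mul_comm w z]
  simp

theorem phaseGate_one (E : Matrix Bool Bool ℂ) : phaseGate E 1 = 1 := by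
  simp [phaseGate]

theorem phaseGate_mem {E : Matrix Bool Bool ℂ} (hE : IsStarProjection E) {z : ℂ} (hz : ‖z‖ = 1) :
    phaseGate E z ∈ Matrix.unitaryGroup Bool ℂ := by
  have h : star E = E := hE.isSelfAdjoint
  have hs : star (phaseGate E z) = phaseGate E (star z) := by
    simp [phaseGate, h]
  have hz' : star z * z = 1 := by
    rw [Complex.star_def, mul_comm, Complex.mul_conj, Complex.normSq_eq_norm_sq, hz]
    simp
  rw [Matrix.mem_unitaryGroup_iff', hs, phaseGate_mul hE, hz', phaseGate_one]

/-- The operator that exchanges `|0⟩` and `|1⟩`. -/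
def notMatrix : Matrix Bool Bool ℂ := fun a b => if a = b then 0 else 1

/-- The projection onto `(|0⟩ - |1⟩) / √2`. -/
def minusProj : Matrix Bool Bool ℂ := fun a b => if a = b then 1 / 2 else -(1 / 2)

theorem isStarProjection_minusProj : IsStarProjection minusProj := by
  constructor
  · ext a b
    rw [Matrix.mul_apply]
    cases a <;> cases b <;> simp [minusProj] <;> norm_num
  · ext a b
    rw [Matrix.star_apply]
    cases a <;> cases b <;> simp [minusProj]

theorem phaseGate_minusProj : phaseGate minusProj (-1) = notMatrix := by
  ext a b
  cases a <;> cases b <;> simp [phaseGate, minusProj, notMatrix] <;> norm_num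

theorem notMatrix_mulVec_ket (b : Bool) : notMatrix *ᵥ ket b = ket (!b) := by
  ext a
  rw [mulVec_ket_apply, ket_apply]
  cases a <;> cases b <;> simp [notMatrix]

/-- The bit string `y` agrees with the list `l` of pairs (qubit, value). -/
def Matches {N : ℕ} (l : List (Fin N × Bool)) (y : Fin N → Bool) : Prop :=
  ∀ c ∈ l, y c.1 = c.2

theorem matches_update {N : ℕ} {l : List (Fin N × Bool)} {f : Fin N} (hf : f ∉ l.map Prod.fst)
    (y : Fin N → Bool) (b : Bool) : Matches l (Function.update y f b) ↔ Matches l y := by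
  refine forall_congr' fun c => forall_congr' fun hc => ?_
  rw [Function.update_of_ne]
  rintro rfl
  exact hf (List.mem_map_of_mem hc)

/-- A controlled negation of a qubit `c` only relabels the states of another qubit `f`. -/
theorem ctrl_not_mulVec_qubitState {N : ℕ} {P : (Fin N → Bool) → Prop} {c f : Fin N}
    (hcf : c ≠ f) (hP : ∀ y b, P (Function.update y c b) ↔ P y)
    (hP' : ∀ y b, P (Function.update y f b) ↔ P y) (y : Fin N → Bool) (ψ : Bool → ℂ)
    [Decidable (P y)] : ctrl P c notMatrix *ᵥ qubitState f y ψ =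
      qubitState f (if P y then Function.update y c (!(y c)) else y) ψ := by
  classical
  have key : ∀ b, ctrl P c notMatrix *ᵥ ket (Function.update y f b) =
      ket (Function.update (if P y then Function.update y c (!(y c)) else y) f b) := by
    intro b
    rw [ctrl_mulVec_ket _ (hP _)]
    simp only [hP', Function.update_of_ne hcf, notMatrix_mulVec_ket]
    split_ifs with h
    · rw [Function.update_comm hcf, ket_eq_qubitState c (Function.update _ c _)]
      simp only [Function.update_self]
      exact qubitState_congr _ fun j hj => by simp [hj]
    · rw [ket_eq_qubitState c (Function.update y f b), Function.update_of_ne hcf]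
  simp only [qubitState, Matrix.mulVec_add, Matrix.mulVec_smul, key]

/-- The decomposition of a controlled gate `V²` whose condition is the conjunction of `P` and the
value of the qubit `c`: the exponents of `V` add up to `p + c - (p ⊕ c) = 2 p c`. -/
theorem ctrl_and_eq {N : ℕ} {P : (Fin N → Bool) → Prop} {c f : Fin N} (hcf : c ≠ f) (v : Bool)
    (hP : ∀ y b, P (Function.update y c b) ↔ P y) (hP' : ∀ y b, P (Function.update y f b) ↔ P y)
    {V V' : Matrix Bool Bool ℂ} (h : V * V' = 1) (h' : V' * V = 1) :
    ctrl (fun y => y c = v ∧ P y) f (V * V) =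
      ctrl (fun y => y c = v) f V * (ctrl P c notMatrix * (ctrl (fun y => y c = v) f V' *
        (ctrl P c notMatrix * ctrl P f V))) := by
  classical
  refine Matrix.ext_ket fun y => ?_
  have hc : ∀ (y : Fin N → Bool) b, (Function.update y f b) c = v ↔ y c = v := by
    simp [Function.update_of_ne hcf]
  have hQ : ∀ b, ((Function.update y f b) c = v ∧ P (Function.update y f b)) ↔
      (y c = v ∧ P y) := fun b => and_congr (hc y b) (hP' y b)
  simp only [← Matrix.mulVec_mulVec]
  rw [ket_eq_qubitState f y, ctrl_mulVec_qubitState _ hQ,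
    ctrl_mulVec_qubitState _ (hP' y), ctrl_not_mulVec_qubitState hcf hP hP',
    ctrl_mulVec_qubitState _ (hc _), ctrl_not_mulVec_qubitState hcf hP hP',
    ctrl_mulVec_qubitState _ (hc _)]
  have h1 : ∀ ψ : Bool → ℂ, V *ᵥ V' *ᵥ ψ = ψ := fun ψ => by rw [Matrix.mulVec_mulVec, h]; simp
  have h2 : ∀ ψ : Bool → ℂ, V' *ᵥ V *ᵥ ψ = ψ := fun ψ => by rw [Matrix.mulVec_mulVec, h']; simp
  by_cases hp : P y
  · by_cases hy : y c = v
    · subst hy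
      simp [hp, hP]
    · obtain rfl : (!(y c)) = v := by cases hv : v <;> simp_all
      simp [hp, hP, h2]
  · by_cases hy : y c = v <;> simp [hp, hy, h1]

/-- A phase gate with `m` controls is a product of two gates with one control, two negations with
`m - 1` controls and a square root of the gate with `m - 1` controls, by `ctrl_and_eq`. A negation
is a phase gate too (`phaseGate_minusProj`). -/
theorem realizable_ctrl {N : ℕ} (hN : 2 ≤ N) : ∀ (l : List (Fin N × Bool)) (f : Fin N),
    (l.map Prod.fst).Nodup → f ∉ l.map Prod.fst → ∀ (E : Matrix Bool Bool ℂ) (z : ℂ),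
    IsStarProjection E → ‖z‖ = 1 →
    Realizable (2 * N * 3 ^ (l.length + 1)) (ctrl (Matches l) f (phaseGate E z)) := by
  have sq : ∀ z : ℂ, ‖z‖ = 1 → ∃ w : ℂ, w * w = z ∧ ‖w‖ = 1 := by
    intro z hz
    obtain ⟨w, rfl⟩ := IsAlgClosed.exists_pow_nat_eq z (n := 2) (by norm_num)
    refine ⟨w, (sq w).symm, ?_⟩
    rw [norm_pow] at hz
    nlinarith [norm_nonneg w]
  -- With the bound `B m` for `m` controls, `B (m + 1) = 3 * B m + 4 * N` and `B 0 = 4 * N`.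
  suffices H : ∀ (l : List (Fin N × Bool)) (f : Fin N),
    (l.map Prod.fst).Nodup → f ∉ l.map Prod.fst → ∀ (E : Matrix Bool Bool ℂ) (z : ℂ),
    IsStarProjection E → ‖z‖ = 1 →
    Realizable (2 * N * 3 ^ (l.length + 1) - 2 * N) (ctrl (Matches l) f (phaseGate E z)) from
    fun l f h1 h2 E z hE hz => (H l f h1 h2 E z hE hz).mono (Nat.sub_le _ _)
  intro l
  induction l with
  | nil =>
    -- All gates act on two qubits: the uncontrolled gate is controlled by both values of some `g`.
    intro f _ _ E z hE hz
    obtain ⟨g, hg⟩ : ∃ g : Fin N, g ≠ f := by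
      have : Nontrivial (Fin N) := Fin.nontrivial_iff_two_le.2 hN
      exact exists_ne f
    have hm := phaseGate_mem hE hz
    have := (realizable_ctrl_single true ⟨_, hm⟩ hg).mul (realizable_ctrl_single false ⟨_, hm⟩ hg)
    have e : ctrl (Matches []) f (phaseGate E z) = ctrl (fun y => y g = true) f (phaseGate E z) *
        ctrl (fun y => y g = false) f (phaseGate E z) := by
      classical
      refine Matrix.ext_ket fun y => ?_
      rw [← Matrix.mulVec_mulVec, ket_eq_qubitState f y,
        ctrl_mulVec_qubitState _ (by simp [Matches]),
        ctrl_mulVec_qubitState _ (by simp [Function.update_of_ne hg]),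
        ctrl_mulVec_qubitState _ (by simp [Function.update_of_ne hg])]
      cases hy : y g <;> simp [Matches]
    rw [e]
    exact this.mono (by simp; omega)
  | cons p l ih =>
    intro f hnd hf E z hE hz
    obtain ⟨c, v⟩ := p
    simp only [List.map_cons, List.nodup_cons, List.mem_cons, not_or] at hnd hf
    obtain ⟨w, rfl, hw⟩ := sq z hz
    have hcf : c ≠ f := Ne.symm hf.1
    have hw' : star w * w = 1 := by
      rw [Complex.star_def, mul_comm, Complex.mul_conj, Complex.normSq_eq_norm_sq, hw]
      simp
    have hM : Matches ((c, v) :: l) = fun y => y c = v ∧ Matches l y := by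
      funext y; simp [Matches]
    rw [← phaseGate_mul hE, hM, ctrl_and_eq hcf v (matches_update hnd.1) (matches_update hf.2)
        (V := phaseGate E w) (V' := phaseGate E (star w))
        (by rw [phaseGate_mul hE, mul_comm, hw', phaseGate_one])
        (by rw [phaseGate_mul hE, hw', phaseGate_one])]
    have hX : Realizable (2 * N * 3 ^ (l.length + 1) - 2 * N)
        (ctrl (Matches l) c notMatrix) := by
      rw [← phaseGate_minusProj]
      exact ih c hnd.2 hnd.1 _ _ isStarProjection_minusProj (by simp)
    have hV := ih f hnd.2 hf.2 E w hE hw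
    have hC := realizable_ctrl_single v ⟨_, phaseGate_mem hE hw⟩ hcf
    have hC' := realizable_ctrl_single v
      ⟨_, phaseGate_mem hE (z := star w) (by simpa using hw)⟩ hcf
    refine (hC.mul (hX.mul (hC'.mul (hX.mul hV)))).mono ?_
    have h3 : 2 * N ≤ 2 * N * 3 ^ (l.length + 1) := Nat.le_mul_of_pos_right _ (by positivity)
    rw [List.length_cons, pow_succ 3 (l.length + 1), ← mul_assoc]
    omega

/-! ### Products in which one factor acts -/

theorem listProd_mulVec_fixed {ι κ : Type*} [Fintype κ] [DecidableEq κ]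
    {A : ι → Matrix κ κ ℂ} {v : κ → ℂ} (l : List ι) (h : ∀ j ∈ l, A j *ᵥ v = v) :
    (l.map A).prod *ᵥ v = v := by
  induction l with
  | nil => simp
  | cons j l ih =>
    rw [List.map_cons, List.prod_cons, ← Matrix.mulVec_mulVec, ih fun i hi => h i (by simp [hi]),
      h j (by simp)]

theorem listProd_mulVec_of_mem {ι κ : Type*} [Fintype κ] [DecidableEq κ]
    {A : ι → Matrix κ κ ℂ} {v w : κ → ℂ} {i : ι} {l : List ι} (hl : l.Nodup) (hi : i ∈ l)
    (hvw : A i *ᵥ v = w) (hv : ∀ j ∈ l, j ≠ i → A j *ᵥ v = v)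
    (hw : ∀ j ∈ l, j ≠ i → A j *ᵥ w = w) : (l.map A).prod *ᵥ v = w := by
  obtain ⟨s, t, rfl⟩ := List.append_of_mem hi
  have hs : ∀ j ∈ s, j ≠ i := fun j hj e => by
    subst e; exact (List.disjoint_of_nodup_append hl) hj (by simp)
  have ht : ∀ j ∈ t, j ≠ i := fun j hj e => by
    subst e; exact (List.nodup_cons.1 (List.nodup_append.1 hl).2.1).1 hj
  rw [List.map_append, List.map_cons, List.prod_append, List.prod_cons, ← Matrix.mulVec_mulVec,
    ← Matrix.mulVec_mulVec,
    listProd_mulVec_fixed t fun j hj => hv j (by simp [hj]) (ht j hj), hvw,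
    listProd_mulVec_fixed s fun j hj => hw j (by simp [hj]) (hs j hj)]

/-! ### Reversible classical computations -/

/-- A multiply controlled negation: the controls, as pairs (qubit, value), and the target. -/
abbrev NotStep (N : ℕ) : Type := List (Fin N × Bool) × Fin N

open Classical in
/-- The action of a controlled negation on a bit string. -/
def NotStep.run {N : ℕ} (s : NotStep N) (y : Fin N → Bool) : Fin N → Bool :=
  if Matches s.1 y then Function.update y s.2 (!(y s.2)) else y

/-- The action of a sequence of controlled negations, the first entry being performed first. -/
def runSteps {N : ℕ} (S : List (NotStep N)) (y : Fin N → Bool) : Fin N → Bool :=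
  S.foldl (fun y s => NotStep.run s y) y

/-- The operator of a sequence of controlled negations. -/
def stepsMatrix {N : ℕ} (S : List (NotStep N)) : Matrix (Fin N → Bool) (Fin N → Bool) ℂ :=
  (S.reverse.map fun s => ctrl (Matches s.1) s.2 notMatrix).prod

/-- The target and the controls of a controlled negation are different qubits, and there are at
most `m` controls. -/
structure NotStep.WellFormed {N : ℕ} (m : ℕ) (s : NotStep N) : Prop where
  nodup : (s.1.map Prod.fst).Nodup
  target : s.2 ∉ s.1.map Prod.fst
  length_le : s.1.length ≤ m

theorem runSteps_append {N : ℕ} (S S' : List (NotStep N)) (y : Fin N → Bool) :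
    runSteps (S ++ S') y = runSteps S' (runSteps S y) :=
  List.foldl_append

theorem runSteps_cons {N : ℕ} (s : NotStep N) (S : List (NotStep N)) (y : Fin N → Bool) :
    runSteps (s :: S) y = runSteps S (NotStep.run s y) := rfl

theorem NotStep.mulVec_ket {N : ℕ} {s : NotStep N} (hs : s.2 ∉ s.1.map Prod.fst)
    (y : Fin N → Bool) : ctrl (Matches s.1) s.2 notMatrix *ᵥ ket y = ket (NotStep.run s y) := by
  classical
  rw [ctrl_mulVec_ket _ (matches_update hs y), NotStep.run]
  split_ifs with h
  · rw [notMatrix_mulVec_ket, ket_eq_qubitState s.2 (Function.update y s.2 _),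
      Function.update_self]
    exact qubitState_congr _ fun j hj => by simp [hj]
  · rw [← ket_eq_qubitState]

theorem stepsMatrix_mulVec_ket {N m : ℕ} (S : List (NotStep N))
    (hS : ∀ s ∈ S, NotStep.WellFormed m s) (y : Fin N → Bool) :
    stepsMatrix S *ᵥ ket y = ket (runSteps S y) := by
  induction S generalizing y with
  | nil => simp [stepsMatrix, runSteps]
  | cons s S ih =>
    have : stepsMatrix (s :: S) = stepsMatrix S * ctrl (Matches s.1) s.2 notMatrix := by
      simp [stepsMatrix]
    rw [this, ← Matrix.mulVec_mulVec, NotStep.mulVec_ket (hS s (by simp)).target,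
      ih fun s hs => hS s (by simp [hs]), runSteps_cons]

theorem realizable_ctrl_of_length_le {N m : ℕ} (hN : 2 ≤ N) {l : List (Fin N × Bool)} {f : Fin N}
    (hnd : (l.map Prod.fst).Nodup) (hf : f ∉ l.map Prod.fst) (hm : l.length ≤ m)
    {E : Matrix Bool Bool ℂ} (hE : IsStarProjection E) {z : ℂ} (hz : ‖z‖ = 1) :
    Realizable (2 * N * 3 ^ (m + 1)) (ctrl (Matches l) f (phaseGate E z)) :=
  (realizable_ctrl hN l f hnd hf E z hE hz).mono
    (Nat.mul_le_mul_left _ (Nat.pow_le_pow_right (by norm_num) (by omega)))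

theorem realizable_stepsMatrix {N m : ℕ} (hN : 2 ≤ N) (S : List (NotStep N))
    (hS : ∀ s ∈ S, NotStep.WellFormed m s) :
    Realizable (S.length * (2 * N * 3 ^ (m + 1))) (stepsMatrix S) := by
  rw [← List.length_reverse]
  refine Realizable.listProd _ _ fun s hs => ?_
  have h := hS s (List.mem_reverse.1 hs)
  rw [← phaseGate_minusProj]
  exact realizable_ctrl_of_length_le hN h.nodup h.target h.length_le isStarProjection_minusProj
    (by simp)

/-! ### Counting with a token -/

/-- The steps that move a token which sits on one of the qubits `T 0, …, T (P - 1)` to the next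
qubit, provided that the bit string agrees with `l`. -/
def shiftSteps {N : ℕ} (T : ℕ → Fin N) (l : List (Fin N × Bool)) : ℕ → List (NotStep N)
  | 0 => []
  | P + 1 => ((T P, true) :: l, T (P + 1)) :: ((T (P + 1), true) :: l, T P) :: shiftSteps T l P

theorem runSteps_shiftSteps_of_not_matches {N : ℕ} (T : ℕ → Fin N) {l : List (Fin N × Bool)}
    {y : Fin N → Bool} (h : ¬ Matches l y) (P : ℕ) : runSteps (shiftSteps T l P) y = y := by
  have h' : ∀ p, ¬ Matches (p :: l) y := fun p hp => h fun c hc => hp c (by simp [hc])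
  induction P with
  | zero => rfl
  | succ P ih =>
    rw [shiftSteps, runSteps_cons, NotStep.run, if_neg (h' _), runSteps_cons, NotStep.run,
      if_neg (h' _), ih]

theorem runSteps_shiftSteps_of_false {N : ℕ} (T : ℕ → Fin N) {l : List (Fin N × Bool)}
    {y : Fin N → Bool} (P : ℕ) (h : ∀ p ≤ P, y (T p) = false) :
    runSteps (shiftSteps T l P) y = y := by
  have h' : ∀ p ≤ P, ¬ Matches ((T p, true) :: l) y := fun p hp hm => by
    have := hm (T p, true) (by simp)
    simp [h p hp] at this
  induction P with
  | zero => rfl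
  | succ P ih =>
    rw [shiftSteps, runSteps_cons, NotStep.run, if_neg (h' _ (by simp)), runSteps_cons,
      NotStep.run, if_neg (h' _ (by simp)),
      ih (fun p hp => h p (by omega)) (fun p hp => h' p (by omega))]

/-- Only the negations for the place `c` of the token apply: the first one puts a token on the place
`c + 1`, the second one removes that at `c`. Going through the places in descending order makes the
token move only once. -/
theorem runSteps_shiftSteps {N M : ℕ} {T : ℕ → Fin N} (hT : Set.InjOn T (Set.Iic M))
    {l : List (Fin N × Bool)} (hl : ∀ p ≤ M, T p ∉ l.map Prod.fst) {y : Fin N → Bool}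
    (hy : ∀ p ≤ M, y (T p) = false) (hm : Matches l y) (P : ℕ) (hP : P ≤ M) (c : ℕ) (hc : c < P) :
    runSteps (shiftSteps T l P) (Function.update y (T c) true) =
      Function.update y (T (c + 1)) true := by
  have hne : ∀ p q, p ≤ M → q ≤ M → p ≠ q → T p ≠ T q := fun p q hp hq h e => h (hT hp hq e)
  induction P with
  | zero => omega
  | succ P ih =>
    rcases Nat.lt_or_ge c P with h | h
    · have h1 : ∀ p, p ≤ M → p ≠ c →
          ¬ Matches ((T p, true) :: l) (Function.update y (T c) true) := fun p hp hpc hm => by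
        have := hm (T p, true) (by simp)
        simp [hne p c hp (by omega) hpc, hy p hp] at this
      rw [shiftSteps, runSteps_cons, NotStep.run, if_neg (h1 _ (by omega) (by omega)),
        runSteps_cons, NotStep.run, if_neg (h1 _ (by omega) (by omega)), ih (by omega) h]
    · obtain rfl : c = P := by omega
      have hne' := hne (c + 1) c hP (by omega) (by omega)
      have h1 : Matches ((T c, true) :: l) (Function.update y (T c) true) := by
        intro p hp
        rcases List.mem_cons.1 hp with rfl | hp
        · simp
        · exact (matches_update (hl c (by omega)) y true).2 hm p hp
      have h2 : Matches ((T (c + 1), true) :: l)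
          (Function.update (Function.update y (T c) true) (T (c + 1)) true) := by
        intro p hp
        rcases List.mem_cons.1 hp with rfl | hp
        · simp
        · exact (matches_update (hl (c + 1) hP) _ true).2
            ((matches_update (hl c (by omega)) y true).2 hm) p hp
      have h3 : Function.update (Function.update (Function.update y (T c) true) (T (c + 1)) true)
          (T c) false = Function.update y (T (c + 1)) true := by
        rw [Function.update_comm hne', Function.update_idem, ← hy c (by omega),
          Function.update_eq_self]
      rw [shiftSteps, runSteps_cons, NotStep.run, if_pos h1]
      simp only [Function.update_of_ne hne', hy _ hP, Bool.not_false]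
      rw [runSteps_cons, NotStep.run, if_pos h2]
      simp only [Function.update_of_ne hne'.symm, Function.update_self, Bool.not_true]
      rw [h3]
      refine runSteps_shiftSteps_of_false T c fun p hp => ?_
      rw [Function.update_of_ne (hne p (c + 1) (by omega) hP (by omega)), hy p (by omega)]

open Classical in
/-- A sequence of conditional shifts moves the token by the number of conditions that hold. -/
theorem runSteps_flatMap_shiftSteps {N M : ℕ} {T : ℕ → Fin N} (hT : Set.InjOn T (Set.Iic M))
    {y : Fin N → Bool} (hy : ∀ p ≤ M, y (T p) = false) (I : List (List (Fin N × Bool)))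
    (hI : ∀ l ∈ I, ∀ p ≤ M, T p ∉ l.map Prod.fst) (c : ℕ)
    (hc : c + I.countP (fun l => Matches l y) ≤ M) :
    runSteps (I.flatMap fun l => shiftSteps T l M) (Function.update y (T c) true) =
      Function.update y (T (c + I.countP (fun l => Matches l y))) true := by
  induction I generalizing c with
  | nil => rfl
  | cons l I ih =>
    rw [List.flatMap_cons, runSteps_append]
    have hl := hI l (by simp)
    have hI' : ∀ l ∈ I, ∀ p ≤ M, T p ∉ l.map Prod.fst := fun l' h => hI l' (by simp [h])
    by_cases hm : Matches l y
    · rw [List.countP_cons_of_pos (by simpa using hm)] at hc ⊢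
      rw [runSteps_shiftSteps hT hl hy hm M le_rfl c (by omega), ih hI' _ (by omega)]
      congr 2
      omega
    · rw [List.countP_cons_of_neg (by simpa using hm)] at hc ⊢
      rw [runSteps_shiftSteps_of_not_matches, ih hI' _ hc]
      rwa [matches_update (hl c (by omega))]

theorem length_shiftSteps {N : ℕ} (T : ℕ → Fin N) (l : List (Fin N × Bool)) (P : ℕ) :
    (shiftSteps T l P).length = 2 * P := by
  induction P with
  | zero => rfl
  | succ P ih => rw [shiftSteps, List.length_cons, List.length_cons, ih]; ring

theorem shiftSteps_wellFormed {N M m : ℕ} {T : ℕ → Fin N} (hT : Set.InjOn T (Set.Iic M))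
    {l : List (Fin N × Bool)} (hl : ∀ p ≤ M, T p ∉ l.map Prod.fst)
    (hnd : (l.map Prod.fst).Nodup) (hlen : l.length + 1 ≤ m) (P : ℕ) (hP : P ≤ M) :
    ∀ s ∈ shiftSteps T l P, NotStep.WellFormed m s := by
  have hne : ∀ p q, p ≤ M → q ≤ M → p ≠ q → T p ≠ T q := fun p q hp hq h e => h (hT hp hq e)
  have key : ∀ p q, p ≤ M → q ≤ M → p ≠ q → NotStep.WellFormed m ((T p, true) :: l, T q) := by
    intro p q hp hq hpq
    refine ⟨?_, ?_, by simpa using hlen⟩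
    · rw [List.map_cons, List.nodup_cons]
      exact ⟨hl p hp, hnd⟩
    · rw [List.map_cons, List.mem_cons, not_or]
      exact ⟨hne q p hq hp hpq.symm, hl q hq⟩
  induction P with
  | zero => simp [shiftSteps]
  | succ P ih =>
    intro s hs
    rw [shiftSteps, List.mem_cons, List.mem_cons] at hs
    rcases hs with rfl | rfl | hs
    · exact key _ _ (by omega) hP (by omega)
    · exact key _ _ hP (by omega) (by omega)
    · exact ih (by omega) s hs

/-! ### Conditional negation of several qubits -/

theorem runSteps_map_target {N : ℕ} (f : Fin N) (ts : List (Fin N)) (hnd : ts.Nodup)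
    (hf : f ∉ ts) (y : Fin N → Bool) :
    runSteps (ts.map fun q => ([(f, true)], q)) y =
      if y f then fun q => if q ∈ ts then !(y q) else y q else y := by
  induction ts generalizing y with
  | nil => simp [runSteps]
  | cons t ts ih =>
    simp only [List.mem_cons, not_or] at hf
    rw [List.nodup_cons] at hnd
    rw [List.map_cons, runSteps_cons, ih hnd.2 hf.2]
    by_cases hy : y f = true
    · have : NotStep.run ([(f, true)], t) y = Function.update y t (!(y t)) := by
        rw [NotStep.run, if_pos (by simpa [Matches] using hy)]
      rw [this, Function.update_of_ne hf.1, if_pos hy, if_pos hy]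
      funext q
      by_cases hq : q = t
      · subst hq; simp [hnd.1]
      · simp [hq]
    · have : NotStep.run ([(f, true)], t) y = y := by
        rw [NotStep.run, if_neg (by simpa [Matches] using hy)]
      rw [this, if_neg hy, if_neg hy]

/-! ### Operators controlled by the token -/

/-- The product of the operators `W p` on the qubit `f`, each controlled by the presence of the
token at `p` and by `l`. -/
def tokenCtrl {N : ℕ} (T : ℕ → Fin N) (l : List (Fin N × Bool)) (f : Fin N)
    (W : ℕ → Matrix Bool Bool ℂ) (M : ℕ) : Matrix (Fin N → Bool) (Fin N → Bool) ℂ :=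
  ((List.range (M + 1)).map fun p => ctrl (Matches ((T p, true) :: l)) f (W p)).prod

theorem tokenCtrl_mulVec_of_not_matches {N : ℕ} {T : ℕ → Fin N} {l : List (Fin N × Bool)}
    {f : Fin N} {W : ℕ → Matrix Bool Bool ℂ} {M : ℕ} (hfl : f ∉ l.map Prod.fst)
    (hfT : ∀ p ≤ M, f ≠ T p) {y : Fin N → Bool} (h : ¬ Matches l y) :
    tokenCtrl T l f W M *ᵥ ket y = ket y := by
  rw [ket_eq_qubitState f]
  refine listProd_mulVec_fixed _ fun p hp => ?_
  have hp' : p ≤ M := Nat.lt_succ_iff.1 (List.mem_range.1 hp)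
  refine ctrl_mulVec_qubitState_neg _ (fun b => matches_update ?_ y b)
    (fun hm => h fun c hc => hm c (by simp [hc])) _
  rw [List.map_cons, List.mem_cons, not_or]
  exact ⟨hfT p hp', hfl⟩

theorem tokenCtrl_mulVec_of_matches {N : ℕ} {T : ℕ → Fin N} {l : List (Fin N × Bool)}
    {f : Fin N} {W : ℕ → Matrix Bool Bool ℂ} {M : ℕ} (hfl : f ∉ l.map Prod.fst)
    (hfT : ∀ p ≤ M, f ≠ T p) {y : Fin N → Bool} (h : Matches l y) {c : ℕ} (hc : c ≤ M)
    (hy : ∀ p ≤ M, y (T p) = true ↔ p = c) (ψ : Bool → ℂ) :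
    tokenCtrl T l f W M *ᵥ qubitState f y ψ = qubitState f y (W c *ᵥ ψ) := by
  have hf : ∀ p ≤ M, f ∉ ((T p, true) :: l).map Prod.fst := by
    intro p hp
    rw [List.map_cons, List.mem_cons, not_or]
    exact ⟨hfT p hp, hfl⟩
  have hM : ∀ p ≤ M, Matches ((T p, true) :: l) y ↔ p = c := by
    intro p hp
    rw [← hy p hp]
    simp only [Matches, List.mem_cons, forall_eq_or_imp, and_iff_left_iff_imp]
    exact fun _ => h
  have hfix : ∀ p ∈ List.range (M + 1), p ≠ c → ∀ ψ, ctrl (Matches ((T p, true) :: l)) f (W p) *ᵥ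
      qubitState f y ψ = qubitState f y ψ := fun p hp hpc ψ => by
    have hp' : p ≤ M := Nat.lt_succ_iff.1 (List.mem_range.1 hp)
    exact ctrl_mulVec_qubitState_neg _ (matches_update (hf p hp') y) (by rwa [hM p hp']) _
  refine listProd_mulVec_of_mem List.nodup_range (i := c) (by simp; omega) ?_
    (fun p hp hpc => hfix p hp hpc _) (fun p hp hpc => hfix p hp hpc _)
  exact ctrl_mulVec_qubitState_pos _ (matches_update (hf c hc) y) ((hM c hc).2 rfl) _

theorem realizable_tokenCtrl {N m M : ℕ} (hN : 2 ≤ N) {T : ℕ → Fin N} {l : List (Fin N × Bool)}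
    {f : Fin N} (hfl : f ∉ l.map Prod.fst) (hfT : ∀ p ≤ M, f ≠ T p)
    (hl : ∀ p ≤ M, T p ∉ l.map Prod.fst) (hnd : (l.map Prod.fst).Nodup) (hlen : l.length + 1 ≤ m)
    {E : ℕ → Matrix Bool Bool ℂ} (hE : ∀ p, IsStarProjection (E p)) {z : ℂ} (hz : ‖z‖ = 1) :
    Realizable ((M + 1) * (2 * N * 3 ^ (m + 1)))
      (tokenCtrl T l f (fun p => phaseGate (E p) z) M) := by
  have := Realizable.listProd (N := N) (L := 2 * N * 3 ^ (m + 1)) (List.range (M + 1))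
    (fun p => ctrl (Matches ((T p, true) :: l)) f (phaseGate (E p) z)) fun p hp => by
      have hp' : p ≤ M := Nat.lt_succ_iff.1 (List.mem_range.1 hp)
      refine realizable_ctrl_of_length_le hN ?_ ?_ (by simpa using hlen) (hE p) hz
      · rw [List.map_cons, List.nodup_cons]
        exact ⟨hl p hp', hnd⟩
      · rw [List.map_cons, List.mem_cons, not_or]
        exact ⟨hfT p hp', hfl⟩
  rwa [List.length_range] at this

/-! ### The coefficients `a(d)` -/

section Coefficients

variable {ℓ : ℕ}

theorem sin_pi_div_pos (hℓ : 3 ≤ ℓ) : 0 < Real.sin (Real.pi / ℓ) := by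
  have h : (3 : ℝ) ≤ ℓ := by exact_mod_cast hℓ
  refine Real.sin_pos_of_pos_of_lt_pi (by positivity) ?_
  rw [div_lt_iff₀ (by linarith)]
  nlinarith [Real.pi_pos]

theorem qInt_neg (d : ℤ) : qInt ℓ (-d) = -qInt ℓ d := by
  simp only [qInt, Int.cast_neg, mul_neg, neg_div, Real.sin_neg]

theorem qInt_zero : qInt ℓ 0 = 0 := by simp [qInt]

theorem qInt_one (hℓ : 3 ≤ ℓ) : qInt ℓ 1 = 1 := by
  simp [qInt, (sin_pi_div_pos hℓ).ne']

theorem qInt_self_sub (hℓ : 3 ≤ ℓ) (d : ℤ) : qInt ℓ (ℓ - d) = qInt ℓ d := by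
  have h : (ℓ : ℝ) ≠ 0 := by positivity
  have e : Real.pi * ((ℓ - d : ℤ) : ℝ) / ℓ = Real.pi - Real.pi * d / ℓ := by
    push_cast; field_simp
  rw [qInt, e, Real.sin_pi_sub, qInt]

theorem qInt_add_one (hℓ : 3 ≤ ℓ) (d : ℤ) : qInt ℓ (d + 1) = Real.sin (Real.pi * d / ℓ) *
    Real.cos (Real.pi / ℓ) / Real.sin (Real.pi / ℓ) + Real.cos (Real.pi * d / ℓ) := by
  have h := (sin_pi_div_pos hℓ).ne'
  have e : Real.pi * ((d + 1 : ℤ) : ℝ) / ℓ = Real.pi * d / ℓ + Real.pi / ℓ := by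
    push_cast; ring
  rw [qInt, e, Real.sin_add]
  field_simp

theorem qInt_sub_one (hℓ : 3 ≤ ℓ) (d : ℤ) : qInt ℓ (d - 1) = Real.sin (Real.pi * d / ℓ) *
    Real.cos (Real.pi / ℓ) / Real.sin (Real.pi / ℓ) - Real.cos (Real.pi * d / ℓ) := by
  have h := (sin_pi_div_pos hℓ).ne'
  have e : Real.pi * ((d - 1 : ℤ) : ℝ) / ℓ = Real.pi * d / ℓ - Real.pi / ℓ := by
    push_cast; ring
  rw [qInt, e, Real.sin_sub]
  field_simp

theorem qInt_two (hℓ : 3 ≤ ℓ) : qInt ℓ 2 = 2 * Real.cos (Real.pi / ℓ) := by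
  have h := (sin_pi_div_pos hℓ).ne'
  have e : Real.pi * ((2 : ℤ) : ℝ) / ℓ = 2 * (Real.pi / ℓ) := by push_cast; ring
  rw [qInt, e, Real.sin_two_mul]
  field_simp

theorem qInt_two_pos (hℓ : 3 ≤ ℓ) : 0 < qInt ℓ 2 := by
  have h : (3 : ℝ) ≤ ℓ := by exact_mod_cast hℓ
  rw [qInt_two hℓ]
  have : 0 < Real.cos (Real.pi / ℓ) := by
    refine Real.cos_pos_of_mem_Ioo ⟨?_, ?_⟩
    · have : 0 < Real.pi / ℓ := by positivity
      linarith [Real.pi_pos]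
    · rw [div_lt_div_iff₀ (by linarith) (by norm_num)]
      nlinarith [Real.pi_pos]
  linarith

theorem qInt_add_one_add_sub_one (hℓ : 3 ≤ ℓ) (d : ℤ) :
    qInt ℓ (d + 1) + qInt ℓ (d - 1) = qInt ℓ 2 * qInt ℓ d := by
  rw [qInt_add_one hℓ, qInt_sub_one hℓ, qInt_two hℓ, qInt]
  ring

theorem qInt_add_one_mul_sub_one (hℓ : 3 ≤ ℓ) (d : ℤ) :
    qInt ℓ (d + 1) * qInt ℓ (d - 1) = qInt ℓ d ^ 2 - 1 := by
  have h := (sin_pi_div_pos hℓ).ne'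
  rw [qInt_add_one hℓ, qInt_sub_one hℓ, qInt]
  field_simp
  linear_combination Real.sin (Real.pi * d / ℓ) ^ 2 * Real.sin_sq_add_cos_sq (Real.pi / ℓ)
    - Real.sin (Real.pi / ℓ) ^ 2 * Real.sin_sq_add_cos_sq (Real.pi * d / ℓ)

/-- The addition theorem behind `aCoeff_triangle`. -/
theorem qInt_cubic (hℓ : 3 ≤ ℓ) (u v : ℤ) :
    qInt ℓ (u + 1) * qInt ℓ (v + 1) * qInt ℓ (u + v)
      + qInt ℓ (u - 1) * qInt ℓ (u + v + 1) * qInt ℓ v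
      - qInt ℓ (v + 1) * qInt ℓ (u + v + 1) * qInt ℓ u
      = qInt ℓ u * qInt ℓ v * qInt ℓ (u + v) := by
  have h := (sin_pi_div_pos hℓ).ne'
  have e : Real.pi * ((u + v : ℤ) : ℝ) / ℓ = Real.pi * u / ℓ + Real.pi * v / ℓ := by
    push_cast; ring
  rw [qInt_add_one hℓ u, qInt_add_one hℓ v, qInt_add_one hℓ (u + v), qInt_sub_one hℓ, qInt, qInt,
    qInt, e, Real.sin_add, Real.cos_add]
  have h1 := Real.sin_sq_add_cos_sq (Real.pi / ℓ)
  have h2 := Real.sin_sq_add_cos_sq (Real.pi * u / ℓ)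
  have h3 := Real.sin_sq_add_cos_sq (Real.pi * v / ℓ)
  generalize Real.sin (Real.pi / ℓ) = s at *
  generalize Real.cos (Real.pi / ℓ) = c at *
  generalize Real.sin (Real.pi * u / ℓ) = su at *
  generalize Real.cos (Real.pi * u / ℓ) = cu at *
  generalize Real.sin (Real.pi * v / ℓ) = sv at *
  generalize Real.cos (Real.pi * v / ℓ) = cv at *
  field_simp
  grind

theorem qInt_ne_zero (hℓ : 3 ≤ ℓ) {d : ℤ} (h0 : d ≠ 0) (h1 : |d| < ℓ) : qInt ℓ d ≠ 0 := by
  have hpos : ∀ d : ℤ, 0 < d → d < ℓ → 0 < qInt ℓ d := by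
    intro d h0 h1
    have h0' : (0 : ℝ) < d := by exact_mod_cast h0
    have h1' : (d : ℝ) < ℓ := by exact_mod_cast h1
    refine div_pos (Real.sin_pos_of_pos_of_lt_pi (by positivity) ?_) (sin_pi_div_pos hℓ)
    rw [div_lt_iff₀ (by linarith)]
    exact mul_lt_mul_of_pos_left h1' Real.pi_pos
  rw [abs_lt] at h1
  rcases lt_or_gt_of_ne h0 with h | h
  · have := hpos (-d) (by omega) (by omega)
    rw [qInt_neg] at this
    linarith
  · exact (hpos d h h1.2).ne'

/-- `|sin(π d / ℓ)|` is at least `sin(π / ℓ)` unless it vanishes. This makes `a(d) a(-d)`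
nonnegative. -/
theorem one_le_qInt_sq (hℓ : 3 ≤ ℓ) {d : ℤ} (h : qInt ℓ d ≠ 0) : 1 ≤ qInt ℓ d ^ 2 := by
  have hs := sin_pi_div_pos hℓ
  have hℓ' : (3 : ℝ) ≤ ℓ := by exact_mod_cast hℓ
  have hℓ0 : (ℓ : ℝ) ≠ 0 := by positivity
  obtain ⟨r, q, hr0, hr1, hd⟩ : ∃ r q : ℤ, 0 ≤ r ∧ r < ℓ ∧ d = r + q * ℓ :=
    ⟨d % ℓ, d / ℓ, Int.emod_nonneg _ (by omega), Int.emod_lt_of_pos _ (by omega),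
      (Int.emod_add_ediv_mul d ℓ).symm⟩
  have e : Real.pi * (d : ℝ) / ℓ = Real.pi * r / ℓ + q * Real.pi := by
    rw [hd]; push_cast; field_simp
  have hsq : qInt ℓ d ^ 2 = qInt ℓ r ^ 2 := by
    rw [qInt, e, Real.sin_add_int_mul_pi, qInt, div_pow, div_pow, mul_pow, ← zpow_natCast,
      ← zpow_mul, mul_comm q, zpow_mul]
    simp
  have hr : 0 < r := by
    refine lt_of_le_of_ne hr0 fun h' => h ?_
    rw [← h', qInt_zero] at hsq
    simpa using hsq
  rw [hsq]
  have hr' : (1 : ℝ) ≤ r := by exact_mod_cast hr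
  have hr1' : (r : ℝ) ≤ ℓ - 1 := by
    have : r ≤ ℓ - 1 := by omega
    exact_mod_cast this
  have hge : 1 ≤ qInt ℓ r := by
    rw [qInt, one_le_div hs]
    have hx : Real.pi / ℓ ≤ Real.pi * r / ℓ := by
      rw [div_le_div_iff_of_pos_right (by linarith)]
      nlinarith [Real.pi_pos]
    have hx' : Real.pi * r / ℓ ≤ Real.pi - Real.pi / ℓ := by
      rw [div_le_iff₀ (by linarith), sub_mul, div_mul_cancel₀ _ hℓ0]
      nlinarith [Real.pi_pos]
    have hpos : 0 < Real.pi / ℓ := by positivity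
    rcases le_total (Real.pi * r / ℓ) (Real.pi / 2) with h2 | h2
    · exact Real.sin_le_sin_of_le_of_le_pi_div_two (by linarith) h2 hx
    · rw [← Real.sin_pi_sub (Real.pi * r / ℓ)]
      exact Real.sin_le_sin_of_le_of_le_pi_div_two (by linarith) (by linarith) (by linarith)
  nlinarith

theorem aCoeff_neg (d : ℤ) : aCoeff ℓ (-d) = qInt ℓ (d - 1) / (qInt ℓ 2 * qInt ℓ d) := by
  rw [aCoeff, qInt_neg, show -d + 1 = -(d - 1) by ring, qInt_neg, mul_neg, neg_div_neg_eq]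

theorem aCoeff_of_qInt_eq_zero {d : ℤ} (h : qInt ℓ d = 0) : aCoeff ℓ d = 0 := by
  simp [aCoeff, h]

theorem aCoeff_add_neg (hℓ : 3 ≤ ℓ) {d : ℤ} (h : qInt ℓ d ≠ 0) :
    aCoeff ℓ d + aCoeff ℓ (-d) = 1 := by
  have h2 := (qInt_two_pos hℓ).ne'
  rw [aCoeff_neg, aCoeff, ← add_div, qInt_add_one_add_sub_one hℓ, div_self (mul_ne_zero h2 h)]

theorem aCoeff_mul_neg_nonneg (hℓ : 3 ≤ ℓ) (d : ℤ) : 0 ≤ aCoeff ℓ d * aCoeff ℓ (-d) := by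
  by_cases h : qInt ℓ d = 0
  · simp [aCoeff_of_qInt_eq_zero h]
  · rw [aCoeff_neg, aCoeff, div_mul_div_comm, qInt_add_one_mul_sub_one hℓ]
    refine div_nonneg ?_ (mul_self_nonneg _)
    linarith [one_le_qInt_sq hℓ h]

/-- `√(a(d) a(-d))`. -/
def sCoeff (ℓ : ℕ) (d : ℤ) : ℝ := Real.sqrt (aCoeff ℓ d * aCoeff ℓ (-d))

theorem sCoeff_neg (d : ℤ) : sCoeff ℓ (-d) = sCoeff ℓ d := by
  rw [sCoeff, neg_neg, mul_comm, sCoeff]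

theorem sCoeff_mul_self (hℓ : 3 ≤ ℓ) (d : ℤ) :
    sCoeff ℓ d * sCoeff ℓ d = aCoeff ℓ d * aCoeff ℓ (-d) :=
  Real.mul_self_sqrt (aCoeff_mul_neg_nonneg hℓ d)

theorem sCoeff_of_qInt_eq_zero {d : ℤ} (h : qInt ℓ d = 0) : sCoeff ℓ d = 0 := by
  simp [sCoeff, aCoeff_of_qInt_eq_zero h]

/-- The diagonal entry of `e² = e`. It holds for `[d] = 0` too, where all coefficients are `0` by
the convention on division by zero. -/
theorem aCoeff_mul_self_add (hℓ : 3 ≤ ℓ) (d : ℤ) :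
    aCoeff ℓ d * aCoeff ℓ d + sCoeff ℓ d * sCoeff ℓ d = aCoeff ℓ d := by
  by_cases h : qInt ℓ d = 0
  · simp [sCoeff_of_qInt_eq_zero h, aCoeff_of_qInt_eq_zero h]
  · rw [sCoeff_mul_self hℓ, ← mul_add, aCoeff_add_neg hℓ h, mul_one]

/-- The off-diagonal entry of `e² = e`. -/
theorem sCoeff_mul_aCoeff_add (hℓ : 3 ≤ ℓ) (d : ℤ) :
    sCoeff ℓ d * (aCoeff ℓ d + aCoeff ℓ (-d)) = sCoeff ℓ d := by
  by_cases h : qInt ℓ d = 0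
  · simp [sCoeff_of_qInt_eq_zero h]
  · rw [aCoeff_add_neg hℓ h, mul_one]

/-- The parameter `1 / [2]²` of the Temperley–Lieb type relation. -/
def tauCoeff (ℓ : ℕ) : ℝ := 1 / qInt ℓ 2 ^ 2

/-- The off-diagonal and diagonal entries of the three-letter relation reduce to this identity when
the letters are different, `u` and `v` being the axial distances of neighbouring letters. -/
theorem aCoeff_triangle (hℓ : 3 ≤ ℓ) {u v : ℤ} (hu : qInt ℓ u ≠ 0) (hv : qInt ℓ v ≠ 0)
    (huv : qInt ℓ (u + v) ≠ 0) :
    aCoeff ℓ u * aCoeff ℓ v + aCoeff ℓ (-u) * aCoeff ℓ (u + v) - aCoeff ℓ v * aCoeff ℓ (u + v)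
      = tauCoeff ℓ := by
  have h2 := (qInt_two_pos hℓ).ne'
  have h := qInt_cubic hℓ u v
  rw [aCoeff_neg, aCoeff, aCoeff, aCoeff, tauCoeff]
  field_simp
  linear_combination h

/-- The identity to which the three-letter relation reduces when two of the letters agree. -/
theorem aCoeff_mul_neg_succ (hℓ : 3 ≤ ℓ) {d : ℤ} (h : qInt ℓ d ≠ 0) (h' : qInt ℓ (d + 1) ≠ 0) :
    aCoeff ℓ d * aCoeff ℓ (-(d + 1)) = tauCoeff ℓ := by
  have h2 := (qInt_two_pos hℓ).ne'
  rw [aCoeff_neg, aCoeff, tauCoeff, add_sub_cancel_right]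
  field_simp

theorem aCoeff_one (hℓ : 3 ≤ ℓ) : aCoeff ℓ 1 = 1 := by
  rw [aCoeff, qInt_one hℓ, mul_one]
  exact div_self (qInt_two_pos hℓ).ne'

theorem aCoeff_neg_one : aCoeff ℓ (-1) = 0 := by simp [aCoeff, qInt_zero]

theorem aCoeff_one_sub_self (hℓ : 3 ≤ ℓ) : aCoeff ℓ (1 - ℓ) = 1 := by
  rw [show (1 - ℓ : ℤ) = -(ℓ - 1) by ring, aCoeff_neg, qInt_self_sub hℓ, qInt_one hℓ,
    show (ℓ - 1 - 1 : ℤ) = ℓ - 2 by ring, qInt_self_sub hℓ, mul_one]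
  exact div_self (qInt_two_pos hℓ).ne'

theorem aCoeff_self_sub_one : aCoeff ℓ (ℓ - 1) = 0 := by
  rcases Nat.eq_zero_or_pos ℓ with rfl | h
  · simp [aCoeff, qInt]
  · have h : (ℓ : ℝ) ≠ 0 := by positivity
    have : qInt ℓ (ℓ - 1 + 1) = 0 := by
      rw [sub_add_cancel, qInt]
      simp [h]
    rw [aCoeff, this, zero_div]

theorem qRoot_mul_star (ℓ : ℕ) : qRoot ℓ * star (qRoot ℓ) = 1 := by
  have h : ‖qRoot ℓ‖ = 1 := by
    rw [qRoot, show 2 * (Real.pi : ℂ) * Complex.I / ℓ = ((2 * Real.pi / ℓ : ℝ) : ℂ) * Complex.I by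
      push_cast; ring]
    exact Complex.norm_exp_ofReal_mul_I _
  rw [Complex.star_def, Complex.mul_conj, Complex.normSq_eq_norm_sq, h]
  simp

theorem norm_qRoot (ℓ : ℕ) : ‖qRoot ℓ‖ = 1 := by
  have := congrArg norm (qRoot_mul_star ℓ)
  rw [norm_mul, norm_star, norm_one] at this
  nlinarith [norm_nonneg (qRoot ℓ)]

/-- `τ = q / (1 + q)²`, because `[2] = q^{1/2} + q^{-1/2}`. -/
theorem one_add_qRoot_sq (hℓ : 3 ≤ ℓ) : (1 + qRoot ℓ) ^ 2 * (tauCoeff ℓ : ℂ) = qRoot ℓ := by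
  have h2 : (qInt ℓ 2 : ℂ) ≠ 0 := by exact_mod_cast (qInt_two_pos hℓ).ne'
  have h : (1 + qRoot ℓ) ^ 2 = qRoot ℓ * (qInt ℓ 2 : ℂ) ^ 2 := by
    have e1 : qRoot ℓ = Complex.exp ((Real.pi / ℓ : ℂ) * Complex.I) *
        Complex.exp ((Real.pi / ℓ : ℂ) * Complex.I) := by
      rw [← Complex.exp_add, qRoot]
      congr 1
      ring
    have e2 : (qInt ℓ 2 : ℂ) = Complex.exp ((Real.pi / ℓ : ℂ) * Complex.I) +
        Complex.exp (-(Real.pi / ℓ : ℂ) * Complex.I) := by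
      rw [qInt_two hℓ]
      push_cast
      rw [Complex.two_cos]
    have e3 : Complex.exp ((Real.pi / ℓ : ℂ) * Complex.I) *
        Complex.exp (-(Real.pi / ℓ : ℂ) * Complex.I) = 1 := by
      rw [← Complex.exp_add]
      simp
    rw [e2, e1]
    generalize Complex.exp ((Real.pi / ℓ : ℂ) * Complex.I) = x at *
    generalize Complex.exp (-(Real.pi / ℓ : ℂ) * Complex.I) = y at *
    linear_combination (-1 - 2 * x ^ 2 - x * y) * e3
  rw [h, tauCoeff]
  push_cast
  field_simp

end Coefficients

/-! ### The projections on words -/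

variable {n k : ℕ}

/-- The number of letters `a` among the first `m` letters of `r`. -/
def letterCount (r : Fin n → Fin k) (m : ℕ) (a : Fin k) : ℕ :=
  (Finset.univ.filter fun j : Fin n => j.val < m ∧ r j = a).card

/-- The content of the box that is next to be added in row `a`, when the first `m` letters of `r`
are read as the rows of the boxes `1, …, m`. -/
def wordContent (r : Fin n → Fin k) (m : ℕ) (a : Fin k) : ℤ := letterCount r m a - (a : ℤ)

/-- The difference of the contents of the rows given by the letters `i` and `i + 1` of `r`. For
different letters it is the axial distance of `i` and `i + 1`. -/
def wordDist (r : Fin n → Fin k) (i : Fin (n - 1)) : ℤ :=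
  wordContent r i (r (leftPos i)) - wordContent r i (r (rightPos i))

/-- The word `r` with the letters `i` and `i + 1` exchanged. -/
def swapWord (r : Fin n → Fin k) (i : Fin (n - 1)) : Fin n → Fin k :=
  r ∘ Equiv.swap (leftPos i) (rightPos i)

/-- The extension of the projection `π(e_i)` to all words, whether or not they come from
`(k, ℓ)`-tableaux. -/
def wordProj (k n ℓ : ℕ) (i : Fin (n - 1)) : Matrix (Fin n → Fin k) (Fin n → Fin k) ℂ :=
  fun s r =>
    if r (leftPos i) = r (rightPos i) then 0
    else (aCoeff ℓ (wordDist r i) : ℂ) * ket r s +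
      (sCoeff ℓ (wordDist r i) : ℂ) * ket (swapWord r i) s

theorem wordProj_mulVec_ket_of_eq {ℓ : ℕ} {i : Fin (n - 1)} {r : Fin n → Fin k}
    (h : r (leftPos i) = r (rightPos i)) : wordProj k n ℓ i *ᵥ ket r = 0 := by
  ext s
  rw [mulVec_ket_apply, wordProj, if_pos h]
  rfl

theorem wordProj_mulVec_ket_of_ne {ℓ : ℕ} {i : Fin (n - 1)} {r : Fin n → Fin k}
    (h : r (leftPos i) ≠ r (rightPos i)) : wordProj k n ℓ i *ᵥ ket r =
      (aCoeff ℓ (wordDist r i) : ℂ) • ket r +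
        (sCoeff ℓ (wordDist r i) : ℂ) • ket (swapWord r i) := by
  ext s
  rw [mulVec_ket_apply, wordProj, if_neg h]
  rfl

theorem swapWord_swapWord (r : Fin n → Fin k) (i : Fin (n - 1)) :
    swapWord (swapWord r i) i = r := by
  funext j; simp [swapWord]

theorem swapWord_left (r : Fin n → Fin k) (i : Fin (n - 1)) :
    swapWord r i (leftPos i) = r (rightPos i) := by simp [swapWord]

theorem swapWord_right (r : Fin n → Fin k) (i : Fin (n - 1)) :
    swapWord r i (rightPos i) = r (leftPos i) := by simp [swapWord]

theorem swapWord_of_ne (r : Fin n → Fin k) {i : Fin (n - 1)} {j : Fin n} (h : j ≠ leftPos i)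
    (h' : j ≠ rightPos i) : swapWord r i j = r j := by
  simp [swapWord, Equiv.swap_apply_of_ne_of_ne h h']

theorem letterCount_congr {r s : Fin n → Fin k} {m : ℕ} (h : ∀ j : Fin n, j.val < m → r j = s j)
    (a : Fin k) : letterCount r m a = letterCount s m a := by
  unfold letterCount
  congr 1
  refine Finset.filter_congr fun j _ => and_congr_right fun hj => by rw [h j hj]

theorem letterCount_swapWord {i : Fin (n - 1)} {m : ℕ} (hm : m ≤ i.val ∨ i.val + 2 ≤ m)
    (r : Fin n → Fin k) (a : Fin k) : letterCount (swapWord r i) m a = letterCount r m a := by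
  rcases hm with hm | hm
  · refine letterCount_congr (fun j hj => swapWord_of_ne r ?_ ?_) a <;>
    · simp only [leftPos, rightPos, ne_eq, Fin.ext_iff]
      omega
  · rw [letterCount, letterCount]
    refine Finset.card_equiv (Equiv.swap (leftPos i) (rightPos i)) fun j => ?_
    rw [Finset.mem_filter, Finset.mem_filter]
    simp only [Finset.mem_univ, true_and, swapWord, Function.comp_apply]
    refine and_congr_left fun _ => ?_
    by_cases h1 : j = leftPos i
    · subst h1; simp [leftPos, rightPos]; omega
    · by_cases h2 : j = rightPos i
      · subst h2; simp [leftPos, rightPos]; omega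
      · rw [Equiv.swap_apply_of_ne_of_ne h1 h2]

theorem letterCount_succ (r : Fin n → Fin k) (p : Fin n) (a : Fin k) :
    letterCount r (p.val + 1) a = letterCount r p.val a + if r p = a then 1 else 0 := by
  have : (Finset.univ.filter fun j : Fin n => j.val < p.val + 1 ∧ r j = a) =
      (Finset.univ.filter fun j : Fin n => j.val < p.val ∧ r j = a) ∪
        (if r p = a then {p} else ∅) := by
    ext j
    split_ifs with h
    · simp only [Finset.mem_filter, Finset.mem_univ, true_and, Finset.mem_union,
        Finset.mem_singleton]
      constructor
      · rintro ⟨h1, h2⟩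
        rcases Nat.lt_succ_iff_lt_or_eq.1 h1 with h3 | h3
        · exact Or.inl ⟨h3, h2⟩
        · exact Or.inr (Fin.ext h3)
      · rintro (h1 | rfl)
        · exact ⟨by omega, h1.2⟩
        · exact ⟨by omega, h⟩
    · simp only [Finset.mem_filter, Finset.mem_univ, true_and, Finset.union_empty]
      refine ⟨fun h1 => ⟨?_, h1.2⟩, fun h1 => ⟨by omega, h1.2⟩⟩
      rcases Nat.lt_succ_iff_lt_or_eq.1 h1.1 with h3 | h3
      · exact h3
      · obtain rfl : j = p := Fin.ext h3
        exact absurd h1.2 h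
  rw [letterCount, this, Finset.card_union_of_disjoint, letterCount]
  · split_ifs <;> simp
  · split_ifs <;> simp

theorem wordContent_swapWord {i : Fin (n - 1)} {m : ℕ} (hm : m ≤ i.val ∨ i.val + 2 ≤ m)
    (r : Fin n → Fin k) (a : Fin k) : wordContent (swapWord r i) m a = wordContent r m a := by
  rw [wordContent, letterCount_swapWord hm, wordContent]

theorem wordContent_succ (r : Fin n → Fin k) (p : Fin n) (a : Fin k) :
    wordContent r (p.val + 1) a = wordContent r p.val a + if r p = a then 1 else 0 := by
  rw [wordContent, letterCount_succ, wordContent]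
  split_ifs <;> push_cast <;> ring

theorem wordDist_swapWord (r : Fin n → Fin k) (i : Fin (n - 1)) :
    wordDist (swapWord r i) i = -wordDist r i := by
  simp only [wordDist, wordContent_swapWord (Or.inl le_rfl), swapWord_left, swapWord_right]
  ring

theorem wordProj_conjTranspose (ℓ : ℕ) (i : Fin (n - 1)) :
    (wordProj k n ℓ i : Matrix (Fin n → Fin k) (Fin n → Fin k) ℂ)ᴴ = wordProj k n ℓ i := by
  ext s r
  rw [Matrix.conjTranspose_apply]
  simp only [wordProj, ket_apply]
  by_cases h1 : r = s
  · subst h1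
    split_ifs with h2 h3 <;> simp
  · by_cases h2 : r = swapWord s i
    · subst h2
      simp only [swapWord_left, swapWord_right, swapWord_swapWord, wordDist_swapWord, sCoeff_neg,
        h1, Ne.symm h1, if_false, if_true]
      simp only [eq_comm (a := s (rightPos i))]
      split_ifs <;> simp
    · have h3 : s ≠ swapWord r i := fun h => h2 (by rw [h, swapWord_swapWord])
      simp [h1, Ne.symm h1, h2, h3]

theorem wordProj_mul_self {ℓ : ℕ} (hℓ : 3 ≤ ℓ) (i : Fin (n - 1)) :
    (wordProj k n ℓ i * wordProj k n ℓ i : Matrix (Fin n → Fin k) (Fin n → Fin k) ℂ) =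
      wordProj k n ℓ i := by
  refine Matrix.ext_ket fun r => ?_
  rw [← Matrix.mulVec_mulVec]
  by_cases h : r (leftPos i) = r (rightPos i)
  · rw [wordProj_mulVec_ket_of_eq h, Matrix.mulVec_zero]
  · have h' : swapWord r i (leftPos i) ≠ swapWord r i (rightPos i) := by
      rw [swapWord_left, swapWord_right]; exact Ne.symm h
    rw [wordProj_mulVec_ket_of_ne h, Matrix.mulVec_add, Matrix.mulVec_smul, Matrix.mulVec_smul,
      wordProj_mulVec_ket_of_ne h, wordProj_mulVec_ket_of_ne h', swapWord_swapWord,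
      wordDist_swapWord, sCoeff_neg]
    have e1 : (aCoeff ℓ (wordDist r i) * aCoeff ℓ (wordDist r i) +
        sCoeff ℓ (wordDist r i) * sCoeff ℓ (wordDist r i) : ℂ) = aCoeff ℓ (wordDist r i) := by
      exact_mod_cast aCoeff_mul_self_add hℓ (wordDist r i)
    have e2 : (sCoeff ℓ (wordDist r i) * (aCoeff ℓ (wordDist r i) + aCoeff ℓ (-wordDist r i)) : ℂ)
        = sCoeff ℓ (wordDist r i) := by
      exact_mod_cast sCoeff_mul_aCoeff_add hℓ (wordDist r i)
    linear_combination (norm := module) e1 • ket r + e2 • ket (swapWord r i)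

theorem wordProj_comm (ℓ : ℕ) {i j : Fin (n - 1)} (hij : i.val + 1 < j.val) :
    (wordProj k n ℓ i * wordProj k n ℓ j : Matrix (Fin n → Fin k) (Fin n → Fin k) ℂ) =
      wordProj k n ℓ j * wordProj k n ℓ i := by
  have n1 : leftPos j ≠ leftPos i := by simp only [leftPos, ne_eq, Fin.ext_iff]; omega
  have n2 : leftPos j ≠ rightPos i := by simp only [leftPos, rightPos, ne_eq, Fin.ext_iff]; omega
  have n3 : rightPos j ≠ leftPos i := by simp only [leftPos, rightPos, ne_eq, Fin.ext_iff]; omega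
  have n4 : rightPos j ≠ rightPos i := by simp only [rightPos, ne_eq, Fin.ext_iff]; omega
  refine Matrix.ext_ket fun r => ?_
  have hc : swapWord (swapWord r i) j = swapWord (swapWord r j) i := by
    funext p
    by_cases h1 : p = leftPos i
    · subst h1
      simp only [swapWord_left, swapWord_of_ne _ n1.symm n3.symm,
        swapWord_of_ne _ n2.symm n4.symm]
    by_cases h2 : p = rightPos i
    · subst h2
      simp only [swapWord_right, swapWord_of_ne _ n1.symm n3.symm,
        swapWord_of_ne _ n2.symm n4.symm]
    by_cases h3 : p = leftPos j
    · subst h3; simp only [swapWord_left, swapWord_of_ne _ n1 n2, swapWord_of_ne _ n3 n4]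
    by_cases h4 : p = rightPos j
    · subst h4; simp only [swapWord_right, swapWord_of_ne _ n1 n2, swapWord_of_ne _ n3 n4]
    simp only [swapWord_of_ne _ h1 h2, swapWord_of_ne _ h3 h4]
  have hi : wordDist (swapWord r j) i = wordDist r i := by
    simp only [wordDist, wordContent_swapWord (i := j) (m := i) (Or.inl (by omega)),
      swapWord_of_ne _ n1.symm n3.symm, swapWord_of_ne _ n2.symm n4.symm]
  have hj : wordDist (swapWord r i) j = wordDist r j := by
    simp only [wordDist, wordContent_swapWord (i := i) (m := j) (Or.inr (by omega)),
      swapWord_of_ne _ n1 n2, swapWord_of_ne _ n3 n4]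
  have ei : swapWord r j (leftPos i) = swapWord r j (rightPos i) ↔
      r (leftPos i) = r (rightPos i) := by
    rw [swapWord_of_ne _ n1.symm n3.symm, swapWord_of_ne _ n2.symm n4.symm]
  have ej : swapWord r i (leftPos j) = swapWord r i (rightPos j) ↔
      r (leftPos j) = r (rightPos j) := by
    rw [swapWord_of_ne _ n1 n2, swapWord_of_ne _ n3 n4]
  rw [← Matrix.mulVec_mulVec, ← Matrix.mulVec_mulVec]
  by_cases h1 : r (leftPos i) = r (rightPos i)
  · by_cases h2 : r (leftPos j) = r (rightPos j)
    · rw [wordProj_mulVec_ket_of_eq h1, wordProj_mulVec_ket_of_eq h2, Matrix.mulVec_zero,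
        Matrix.mulVec_zero]
    · rw [wordProj_mulVec_ket_of_eq h1, wordProj_mulVec_ket_of_ne h2, Matrix.mulVec_zero,
        Matrix.mulVec_add, Matrix.mulVec_smul, Matrix.mulVec_smul, wordProj_mulVec_ket_of_eq h1,
        wordProj_mulVec_ket_of_eq (ei.2 h1)]
      simp
  · by_cases h2 : r (leftPos j) = r (rightPos j)
    · rw [wordProj_mulVec_ket_of_ne h1, wordProj_mulVec_ket_of_eq h2, Matrix.mulVec_zero,
        Matrix.mulVec_add, Matrix.mulVec_smul, Matrix.mulVec_smul, wordProj_mulVec_ket_of_eq h2,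
        wordProj_mulVec_ket_of_eq (ej.2 h2)]
      simp
    · rw [wordProj_mulVec_ket_of_ne h1, wordProj_mulVec_ket_of_ne h2]
      simp only [Matrix.mulVec_add, Matrix.mulVec_smul]
      rw [wordProj_mulVec_ket_of_ne h1, wordProj_mulVec_ket_of_ne h2,
        wordProj_mulVec_ket_of_ne (mt ei.1 h1), wordProj_mulVec_ket_of_ne (mt ej.1 h2), hc, hi, hj]
      module

/-! ### The braid relation -/

/-- The relation `e₁e₂e₁ - τe₁ = e₂e₁e₂ - τe₂` for operators on three letters that act by the
formulas of the Jones–Wenzl representation, with `x a` in the role of the content of row `a`. -/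
theorem threeLetter_relation {ℓ : ℕ} (hℓ : 3 ≤ ℓ) {κ : Type*} [Fintype κ]
    (A B : Matrix κ κ ℂ) (v : Fin k → Fin k → Fin k → κ → ℂ) (x : Fin k → ℤ)
    (hA : ∀ a b c, A *ᵥ v a b c = if a = b then 0 else
      (aCoeff ℓ (x a - x b) : ℂ) • v a b c + (sCoeff ℓ (x a - x b) : ℂ) • v b a c)
    (hB : ∀ a b c, B *ᵥ v a b c = if b = c then 0 else
      (aCoeff ℓ (x b + (if a = b then 1 else 0) - (x c + if a = c then 1 else 0)) : ℂ) • v a b c +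
      (sCoeff ℓ (x b + (if a = b then 1 else 0) - (x c + if a = c then 1 else 0)) : ℂ) • v a c b)
    (a b c : Fin k) (hab : a ≠ b → qInt ℓ (x a - x b) ≠ 0) (hbc : b ≠ c → qInt ℓ (x b - x c) ≠ 0)
    (hac : a ≠ c → qInt ℓ (x a - x c) ≠ 0)
    (h1 : a = b → a ≠ c → qInt ℓ (x a + 1 - x c) ≠ 0)
    (h2 : a = c → a ≠ b → qInt ℓ (x a + 1 - x b) ≠ 0)
    (h3 : b = c → b ≠ a → qInt ℓ (x b + 1 - x a) ≠ 0) :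
    A *ᵥ B *ᵥ A *ᵥ v a b c - (tauCoeff ℓ : ℂ) • A *ᵥ v a b c =
      B *ᵥ A *ᵥ B *ᵥ v a b c - (tauCoeff ℓ : ℂ) • B *ᵥ v a b c := by
  by_cases e1 : a = b
  · subst e1
    by_cases e2 : a = c
    · subst e2; simp [hA, hB]
    · have h0 := hac e2
      have h0' := h1 rfl e2
      set d := x a - x c with hd
      have ed : x a + 1 - x c = d + 1 := by rw [hd]; ring
      have ed' : x c - (x a + 1) = -(d + 1) := by rw [hd]; ring
      rw [ed] at h0'
      have s1 : (sCoeff ℓ (d + 1) * sCoeff ℓ (d + 1) : ℂ) =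
          aCoeff ℓ (d + 1) * aCoeff ℓ (-(d + 1)) := by exact_mod_cast sCoeff_mul_self hℓ (d + 1)
      have t1 : (aCoeff ℓ d * aCoeff ℓ (-(d + 1)) : ℂ) = tauCoeff ℓ := by
        exact_mod_cast aCoeff_mul_neg_succ hℓ h0 h0'
      simp only [hA, hB, Matrix.mulVec_add, Matrix.mulVec_smul, Matrix.mulVec_zero, e2, Ne.symm e2,
        if_true, if_false, add_zero, smul_zero, sub_zero, ed, ed', ← hd,
        sCoeff_neg]
      linear_combination (norm := module)
        ((-(aCoeff ℓ d : ℂ)) * s1 + (-(aCoeff ℓ (d + 1) : ℂ)) * t1) • v a a c +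
        ((-(sCoeff ℓ (d + 1) : ℂ)) * t1) • v a c a
  · have g1 := hab e1
    by_cases e2 : b = c
    · subst e2
      have g2 := h3 rfl (Ne.symm e1)
      set d := x b - x a with hd
      have ed : x b + 1 - x a = d + 1 := by rw [hd]; ring
      have ed' : x a - (x b + 1) = -(d + 1) := by rw [hd]; ring
      have ed'' : x a - x b = -d := by rw [hd]; ring
      rw [ed''] at g1
      rw [ed] at g2
      have g1' : qInt ℓ d ≠ 0 := by rw [qInt_neg] at g1; simpa using g1
      have s1 : (sCoeff ℓ d * sCoeff ℓ d : ℂ) = aCoeff ℓ d * aCoeff ℓ (-d) := by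
        exact_mod_cast sCoeff_mul_self hℓ d
      have t1 : (aCoeff ℓ d * aCoeff ℓ (-(d + 1)) : ℂ) = tauCoeff ℓ := by
        exact_mod_cast aCoeff_mul_neg_succ hℓ g1' g2
      simp only [hA, hB, Matrix.mulVec_add, Matrix.mulVec_smul, Matrix.mulVec_zero, e1, Ne.symm e1,
        if_true, if_false, add_zero, zero_add, smul_zero, sub_zero, ed', ed'', ← hd,
        sCoeff_neg]
      linear_combination (norm := module)
        ((aCoeff ℓ (-(d + 1)) : ℂ) * s1 + (aCoeff ℓ (-d) : ℂ) * t1) • v a b b +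
        ((sCoeff ℓ d : ℂ) * t1) • v b a b
    · have g2 := hbc e2
      by_cases e3 : a = c
      · subst e3
        have g3 := h2 rfl e1
        set d := x a - x b with hd
        have ed : x a + 1 - x b = d + 1 := by rw [hd]; ring
        have ed' : x b - (x a + 1) = -(d + 1) := by rw [hd]; ring
        rw [ed] at g3
        have t1 : (aCoeff ℓ d * aCoeff ℓ (-(d + 1)) : ℂ) = tauCoeff ℓ := by
          exact_mod_cast aCoeff_mul_neg_succ hℓ g1 g3
        simp only [hA, hB, Matrix.mulVec_add, Matrix.mulVec_smul, e1,
          Ne.symm e1, if_true, if_false, add_zero, smul_zero, ed', ← hd,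
          sCoeff_neg]
        linear_combination (norm := module)
          ((aCoeff ℓ d : ℂ) * t1 - (aCoeff ℓ (-(d + 1)) : ℂ) * t1) • v a b a +
          ((sCoeff ℓ d : ℂ) * t1) • v b a a + (-(sCoeff ℓ (d + 1) : ℂ) * t1) • v a a b
      · have g3 := hac e3
        set d := x a - x b with hd
        set d' := x b - x c with hd'
        have ed : x a - x c = d + d' := by rw [hd, hd']; ring
        rw [ed] at g3
        have m1 : x b - x a = -d := by rw [hd]; ring
        have m2 : x c - x b = -d' := by rw [hd']; ring
        have m3 : x c - x a = -(d + d') := by rw [hd, hd']; ring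
        have s1 : (sCoeff ℓ d * sCoeff ℓ d : ℂ) = aCoeff ℓ d * aCoeff ℓ (-d) := by
          exact_mod_cast sCoeff_mul_self hℓ d
        have s2 : (sCoeff ℓ d' * sCoeff ℓ d' : ℂ) = aCoeff ℓ d' * aCoeff ℓ (-d') := by
          exact_mod_cast sCoeff_mul_self hℓ d'
        have t1 : (aCoeff ℓ d * aCoeff ℓ d' + aCoeff ℓ (-d) * aCoeff ℓ (d + d') -
            aCoeff ℓ d' * aCoeff ℓ (d + d') : ℂ) = tauCoeff ℓ := by
          exact_mod_cast aCoeff_triangle hℓ g1 g2 g3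
        have t2 : (aCoeff ℓ d' * aCoeff ℓ d + aCoeff ℓ (-d') * aCoeff ℓ (d + d') -
            aCoeff ℓ d * aCoeff ℓ (d + d') : ℂ) = tauCoeff ℓ := by
          have := aCoeff_triangle hℓ g2 g1 (by rwa [add_comm] at g3)
          rw [add_comm d' d] at this
          exact_mod_cast this
        simp only [hA, hB, Matrix.mulVec_add, Matrix.mulVec_smul, e1, e2, e3,
          Ne.symm e1, Ne.symm e2, Ne.symm e3, if_false, add_zero, ← hd, ← hd', ed, m1,
          m2, sCoeff_neg]
        linear_combination (norm := module)
          ((aCoeff ℓ (d + d') : ℂ) * s1 - (aCoeff ℓ (d + d') : ℂ) * s2 + (aCoeff ℓ d : ℂ) * t1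
            - (aCoeff ℓ d' : ℂ) * t2) • v a b c +
          ((sCoeff ℓ d : ℂ) * t1) • v b a c - ((sCoeff ℓ d' : ℂ) * t2) • v a c b

/-- The braid relation on a word in whose prefixes the contents of different rows are incongruent
modulo `ℓ`. Only the letters at three places change, so it is an instance of
`threeLetter_relation`. -/
theorem wordProj_braid {ℓ : ℕ} (hℓ : 3 ≤ ℓ) {i j : Fin (n - 1)} (hij : i.val + 1 = j.val)
    {r : Fin n → Fin k}
    (hr : ∀ m ≤ n, ∀ a b, a ≠ b → qInt ℓ (wordContent r m a - wordContent r m b) ≠ 0) :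
    wordProj k n ℓ i *ᵥ wordProj k n ℓ j *ᵥ wordProj k n ℓ i *ᵥ ket r -
        (tauCoeff ℓ : ℂ) • wordProj k n ℓ i *ᵥ ket r =
      wordProj k n ℓ j *ᵥ wordProj k n ℓ i *ᵥ wordProj k n ℓ j *ᵥ ket r -
        (tauCoeff ℓ : ℂ) • wordProj k n ℓ j *ᵥ ket r := by
  have hp2 : leftPos j = rightPos i := Fin.ext (by simp [leftPos, rightPos, hij])
  have n12 := leftPos_ne_rightPos i
  have n23 : rightPos i ≠ rightPos j := hp2 ▸ leftPos_ne_rightPos j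
  have n13 : leftPos i ≠ rightPos j := by
    simp only [leftPos, rightPos, ne_eq, Fin.ext_iff]; omega
  -- The word `r` with the letters `a b c` at the places `i`, `i + 1`, `i + 2`.
  let w : Fin k → Fin k → Fin k → Fin n → Fin k := fun a b c =>
    Function.update (Function.update (Function.update r (leftPos i) a) (rightPos i) b)
      (rightPos j) c
  have w1 : ∀ a b c, w a b c (leftPos i) = a := fun a b c => by simp [w, n12, n13]
  have w2 : ∀ a b c, w a b c (rightPos i) = b := fun a b c => by simp [w, n23]
  have w3 : ∀ a b c, w a b c (rightPos j) = c := fun a b c => by simp [w]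
  have w0 : ∀ a b c p, p ≠ leftPos i → p ≠ rightPos i → p ≠ rightPos j → w a b c p = r p :=
    fun a b c p h1 h2 h3 => by simp [w, h1, h2, h3]
  have wi : ∀ a b c, swapWord (w a b c) i = w b a c := by
    intro a b c
    funext p
    by_cases h1 : p = leftPos i
    · subst h1; rw [swapWord_left, w1, w2]
    by_cases h2 : p = rightPos i
    · subst h2; rw [swapWord_right, w1, w2]
    rw [swapWord_of_ne _ h1 h2]
    by_cases h3 : p = rightPos j
    · subst h3; rw [w3, w3]
    · rw [w0 _ _ _ _ h1 h2 h3, w0 _ _ _ _ h1 h2 h3]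
  have wj : ∀ a b c, swapWord (w a b c) j = w a c b := by
    intro a b c
    funext p
    by_cases h2 : p = rightPos i
    · subst h2; rw [← hp2, swapWord_left, hp2, w2, w3]
    by_cases h3 : p = rightPos j
    · subst h3; rw [swapWord_right, w3, hp2, w2]
    rw [swapWord_of_ne _ (hp2 ▸ h2) h3]
    by_cases h1 : p = leftPos i
    · subst h1; rw [w1, w1]
    · rw [w0 _ _ _ _ h1 h2 h3, w0 _ _ _ _ h1 h2 h3]
  have ci : ∀ a b c d, wordContent (w a b c) i d = wordContent r i d := by
    intro a b c d
    rw [wordContent, wordContent, letterCount_congr]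
    intro p hp
    refine w0 _ _ _ _ ?_ ?_ ?_ <;>
    · simp only [leftPos, rightPos, ne_eq, Fin.ext_iff]
      omega
  have cj : ∀ a b c d, wordContent (w a b c) j d =
      wordContent r i d + if a = d then 1 else 0 := by
    intro a b c d
    have := wordContent_succ (w a b c) (leftPos i) d
    rw [w1] at this
    rw [← hij, ← ci a b c d]
    exact this
  have hw : w (r (leftPos i)) (r (rightPos i)) (r (rightPos j)) = r := by
    simp [w, Function.update_eq_self]
  have c1 : ∀ d, wordContent r (i + 1) d = wordContent r i d + if r (leftPos i) = d then 1 else 0 :=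
    fun d => wordContent_succ r (leftPos i) d
  have c2 : ∀ d, wordContent r (i + 2) d =
      wordContent r (i + 1) d + if r (rightPos i) = d then 1 else 0 :=
    fun d => wordContent_succ r (rightPos i) d
  have c3 : ∀ d, wordContent r (i + 3) d =
      wordContent r (i + 2) d + if r (rightPos j) = d then 1 else 0 := by
    intro d
    have := wordContent_succ r (rightPos j) d
    have e : (rightPos j).val = i.val + 2 := by simp [rightPos, ← hij]
    rwa [e] at this
  have hn : i.val + 3 ≤ n := by have := j.2; omega
  conv_lhs => rw [← hw]
  conv_rhs => rw [← hw]
  refine threeLetter_relation hℓ _ _ (fun a b c => ket (w a b c)) (wordContent r i) ?_ ?_ _ _ _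
    (hr i (by omega) _ _) (hr i (by omega) _ _) (hr i (by omega) _ _) ?_ ?_ ?_
  · intro a b c
    split_ifs with h
    · exact wordProj_mulVec_ket_of_eq (by rw [w1, w2, h])
    · rw [wordProj_mulVec_ket_of_ne (by rwa [w1, w2]), wi, wordDist, ci, ci, w1, w2]
  · intro a b c
    by_cases h : b = c
    · rw [if_pos h]
      exact wordProj_mulVec_ket_of_eq (by rw [hp2, w2, w3, h])
    · rw [if_neg h, wordProj_mulVec_ket_of_ne (by rwa [hp2, w2, w3]), wj, wordDist, cj, cj, hp2,
        w2, w3]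
  · intro h1 h2
    have := hr (i + 1) (by omega) _ _ h2
    rw [c1, c1, if_pos rfl, if_neg h2] at this
    convert this using 2
    ring
  · intro h1 h2
    have := hr (i + 1) (by omega) _ _ h2
    rw [c1, c1, if_pos rfl, if_neg h2] at this
    convert this using 2
    ring
  · intro h1 h2
    have := hr (i + 3) hn _ _ h2
    rw [c3, c3, c2, c2, c1, c1, if_pos rfl, if_pos rfl, if_neg h2, if_neg h2.symm, ← h1, if_pos rfl,
      if_neg h2] at this
    convert this using 2
    ring

/-! ### Tableaux and their words -/

theorem StandardTableau.rowLen_shapeAt (t : StandardTableau n) (m a : ℕ) :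
    (t.shapeAt m).rowLen a =
      (Finset.univ.filter fun j : Fin n => j.val < m ∧ (t.box j).1 = a).card := by
  have h : (t.shapeAt m).row a =
      (Finset.univ.filter fun j : Fin n => j.val < m ∧ (t.box j).1 = a).image t.box := by
    ext p
    simp only [YoungDiagram.mem_row_iff, ← YoungDiagram.mem_cells, StandardTableau.shapeAt,
      Finset.mem_image, Finset.mem_filter, Finset.mem_univ, true_and]
    constructor
    · rintro ⟨⟨j, hj, rfl⟩, h⟩
      exact ⟨j, ⟨hj, h⟩, rfl⟩
    · rintro ⟨j, ⟨hj, h⟩, rfl⟩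
      exact ⟨⟨j, hj, rfl⟩, h⟩
  rw [YoungDiagram.rowLen_eq_card, h, Finset.card_image_of_injective _ t.box_injective]

namespace KLTableau

variable {ℓ : ℕ}

theorem rowLen_shapeAt (t : KLTableau k ℓ n) (m : ℕ) (a : Fin k) :
    (t.shapeAt m).rowLen a = letterCount t.rowWord m a := by
  rw [StandardTableau.rowLen_shapeAt, letterCount]
  congr 1
  refine Finset.filter_congr fun j _ => and_congr_right fun _ => ?_
  rw [Fin.ext_iff]
  rfl

/-- The column of a box is the number of earlier boxes in its row. -/
theorem box_snd (t : KLTableau k ℓ n) (j : Fin n) :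
    (t.box j).2 = letterCount t.rowWord j (t.rowWord j) := by
  have h1 : ¬ (t.box j).2 < (t.shapeAt j).rowLen (t.box j).1 := by
    rw [← YoungDiagram.mem_iff_lt_rowLen, ← YoungDiagram.mem_cells]
    simp only [StandardTableau.shapeAt, Finset.mem_image, Finset.mem_filter, Finset.mem_univ,
      true_and, not_exists, not_and, Prod.mk.eta]
    intro p hp h
    rw [t.box_injective h] at hp
    exact lt_irrefl _ hp
  have h2 : (t.box j).2 < (t.shapeAt (j + 1)).rowLen (t.box j).1 := by
    rw [← YoungDiagram.mem_iff_lt_rowLen, ← YoungDiagram.mem_cells]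
    simp only [StandardTableau.shapeAt, Finset.mem_image, Finset.mem_filter, Finset.mem_univ,
      true_and, Prod.mk.eta]
    exact ⟨j, by omega, rfl⟩
  have e1 := rowLen_shapeAt t j (t.rowWord j)
  have e2 := rowLen_shapeAt t (j + 1) (t.rowWord j)
  rw [letterCount_succ, if_pos rfl] at e2
  change (t.shapeAt j).rowLen (t.box j).1 = _ at e1
  change (t.shapeAt (j + 1)).rowLen (t.box j).1 = _ at e2
  omega

theorem rowWord_injective : Function.Injective (rowWord : KLTableau k ℓ n → Fin n → Fin k) := by
  intro s t h
  refine box_inj (funext fun j => Prod.ext ?_ ?_)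
  · exact congrArg Fin.val (congrFun h j)
  · rw [box_snd, box_snd, h]

/-- The contents of different rows of a `(k, ℓ)`-diagram are incongruent modulo `ℓ`: they decrease
strictly, by less than `ℓ` in total since `λ_1 - λ_k ≤ ℓ - k`. -/
theorem qInt_wordContent_ne_zero (hℓ : 3 ≤ ℓ) (t : KLTableau k ℓ n) (m : ℕ) (hm : m ≤ n)
    (a b : Fin k) (hab : a ≠ b) :
    qInt ℓ (wordContent t.rowWord m a - wordContent t.rowWord m b) ≠ 0 := by
  have key : ∀ a b : Fin k, a < b →
      0 < wordContent t.rowWord m a - wordContent t.rowWord m b ∧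
        wordContent t.rowWord m a - wordContent t.rowWord m b < ℓ := by
    intro a b h
    have hk := (t.isKL m hm).2
    have h1 := (t.shapeAt m).rowLen_anti a b h.le
    have h2 := (t.shapeAt m).rowLen_anti 0 a (Nat.zero_le _)
    have h3 := (t.shapeAt m).rowLen_anti b (k - 1) (by have := b.2; omega)
    rw [rowLen_shapeAt] at h1 h2 h3
    rw [rowLen_shapeAt] at h1
    have hb := b.2
    have : a.val < b.val := h
    simp only [wordContent]
    omega
  rcases lt_or_gt_of_ne hab with h | h
  · have := key a b h
    exact qInt_ne_zero hℓ (by omega) (by rw [abs_lt]; omega)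
  · have := key b a h
    exact qInt_ne_zero hℓ (by omega) (by rw [abs_lt]; omega)

theorem axialDist_eq_wordDist (t : KLTableau k ℓ n) {i : Fin (n - 1)}
    (h : t.rowWord (leftPos i) ≠ t.rowWord (rightPos i)) :
    t.axialDist i = wordDist t.rowWord i := by
  have e1 := t.box_snd (leftPos i)
  have e2 := t.box_snd (rightPos i)
  have e3 : letterCount t.rowWord (rightPos i) (t.rowWord (rightPos i)) =
      letterCount t.rowWord i (t.rowWord (rightPos i)) := by
    have := letterCount_succ t.rowWord (leftPos i) (t.rowWord (rightPos i))
    rwa [if_neg h, add_zero] at this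
  rw [e3] at e2
  have e4 : letterCount t.rowWord (leftPos i) (t.rowWord (leftPos i)) =
      letterCount t.rowWord i (t.rowWord (leftPos i)) := rfl
  have e5 : ((t.rowWord (leftPos i)).val : ℤ) = (t.box (leftPos i)).1 := rfl
  have e6 : ((t.rowWord (rightPos i)).val : ℤ) = (t.box (rightPos i)).1 := rfl
  simp only [axialDist, wordDist, wordContent]
  omega

/-- Exchanging two neighbouring numbers preserves the order of all other pairs. -/
theorem lt_of_swap_lt {i : Fin (n - 1)} {a b : Fin n}
    (h : Equiv.swap (leftPos i) (rightPos i) a < Equiv.swap (leftPos i) (rightPos i) b)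
    (h' : ¬ (Equiv.swap (leftPos i) (rightPos i) a = leftPos i ∧
      Equiv.swap (leftPos i) (rightPos i) b = rightPos i)) : a < b := by
  have hl : (leftPos i).val = i.val := rfl
  have hr : (rightPos i).val = i.val + 1 := rfl
  rw [Equiv.swap_apply_def, Equiv.swap_apply_def] at *
  rw [Fin.lt_def] at *
  simp only [Fin.ext_iff] at *
  split_ifs at * <;> omega

/-- If `i + 1` is in the same column as `i`, it is in the next row. -/
theorem axialDist_of_col_eq (t : KLTableau k ℓ n) {i : Fin (n - 1)}
    (h : (t.box (leftPos i)).2 = (t.box (rightPos i)).2) : t.axialDist i = 1 := by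
  have hl : (leftPos i).val = i.val := rfl
  have hr : (rightPos i).val = i.val + 1 := rfl
  have hne : (t.box (leftPos i)).1 ≠ (t.box (rightPos i)).1 := fun h' =>
    leftPos_ne_rightPos i (t.box_injective (Prod.ext h' h))
  have hlt : (t.box (leftPos i)).1 < (t.box (rightPos i)).1 := by
    refine lt_of_le_of_ne (not_lt.1 fun h' => ?_) hne
    have := t.col_strict _ _ h.symm h'
    rw [Fin.lt_def] at this
    omega
  have hsucc : (t.box (rightPos i)).1 = (t.box (leftPos i)).1 + 1 := by
    by_contra hcon
    obtain ⟨p, hp⟩ : ((t.box (leftPos i)).1 + 1, (t.box (leftPos i)).2) ∈ Set.range t.box :=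
      t.isLowerSet (show _ ≤ t.box (rightPos i) from ⟨by simp only; omega, h.le⟩) ⟨_, rfl⟩
    have h1 : leftPos i < p := t.col_strict _ _ (by rw [hp]) (by rw [hp]; simp)
    have h2 : p < rightPos i := t.col_strict _ _ (by rw [hp, ← h]) (by rw [hp]; simp only; omega)
    rw [Fin.lt_def] at h1 h2
    omega
  simp only [axialDist]
  omega

/-- Two numbers `i`, `i + 1` in different rows can be exchanged unless they are in the same column
or the exchange violates the bound on `λ_1 - λ_k`; in these two cases their axial distance is `1`
or `1 - ℓ`. -/
theorem exists_isSwap (hk : 1 < k) (t : KLTableau k ℓ n) {i : Fin (n - 1)}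
    (hrow : (t.box (leftPos i)).1 ≠ (t.box (rightPos i)).1) (h1 : t.axialDist i ≠ 1)
    (h2 : t.axialDist i ≠ 1 - ℓ) : ∃ t', IsSwap i t' t := by
  have hcol : (t.box (leftPos i)).2 ≠ (t.box (rightPos i)).2 := mt t.axialDist_of_col_eq h1
  let s : StandardTableau n :=
    { box := t.box ∘ Equiv.swap (leftPos i) (rightPos i)
      box_injective := t.box_injective.comp (Equiv.injective _)
      isLowerSet := by
        rw [Set.range_comp, Equiv.range_eq_univ, Set.image_univ]
        exact t.isLowerSet
      row_strict := fun a b h h' =>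
        lt_of_swap_lt (t.row_strict _ _ h h') fun ⟨ha, hb⟩ => hrow (by
          simpa only [Function.comp_apply, ha, hb] using h)
      col_strict := fun a b h h' =>
        lt_of_swap_lt (t.col_strict _ _ h h') fun ⟨ha, hb⟩ => hcol (by
          simpa only [Function.comp_apply, ha, hb] using h) }
  have hs : ∀ m (a : Fin k), (s.shapeAt m).rowLen a = letterCount (swapWord t.rowWord i) m a := by
    intro m a
    rw [StandardTableau.rowLen_shapeAt, letterCount]
    congr 1
    refine Finset.filter_congr fun j _ => and_congr_right fun _ => ?_
    rw [Fin.ext_iff]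
    rfl
  refine ⟨⟨s, fun m hm => ⟨?_, ?_⟩⟩, rfl⟩
  · rw [StandardTableau.rowLen_shapeAt, Finset.card_eq_zero, Finset.filter_eq_empty_iff]
    rintro j - ⟨-, h⟩
    exact absurd h (t.row_lt _).ne
  · have e0 := hs m ⟨0, by omega⟩
    have e1 := hs m ⟨k - 1, by omega⟩
    have f0 := t.rowLen_shapeAt m ⟨0, by omega⟩
    have f1 := t.rowLen_shapeAt m ⟨k - 1, by omega⟩
    have hK := (t.isKL m hm).2
    simp only at e0 e1 f0 f1
    rw [e0, e1]
    -- Only the diagram after `i` numbers changes.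
    by_cases hmi : m = i.val + 1
    · subst hmi
      have hrow' : t.rowWord (leftPos i) ≠ t.rowWord (rightPos i) :=
        fun h => hrow (congrArg Fin.val h)
      have hd := t.axialDist_eq_wordDist hrow'
      rw [wordDist, wordContent, wordContent] at hd
      have g : ∀ a, letterCount (swapWord t.rowWord i) (i + 1) a =
          letterCount t.rowWord i a + if t.rowWord (rightPos i) = a then 1 else 0 := by
        intro a
        have := letterCount_succ (swapWord t.rowWord i) (leftPos i) a
        rw [swapWord_left] at this
        rw [← letterCount_swapWord (i := i) (m := i) (Or.inl le_rfl) t.rowWord a]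
        exact this
      have g1 : ∀ a, letterCount t.rowWord (i + 1) a =
          letterCount t.rowWord i a + if t.rowWord (leftPos i) = a then 1 else 0 :=
        fun a => letterCount_succ t.rowWord (leftPos i) a
      have g2 : ∀ a, letterCount t.rowWord (i + 2) a =
          letterCount t.rowWord (i + 1) a + if t.rowWord (rightPos i) = a then 1 else 0 :=
        fun a => letterCount_succ t.rowWord (rightPos i) a
      have hi := i.2
      have hK0 := (t.isKL i (by omega)).2
      have hK2 := (t.isKL (i + 2) (by omega)).2
      have a0 := t.rowLen_shapeAt i ⟨0, by omega⟩
      have a1 := t.rowLen_shapeAt i ⟨k - 1, by omega⟩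
      have b0 := t.rowLen_shapeAt (i + 2) ⟨0, by omega⟩
      have b1 := t.rowLen_shapeAt (i + 2) ⟨k - 1, by omega⟩
      simp only at a0 a1 b0 b1
      rw [a0, a1] at hK0
      rw [b0, b1, g2, g2, g1, g1] at hK2
      rw [g, g]
      -- If the bound fails after the exchange, the diagram before `i` attains it, `i + 1` is in the
      -- first row and `i` in the last one.
      by_contra hcon
      have r2 : t.rowWord (rightPos i) = ⟨0, by omega⟩ := by
        by_contra h
        rw [if_neg h] at hcon
        omega
      have hk1 : (⟨0, by omega⟩ : Fin k) ≠ ⟨k - 1, by omega⟩ := by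
        simp only [ne_eq, Fin.mk.injEq]; omega
      rw [r2] at hcon hK2 hrow'
      rw [if_pos rfl, if_neg hk1] at hcon hK2
      rw [if_neg hrow'] at hK2
      have r1 : t.rowWord (leftPos i) = ⟨k - 1, by omega⟩ := by
        by_contra h
        rw [if_neg h] at hK2
        omega
      rw [r1, r2] at hd
      simp only at hd
      omega
    · rw [letterCount_swapWord (by omega), letterCount_swapWord (by omega), ← f0, ← f1]
      exact hK

end KLTableau

/-! ### The Jones–Wenzl representation -/

namespace KLTableau

variable {ℓ : ℕ}

theorem rows_ne_of_isSwap {i : Fin (n - 1)} {t t' : KLTableau k ℓ n} (h : IsSwap i t' t) :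
    t.rowWord (leftPos i) ≠ t.rowWord (rightPos i) := by
  intro he
  have he' : (t.box (leftPos i)).1 = (t.box (rightPos i)).1 := congrArg Fin.val he
  have hlt : leftPos i < rightPos i := by simp [leftPos, rightPos, Fin.lt_def]
  have h1 : t'.box (leftPos i) = t.box (rightPos i) := by rw [h]; simp
  have h2 : t'.box (rightPos i) = t.box (leftPos i) := by rw [h]; simp
  rcases lt_trichotomy (t.box (leftPos i)).2 (t.box (rightPos i)).2 with h3 | h3 | h3
  · have := t'.row_strict (rightPos i) (leftPos i) (by rw [h1, h2, he']) (by rw [h1, h2]; exact h3)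
    exact lt_asymm this hlt
  · exact leftPos_ne_rightPos i (t.box_injective (Prod.ext he' h3))
  · exact lt_asymm (t.row_strict _ _ he'.symm h3) hlt

theorem rowWord_of_isSwap {i : Fin (n - 1)} {t t' : KLTableau k ℓ n} (h : IsSwap i t' t) :
    t'.rowWord = swapWord t.rowWord i := by
  funext j
  refine Fin.ext ?_
  change (t'.box j).1 = _
  rw [h]
  rfl

end KLTableau

/-- The matrix of `|t⟩ ↦ |r(t)⟩`. -/
def wordEmbedding (k ℓ n : ℕ) : Matrix (Fin n → Fin k) (KLTableau k ℓ n) ℂ :=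
  fun r t => ket t.rowWord r

theorem wordEmbedding_mulVec_ket {ℓ : ℕ} (t : KLTableau k ℓ n) :
    wordEmbedding k ℓ n *ᵥ ket t = ket t.rowWord := by
  ext r
  rw [mulVec_ket_apply, wordEmbedding]

theorem wordEmbedding_isometry (k ℓ n : ℕ) :
    (wordEmbedding k ℓ n)ᴴ * wordEmbedding k ℓ n = 1 := by
  ext s t
  rw [Matrix.mul_apply, Matrix.one_apply]
  simp only [Matrix.conjTranspose_apply, wordEmbedding, ket_apply]
  rw [Finset.sum_eq_single s.rowWord (fun r _ hr => by simp [hr]) (by simp)]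
  by_cases h : s = t
  · simp [h]
  · have : s.rowWord ≠ t.rowWord := fun h' => h (KLTableau.rowWord_injective h')
    simp [h, this]

/-- The projections on words restrict to those of the Jones–Wenzl representation. -/
theorem wordProj_mul_wordEmbedding {ℓ : ℕ} (hk : 1 < k) (hℓ : 3 ≤ ℓ) (i : Fin (n - 1)) :
    wordProj k n ℓ i * wordEmbedding k ℓ n = wordEmbedding k ℓ n * jwProj k ℓ n i := by
  classical
  refine Matrix.ext_ket fun t => ?_
  rw [← Matrix.mulVec_mulVec, ← Matrix.mulVec_mulVec, wordEmbedding_mulVec_ket]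
  have hcol : ∀ s, (jwProj k ℓ n i *ᵥ ket t) s = jwProj k ℓ n i s t := mulVec_ket_apply _ _
  have hself : ¬ KLTableau.IsSwap i t t := fun h => by
    have := KLTableau.rows_ne_of_isSwap h
    have h' := congrFun (KLTableau.rowWord_of_isSwap h) (leftPos i)
    rw [swapWord_left] at h'
    exact this h'
  by_cases hex : ∃ t', KLTableau.IsSwap i t' t
  · have hex' := hex
    obtain ⟨t', ht'⟩ := hex
    have hne := KLTableau.rows_ne_of_isSwap ht'
    have hd := t.axialDist_eq_wordDist hne
    have hJ : jwProj k ℓ n i *ᵥ ket t = (aCoeff ℓ (wordDist t.rowWord i) : ℂ) • ket t +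
        (sCoeff ℓ (wordDist t.rowWord i) : ℂ) • ket t' := by
      ext s
      rw [hcol, jwProj, if_pos hex', hd]
      simp only [Pi.add_apply, Pi.smul_apply, ket_apply, sCoeff]
      have hst' : KLTableau.IsSwap i s t ↔ s = t' :=
        ⟨fun h => KLTableau.box_inj (h.trans ht'.symm), fun h => h ▸ ht'⟩
      by_cases h1 : s = t
      · subst h1
        have h2 : s ≠ t' := fun h => hself (hst'.2 h)
        simp [h2]
      · by_cases h2 : s = t'
        · rw [if_neg h1, if_pos (hst'.2 h2)]
          have h3 : t' ≠ t := h2 ▸ h1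
          simp [h2, h3]
        · rw [if_neg h1, if_neg (mt hst'.1 h2)]
          simp [h1, h2]
    rw [wordProj_mulVec_ket_of_ne hne, hJ, Matrix.mulVec_add, Matrix.mulVec_smul,
      Matrix.mulVec_smul, wordEmbedding_mulVec_ket, wordEmbedding_mulVec_ket,
      KLTableau.rowWord_of_isSwap ht']
  · have hJ : jwProj k ℓ n i *ᵥ ket t =
        if (t.box (leftPos i)).1 = (t.box (rightPos i)).1 then 0 else ket t := by
      ext s
      rw [hcol, jwProj, if_neg hex]
      by_cases h1 : s = t
      · subst h1
        rw [if_pos rfl]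
        split_ifs <;> simp [ket_apply]
      · rw [if_neg h1, if_neg fun h => hex ⟨s, h⟩]
        split_ifs <;> simp [ket_apply, h1]
    rw [hJ]
    by_cases hrow : (t.box (leftPos i)).1 = (t.box (rightPos i)).1
    · rw [if_pos hrow, Matrix.mulVec_zero]
      exact wordProj_mulVec_ket_of_eq (Fin.ext hrow)
    · have hne : t.rowWord (leftPos i) ≠ t.rowWord (rightPos i) :=
        fun h => hrow (congrArg Fin.val h)
      have hd := t.axialDist_eq_wordDist hne
      -- Without an exchange the axial distance is `1` or `1 - ℓ`, so that `a(d) = 1`, `a(-d) = 0`.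
      have hcoef : aCoeff ℓ (wordDist t.rowWord i) = 1 ∧ sCoeff ℓ (wordDist t.rowWord i) = 0 := by
        rw [← hd]
        by_cases h1 : t.axialDist i = 1
        · rw [h1, sCoeff, aCoeff_one hℓ, aCoeff_neg_one]
          simp
        · have h2 : t.axialDist i = 1 - ℓ := by
            by_contra h2
            exact hex (t.exists_isSwap hk hrow h1 h2)
          rw [h2, sCoeff, aCoeff_one_sub_self hℓ, neg_sub, aCoeff_self_sub_one]
          simp
      rw [if_neg hrow, wordProj_mulVec_ket_of_ne hne, hcoef.1, hcoef.2, wordEmbedding_mulVec_ket]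
      simp

section Relations

variable {ℓ : ℕ}

/-- `π(e_i)` is a compression of the projection on words. -/
theorem jwProj_eq (hk : 1 < k) (hℓ : 3 ≤ ℓ) (i : Fin (n - 1)) : jwProj k ℓ n i =
    (wordEmbedding k ℓ n)ᴴ * (wordProj k n ℓ i * wordEmbedding k ℓ n) := by
  rw [wordProj_mul_wordEmbedding hk hℓ, ← Matrix.mul_assoc, wordEmbedding_isometry, Matrix.one_mul]

theorem wordEmbedding_mul_injective {ι : Type*} {A B : Matrix (KLTableau k ℓ n) ι ℂ}
    (h : wordEmbedding k ℓ n * A = wordEmbedding k ℓ n * B) : A = B := by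
  have := congrArg ((wordEmbedding k ℓ n)ᴴ * ·) h
  simpa only [← Matrix.mul_assoc, wordEmbedding_isometry, Matrix.one_mul] using this

theorem jwProj_conjTranspose (hk : 1 < k) (hℓ : 3 ≤ ℓ) (i : Fin (n - 1)) :
    (jwProj k ℓ n i)ᴴ = jwProj k ℓ n i := by
  rw [jwProj_eq hk hℓ, Matrix.conjTranspose_mul, Matrix.conjTranspose_mul,
    Matrix.conjTranspose_conjTranspose, wordProj_conjTranspose, Matrix.mul_assoc]

theorem jwProj_mul_self (hk : 1 < k) (hℓ : 3 ≤ ℓ) (i : Fin (n - 1)) :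
    jwProj k ℓ n i * jwProj k ℓ n i = jwProj k ℓ n i := by
  apply wordEmbedding_mul_injective
  rw [← Matrix.mul_assoc, ← wordProj_mul_wordEmbedding hk hℓ, Matrix.mul_assoc,
    ← wordProj_mul_wordEmbedding hk hℓ, ← Matrix.mul_assoc, wordProj_mul_self hℓ]

theorem jwProj_comm (hk : 1 < k) (hℓ : 3 ≤ ℓ) {i j : Fin (n - 1)} (hij : i.val + 1 < j.val) :
    jwProj k ℓ n i * jwProj k ℓ n j = jwProj k ℓ n j * jwProj k ℓ n i := by
  apply wordEmbedding_mul_injective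
  rw [← Matrix.mul_assoc, ← wordProj_mul_wordEmbedding hk hℓ, Matrix.mul_assoc,
    ← wordProj_mul_wordEmbedding hk hℓ, ← Matrix.mul_assoc, wordProj_comm ℓ hij, Matrix.mul_assoc,
    wordProj_mul_wordEmbedding hk hℓ, ← Matrix.mul_assoc, wordProj_mul_wordEmbedding hk hℓ,
    Matrix.mul_assoc]

theorem jwProj_braid (hk : 1 < k) (hℓ : 3 ≤ ℓ) {i j : Fin (n - 1)} (hij : i.val + 1 = j.val) :
    jwProj k ℓ n i * jwProj k ℓ n j * jwProj k ℓ n i - (tauCoeff ℓ : ℂ) • jwProj k ℓ n i =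
      jwProj k ℓ n j * jwProj k ℓ n i * jwProj k ℓ n j - (tauCoeff ℓ : ℂ) • jwProj k ℓ n j := by
  apply wordEmbedding_mul_injective
  refine Matrix.ext_ket fun t => ?_
  have hc : ∀ (i : Fin (n - 1)) (v : KLTableau k ℓ n → ℂ),
      wordEmbedding k ℓ n *ᵥ jwProj k ℓ n i *ᵥ v =
        wordProj k n ℓ i *ᵥ wordEmbedding k ℓ n *ᵥ v := by
    intro i v
    rw [Matrix.mulVec_mulVec, ← wordProj_mul_wordEmbedding hk hℓ, Matrix.mulVec_mulVec]
  simp only [← Matrix.mulVec_mulVec, Matrix.sub_mulVec, Matrix.mulVec_sub, Matrix.smul_mulVec,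
    Matrix.mulVec_smul, hc, wordEmbedding_mulVec_ket]
  exact wordProj_braid hℓ hij (t.qInt_wordContent_ne_zero hℓ)

theorem jwMatrix_mem (hk : 1 < k) (hℓ : 3 ≤ ℓ) (i : Fin (n - 1)) :
    jwMatrix k ℓ n i ∈ Matrix.unitaryGroup (KLTableau k ℓ n) ℂ := by
  rw [Matrix.mem_unitaryGroup_iff, Matrix.star_eq_conjTranspose, jwMatrix]
  simp only [Matrix.conjTranspose_sub, Matrix.conjTranspose_smul, Matrix.conjTranspose_one,
    jwProj_conjTranspose hk hℓ, mul_sub, sub_mul, smul_mul_assoc, mul_smul_comm, one_mul, mul_one,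
    jwProj_mul_self hk hℓ, star_add, star_one]
  have h := qRoot_mul_star ℓ
  linear_combination (norm := module) h • (1 : Matrix (KLTableau k ℓ n) (KLTableau k ℓ n) ℂ)
    - h • jwProj k ℓ n i

theorem jwMatrix_comm (hk : 1 < k) (hℓ : 3 ≤ ℓ) {i j : Fin (n - 1)} (hij : i.val + 1 < j.val) :
    jwMatrix k ℓ n i * jwMatrix k ℓ n j = jwMatrix k ℓ n j * jwMatrix k ℓ n i := by
  simp only [jwMatrix, mul_sub, sub_mul, smul_mul_assoc, mul_smul_comm, one_mul, mul_one,
    jwProj_comm hk hℓ hij]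
  module

theorem jwMatrix_braid (hk : 1 < k) (hℓ : 3 ≤ ℓ) {i j : Fin (n - 1)} (hij : i.val + 1 = j.val) :
    jwMatrix k ℓ n i * jwMatrix k ℓ n j * jwMatrix k ℓ n i =
      jwMatrix k ℓ n j * jwMatrix k ℓ n i * jwMatrix k ℓ n j := by
  have hb := jwProj_braid (n := n) hk hℓ hij
  have ht := one_add_qRoot_sq hℓ
  simp only [jwMatrix, mul_sub, sub_mul, smul_mul_assoc, mul_smul_comm, one_mul, mul_one,
    jwProj_mul_self hk hℓ, smul_sub]
  set E := jwProj k ℓ n i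
  set F := jwProj k ℓ n j
  set q := qRoot ℓ
  linear_combination (norm := module) (-(1 + q) ^ 3) • hb - ((1 + q) * ht) • (E - F)

/-- The Jones–Wenzl representation. -/
def jwRep (hk : 1 < k) (hℓ : 3 ≤ ℓ) : BraidGroup n →* Matrix.unitaryGroup (KLTableau k ℓ n) ℂ :=
  PresentedGroup.toGroup (f := fun i => ⟨jwMatrix k ℓ n i, jwMatrix_mem hk hℓ i⟩) (by
    intro w hw
    rcases hw with ⟨i, j, hij⟩ | ⟨i, j, hij⟩
    · simp only [map_mul, map_inv, FreeGroup.lift_apply_of, mul_inv_eq_one]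
      exact Subtype.ext (jwMatrix_braid hk hℓ hij)
    · simp only [map_mul, map_inv, FreeGroup.lift_apply_of, mul_inv_eq_one]
      exact Subtype.ext (jwMatrix_comm hk hℓ hij))

theorem jwRep_gen (hk : 1 < k) (hℓ : 3 ≤ ℓ) (i : Fin (n - 1)) :
    (jwRep hk hℓ (BraidGroup.gen i) : Matrix (KLTableau k ℓ n) (KLTableau k ℓ n) ℂ) =
      jwMatrix k ℓ n i := by
  rw [jwRep, BraidGroup.gen, PresentedGroup.toGroup.of]

end Relations

/-! ### The computational subspace -/

theorem orthonormal_rowWord (k ℓ n : ℕ) : Orthonormal ℂ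
    fun t : KLTableau k ℓ n => (EuclideanSpace.single t.rowWord 1 : EuclideanSpace ℂ _) :=
  EuclideanSpace.orthonormal_single.comp _ KLTableau.rowWord_injective

/-- The vectors `|r(t)⟩` as a basis of the computational subspace. -/
def compModuleBasis (k ℓ n : ℕ) : Module.Basis (KLTableau k ℓ n) ℂ (compSubspace k ℓ n) :=
  Module.Basis.span (orthonormal_rowWord k ℓ n).linearIndependent

theorem compModuleBasis_apply {ℓ : ℕ} (t : KLTableau k ℓ n) :
    (compModuleBasis k ℓ n t : EuclideanSpace ℂ (Fin n → Fin k)) =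
      EuclideanSpace.single t.rowWord 1 :=
  congrArg Subtype.val (Module.Basis.span_apply (orthonormal_rowWord k ℓ n).linearIndependent t)

/-- The vectors `|r(t)⟩` as an orthonormal basis of the computational subspace. -/
def compBasis (k ℓ n : ℕ) : OrthonormalBasis (KLTableau k ℓ n) ℂ (compSubspace k ℓ n) :=
  (compModuleBasis k ℓ n).toOrthonormalBasis (by
    have h := orthonormal_rowWord k ℓ n
    rw [orthonormal_iff_ite] at h ⊢
    intro s t
    rw [← h s t, Submodule.coe_inner, compModuleBasis_apply, compModuleBasis_apply])

theorem compBasis_apply {ℓ : ℕ} (t : KLTableau k ℓ n) :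
    (compBasis k ℓ n t : EuclideanSpace ℂ (Fin n → Fin k)) = EuclideanSpace.single t.rowWord 1 := by
  rw [compBasis, Module.Basis.coe_toOrthonormalBasis, compModuleBasis_apply]

/-- The isometry `|t⟩ ↦ |r(t)⟩` onto the computational subspace. -/
def compEquiv (k ℓ n : ℕ) : EuclideanSpace ℂ (KLTableau k ℓ n) ≃ₗᵢ[ℂ] compSubspace k ℓ n :=
  (compBasis k ℓ n).repr.symm

theorem compEquiv_single {ℓ : ℕ} (t : KLTableau k ℓ n) :
    (compEquiv k ℓ n (EuclideanSpace.single t 1) : EuclideanSpace ℂ (Fin n → Fin k)) =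
      EuclideanSpace.single t.rowWord 1 := by
  rw [compEquiv, OrthonormalBasis.repr_symm_single, compBasis_apply]

/-- Unitary matrices as linear isometries of Euclidean space. -/
def unitaryToIsometry {ι : Type*} [Fintype ι] [DecidableEq ι] :
    Matrix.unitaryGroup ι ℂ →* (EuclideanSpace ℂ ι ≃ₗᵢ[ℂ] EuclideanSpace ℂ ι) :=
  Unitary.linearIsometryEquiv.toMonoidHom.comp
    { toFun := fun U => ⟨Matrix.toEuclideanCLM (n := ι) (𝕜 := ℂ) U, Unitary.map_mem _ U.2⟩
      map_one' := Subtype.ext (map_one _)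
      map_mul' := fun _ _ => Subtype.ext (map_mul _ _ _) }

theorem unitaryToIsometry_apply {ι : Type*} [Fintype ι] [DecidableEq ι]
    (U : Matrix.unitaryGroup ι ℂ) (v : EuclideanSpace ℂ ι) :
    unitaryToIsometry U v = Matrix.toEuclideanLin (U : Matrix ι ι ℂ) v := rfl

/-- The representation on the computational subspace that corresponds to `π`. -/
def compRep {ℓ : ℕ} (π : BraidGroup n →* Matrix.unitaryGroup (KLTableau k ℓ n) ℂ) :
    BraidGroup n →* (compSubspace k ℓ n ≃ₗᵢ[ℂ] compSubspace k ℓ n) where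
  toFun b := ((compEquiv k ℓ n).symm.trans (unitaryToIsometry (π b))).trans (compEquiv k ℓ n)
  map_one' := by
    ext v : 1
    simp
  map_mul' b c := by
    ext v : 1
    simp

theorem compRep_compEquiv {ℓ : ℕ} (π : BraidGroup n →* Matrix.unitaryGroup (KLTableau k ℓ n) ℂ)
    (b : BraidGroup n) (v : EuclideanSpace ℂ (KLTableau k ℓ n)) :
    compRep π b (compEquiv k ℓ n v) = compEquiv k ℓ n
      (Matrix.toEuclideanLin (π b : Matrix (KLTableau k ℓ n) (KLTableau k ℓ n) ℂ) v) := by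
  simp [compRep, unitaryToIsometry_apply]

/-! ### The layout of the qubits -/

/-- The number of qubits: `n` registers of `⌈log₂ k⌉` qubits, the `2n + 1` places of a token, and
a flag. -/
abbrev numQubits (n k : ℕ) : ℕ := n * Nat.clog 2 k + (2 * n + 2)

/-- The qubit `b` of the register `p`. -/
def regQubit (p : Fin n) (b : Fin (Nat.clog 2 k)) : Fin (numQubits n k) :=
  Fin.castAdd _ (finProdFinEquiv (p, b))

/-- The qubit of the place `p ≤ 2n` of the token. -/
def tokenQubit (n k p : ℕ) : Fin (numQubits n k) :=
  Fin.natAdd _ ⟨min p (2 * n), by omega⟩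

/-- The qubit of the flag. -/
def flagQubit (n k : ℕ) : Fin (numQubits n k) := Fin.natAdd _ ⟨2 * n + 1, by omega⟩

theorem regQubit_injective {p p' : Fin n} {b b' : Fin (Nat.clog 2 k)}
    (h : regQubit p b = regQubit p' b') : p = p' ∧ b = b' := by
  have := finProdFinEquiv.injective (Fin.castAdd_injective _ _ h)
  simpa using this

/-- The qubits `Fin.natAdd _ e` are the ancillas. -/
theorem regQubit_ne_natAdd (p : Fin n) (b : Fin (Nat.clog 2 k)) (e : Fin (2 * n + 2)) :
    regQubit p b ≠ Fin.natAdd _ e := by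
  intro h
  have h' := congrArg Fin.val h
  simp only [regQubit, Fin.val_castAdd, Fin.val_natAdd] at h'
  have := (finProdFinEquiv (p, b)).2
  omega

theorem regQubit_ne_tokenQubit (p : Fin n) (b : Fin (Nat.clog 2 k)) (q : ℕ) :
    regQubit p b ≠ tokenQubit n k q := regQubit_ne_natAdd _ _ _

theorem regQubit_ne_flagQubit (p : Fin n) (b : Fin (Nat.clog 2 k)) :
    regQubit p b ≠ flagQubit n k := regQubit_ne_natAdd _ _ _

theorem flagQubit_ne_tokenQubit (q : ℕ) : flagQubit n k ≠ tokenQubit n k q := by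
  simp only [flagQubit, tokenQubit, ne_eq, Fin.ext_iff, Fin.val_natAdd]
  omega

theorem tokenQubit_injOn : Set.InjOn (tokenQubit n k) (Set.Iic (2 * n)) := by
  intro p hp q hq h
  simp only [tokenQubit, Fin.ext_iff, Fin.val_natAdd] at h
  simp only [Set.mem_Iic] at hp hq
  omega

theorem ext_qubits {y y' : Fin (numQubits n k) → Bool}
    (h1 : ∀ p b, y (regQubit p b) = y' (regQubit p b))
    (h2 : ∀ e, y (Fin.natAdd _ e) = y' (Fin.natAdd _ e)) : y = y' := by
  funext q
  refine Fin.addCases (fun j => ?_) h2 q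
  obtain ⟨⟨p, b⟩, rfl⟩ := finProdFinEquiv.surjective j
  exact h1 p b

theorem encodeBits_regQubit (r : Fin n → Fin k) (p : Fin n) (b : Fin (Nat.clog 2 k)) :
    encodeBits (2 * n + 2) r (regQubit p b) = (r p).val.testBit b := by
  have h : finProdFinEquiv.symm (finProdFinEquiv (p, b)) = (p, b) := Equiv.symm_apply_apply _ _
  rw [finProdFinEquiv_symm_apply, Prod.mk.injEq] at h
  rw [encodeBits, regQubit, Fin.append_left, h.1, h.2]

theorem encodeBits_natAdd (r : Fin n → Fin k) (e : Fin (2 * n + 2)) :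
    encodeBits (2 * n + 2) r (Fin.natAdd _ e) = false := by
  rw [encodeBits, Fin.append_right]

theorem encodeBits_injective : Function.Injective (encodeBits (n := n) (k := k) (2 * n + 2)) := by
  intro r s h
  funext p
  refine Fin.ext (Nat.eq_of_testBit_eq fun b => ?_)
  by_cases hb : b < Nat.clog 2 k
  · rw [← encodeBits_regQubit r p ⟨b, hb⟩, h, encodeBits_regQubit]
  · have hk : ∀ z : Fin k, z.val.testBit b = false := fun z => by
      refine Nat.testBit_eq_false_of_lt (z.2.trans_le ((Nat.le_pow_clog one_lt_two k).trans ?_))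
      exact Nat.pow_le_pow_right (by norm_num) (not_lt.1 hb)
    rw [hk, hk]

/-- The condition that the register `p` contains the letter `z`. -/
def letterPattern (p : Fin n) (z : Fin k) : List (Fin (numQubits n k) × Bool) :=
  (List.finRange _).map fun b => (regQubit p b, z.val.testBit b)

theorem matches_letterPattern (p : Fin n) (z : Fin k) (y : Fin (numQubits n k) → Bool) :
    Matches (letterPattern p z) y ↔ ∀ b, y (regQubit p b) = z.val.testBit b := by
  simp [Matches, letterPattern]

theorem matches_append {N : ℕ} (l l' : List (Fin N × Bool)) (y : Fin N → Bool) :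
    Matches (l ++ l') y ↔ Matches l y ∧ Matches l' y := by
  simp only [Matches, List.mem_append, or_imp, forall_and]

theorem matches_letterPattern_encodeBits (p : Fin n) (z : Fin k) (r : Fin n → Fin k) :
    Matches (letterPattern p z) (encodeBits (2 * n + 2) r) ↔ r p = z := by
  rw [matches_letterPattern]
  simp only [encodeBits_regQubit]
  refine ⟨fun h => ?_, fun h b => by rw [h]⟩
  have : Function.update r p z = r := encodeBits_injective (ext_qubits (fun q b => by
    rw [encodeBits_regQubit, encodeBits_regQubit]
    by_cases hq : q = p
    · subst hq; simp [h]
    · simp [hq]) fun e => by rw [encodeBits_natAdd, encodeBits_natAdd])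
  rw [← congrFun this p, Function.update_self]

theorem length_letterPattern (p : Fin n) (z : Fin k) :
    (letterPattern p z).length = Nat.clog 2 k := by simp [letterPattern]

theorem map_fst_letterPattern (p : Fin n) (z : Fin k) :
    (letterPattern p z).map Prod.fst = (List.finRange _).map (regQubit p) := by
  simp [letterPattern, Function.comp_def]

theorem nodup_letterPattern (p : Fin n) (z : Fin k) :
    ((letterPattern p z).map Prod.fst).Nodup := by
  rw [map_fst_letterPattern]
  exact (List.nodup_finRange _).map fun b b' h => (regQubit_injective h).2

theorem natAdd_notMem_letterPattern (p : Fin n) (z : Fin k) (e : Fin (2 * n + 2)) :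
    Fin.natAdd _ e ∉ (letterPattern p z).map Prod.fst := by
  rw [map_fst_letterPattern, List.mem_map]
  rintro ⟨b, -, h⟩
  exact regQubit_ne_natAdd _ _ _ h

/-- The condition that the registers `i` and `i + 1` contain the letters `x` and `y`. -/
def pairPattern (i : Fin (n - 1)) (x y : Fin k) : List (Fin (numQubits n k) × Bool) :=
  letterPattern (leftPos i) x ++ letterPattern (rightPos i) y

theorem nodup_pairPattern (i : Fin (n - 1)) (x y : Fin k) :
    ((pairPattern i x y).map Prod.fst).Nodup := by
  rw [pairPattern, List.map_append, List.nodup_append]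
  refine ⟨nodup_letterPattern _ _, nodup_letterPattern _ _, ?_⟩
  rw [map_fst_letterPattern, map_fst_letterPattern]
  intro a ha b hb hab
  obtain ⟨c, -, rfl⟩ := List.mem_map.1 ha
  obtain ⟨d, -, rfl⟩ := List.mem_map.1 hb
  exact leftPos_ne_rightPos i (regQubit_injective hab).1

theorem natAdd_notMem_pairPattern (i : Fin (n - 1)) (x y : Fin k) (e : Fin (2 * n + 2)) :
    Fin.natAdd _ e ∉ (pairPattern i x y).map Prod.fst := by
  rw [pairPattern, List.map_append, List.mem_append, not_or]
  exact ⟨natAdd_notMem_letterPattern _ _ _, natAdd_notMem_letterPattern _ _ _⟩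

theorem length_pairPattern (i : Fin (n - 1)) (x y : Fin k) :
    (pairPattern i x y).length = 2 * Nat.clog 2 k := by
  rw [pairPattern, List.length_append, length_letterPattern, length_letterPattern, two_mul]

theorem matches_pairPattern_encodeBits (i : Fin (n - 1)) (x y : Fin k) (r : Fin n → Fin k) :
    Matches (pairPattern i x y) (encodeBits (2 * n + 2) r) ↔
      r (leftPos i) = x ∧ r (rightPos i) = y := by
  rw [pairPattern, matches_append, matches_letterPattern_encodeBits,
    matches_letterPattern_encodeBits]

/-! ### Computing the axial distance and the order of the two letters -/

/-- The number of places by which the token moves for the letter `z`. -/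
def letterWeight (x y z : Fin k) : ℕ := if z = x then 2 else if z = y then 0 else 1

/-- The conditions of the shifts for the first `m` letters: the letter `z` gives
`letterWeight x y z` shifts. -/
def prefixConditions (x y : Fin k) : ℕ → List (List (Fin (numQubits n k) × Bool))
  | 0 => []
  | m + 1 => prefixConditions x y m ++ if h : m < n then
      (List.finRange k).flatMap fun z =>
        List.replicate (letterWeight x y z) (letterPattern ⟨m, h⟩ z)
    else []

theorem mem_prefixConditions {x y : Fin k} {m : ℕ} {l : List (Fin (numQubits n k) × Bool)}
    (hl : l ∈ prefixConditions x y m) : ∃ p z, l = letterPattern p z := by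
  induction m with
  | zero => simp [prefixConditions] at hl
  | succ m ih =>
    rw [prefixConditions, List.mem_append] at hl
    rcases hl with hl | hl
    · exact ih hl
    · split_ifs at hl with h
      · obtain ⟨z, -, hz⟩ := List.mem_flatMap.1 hl
        exact ⟨_, _, List.eq_of_mem_replicate hz⟩
      · simp at hl

theorem length_prefixConditions (x y : Fin k) (m : ℕ) :
    (prefixConditions (n := n) x y m).length ≤ m * (2 * k) := by
  induction m with
  | zero => simp [prefixConditions]
  | succ m ih =>
    rw [prefixConditions, List.length_append, Nat.succ_mul]
    refine Nat.add_le_add ih ?_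
    split_ifs with h
    · rw [List.length_flatMap]
      have : ∀ z ∈ List.finRange k, (List.replicate (letterWeight x y z)
          (letterPattern (k := k) ⟨m, h⟩ z)).length ≤ 2 := fun z _ => by
        rw [List.length_replicate, letterWeight]
        split_ifs <;> omega
      refine (List.sum_le_card_nsmul _ 2 fun c hc => ?_).trans ?_
      · obtain ⟨z, hz, rfl⟩ := List.mem_map.1 hc
        exact this z hz
      · simp [mul_comm]
    · simp

open Classical in
/-- After `m` letters the token has moved to the place `m + #x - #y`. -/
theorem countP_prefixConditions {x y : Fin k} (hxy : x ≠ y) (r : Fin n → Fin k) (m : ℕ)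
    (hm : m ≤ n) :
    (((prefixConditions x y m).countP fun l => Matches l (encodeBits (2 * n + 2) r) : ℕ) : ℤ) =
      m + letterCount r m x - letterCount r m y := by
  induction m with
  | zero => simp [prefixConditions, letterCount]
  | succ m ih =>
    have hs := fun a => letterCount_succ r ⟨m, hm⟩ a
    simp only at hs
    have hc : ((List.finRange k).flatMap fun z => List.replicate (letterWeight x y z)
        (letterPattern ⟨m, hm⟩ z)).countP
          (fun l => Matches l (encodeBits (2 * n + 2) r)) = letterWeight x y (r ⟨m, hm⟩) := by
      rw [List.countP_flatMap]
      simp only [Function.comp_def, List.countP_replicate, decide_eq_true_eq,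
        matches_letterPattern_encodeBits]
      rw [← Fin.sum_univ_def]
      simp
    rw [prefixConditions, List.countP_append, dif_pos (show m < n from hm), hc, Nat.cast_add,
      ih (by omega), hs, hs, letterWeight]
    by_cases h1 : r ⟨m, hm⟩ = x
    · have h2 : r ⟨m, hm⟩ ≠ y := h1 ▸ hxy
      simp [h1, hxy]; ring
    · by_cases h2 : r ⟨m, hm⟩ = y
      · have h3 : y ≠ x := hxy.symm
        simp [h2, h3]
        ring
      · simp [h1, h2]; ring

theorem letterCount_le (r : Fin n → Fin k) (m : ℕ) (a : Fin k) : letterCount r m a ≤ n := by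
  refine (Finset.card_le_univ _).trans ?_
  simp

/-- The place of the token after the first `m` letters. -/
def tokenPlace (x y : Fin k) (r : Fin n → Fin k) (m : ℕ) : ℕ :=
  m + letterCount r m x - letterCount r m y

/-- The qubits in which the contents of the registers `i` and `i + 1` differ when these contain two
different letters `x` and `y`. -/
def diffQubits (i : Fin (n - 1)) (x y : Fin k) : List (Fin (numQubits n k)) :=
  ((List.finRange (Nat.clog 2 k)).filter fun b : Fin _ => x.val.testBit b ≠ y.val.testBit b).map
      (regQubit (leftPos i)) ++
    ((List.finRange (Nat.clog 2 k)).filter fun b : Fin _ => x.val.testBit b ≠ y.val.testBit b).map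
      (regQubit (rightPos i))

/-- The classical computation that moves the token to the place given by the numbers of letters `x`
and `y` before the register `i`, and that replaces the contents `y, x` of the registers `i`, `i + 1`
by `x, y` and a raised flag. -/
def prepSteps (i : Fin (n - 1)) (x y : Fin k) : List (NotStep (numQubits n k)) :=
  ([], tokenQubit n k 0) ::
    ((prefixConditions x y i).flatMap (fun l => shiftSteps (tokenQubit n k) l (2 * n)) ++
      (pairPattern i y x, flagQubit n k) ::
        (diffQubits i x y).map fun q => ([(flagQubit n k, true)], q))

/-- The registers contain `r` and the token is at its place for the prefix before `i`. -/
def tokenState (i : Fin (n - 1)) (x y : Fin k) (r : Fin n → Fin k) :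
    Fin (numQubits n k) → Bool :=
  Function.update (encodeBits (2 * n + 2) r) (tokenQubit n k (tokenPlace x y r i)) true

theorem tokenPlace_le (x y : Fin k) (r : Fin n → Fin k) {m : ℕ} (hm : m ≤ n) :
    tokenPlace x y r m ≤ 2 * n := by
  have := letterCount_le r m x
  rw [tokenPlace]
  omega

theorem tokenPlace_cast {x y : Fin k} (hxy : x ≠ y) (r : Fin n → Fin k) {m : ℕ} (hm : m ≤ n) :
    (tokenPlace x y r m : ℤ) = m + letterCount r m x - letterCount r m y := by
  classical
  have := countP_prefixConditions hxy r m hm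
  rw [tokenPlace]
  omega

theorem tokenState_flagQubit (i : Fin (n - 1)) (x y : Fin k) (r : Fin n → Fin k) :
    tokenState i x y r (flagQubit n k) = false := by
  rw [tokenState, Function.update_of_ne (flagQubit_ne_tokenQubit _)]
  exact encodeBits_natAdd _ _

theorem tokenState_tokenQubit (i : Fin (n - 1)) (x y : Fin k) (r : Fin n → Fin k)
    {p : ℕ} (hp : p ≤ 2 * n) :
    tokenState i x y r (tokenQubit n k p) = true ↔ p = tokenPlace x y r i := by
  have hi := i.2
  rw [tokenState]
  by_cases h : p = tokenPlace x y r i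
  · simp [h]
  · rw [Function.update_of_ne fun h' => h (tokenQubit_injOn hp
      (tokenPlace_le x y r (by omega)) h')]
    simp only [h, iff_false, Bool.not_eq_true]
    exact encodeBits_natAdd _ _

theorem matches_pairPattern_tokenState (i : Fin (n - 1)) (x y x' y' : Fin k) (r : Fin n → Fin k) :
    Matches (pairPattern i x' y') (tokenState i x y r) ↔
      r (leftPos i) = x' ∧ r (rightPos i) = y' := by
  have h : tokenQubit n k (tokenPlace x y r i) ∉ (pairPattern i x' y').map Prod.fst :=
    natAdd_notMem_pairPattern _ _ _ _
  rw [tokenState, matches_update h, matches_pairPattern_encodeBits]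

theorem runSteps_prefix {i : Fin (n - 1)} {x y : Fin k} (hxy : x ≠ y) (r : Fin n → Fin k) :
    runSteps ((prefixConditions x y i).flatMap (fun l => shiftSteps (tokenQubit n k) l (2 * n)))
      (NotStep.run ([], tokenQubit n k 0) (encodeBits (2 * n + 2) r)) = tokenState i x y r := by
  classical
  have hi : i.val ≤ n := by have := i.2; omega
  have h0 : NotStep.run ([], tokenQubit n k 0) (encodeBits (2 * n + 2) r) =
      Function.update (encodeBits (2 * n + 2) r) (tokenQubit n k 0) true := by
    rw [NotStep.run, if_pos (by simp [Matches])]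
    have : encodeBits (2 * n + 2) r (tokenQubit n k 0) = false := encodeBits_natAdd _ _
    simp [this]
  have hc := countP_prefixConditions hxy r i hi
  have hp := tokenPlace_cast hxy r hi
  have hp' := tokenPlace_le x y r hi
  have hc' := Nat.cast_injective (hc.trans hp.symm)
  rw [h0, runSteps_flatMap_shiftSteps (M := 2 * n) tokenQubit_injOn
    (fun p _ => encodeBits_natAdd _ _) _ ?_ 0 (by rw [zero_add]; exact hc'.trans_le hp'),
    tokenState]
  · congr 2
    rw [zero_add]
    exact hc'
  · intro l hl p _
    obtain ⟨q, z, rfl⟩ := mem_prefixConditions hl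
    exact natAdd_notMem_letterPattern _ _ _

theorem regQubit_mem_diffQubits (i : Fin (n - 1)) (x y : Fin k) (p : Fin n)
    (b : Fin (Nat.clog 2 k)) : regQubit p b ∈ diffQubits i x y ↔
      (p = leftPos i ∨ p = rightPos i) ∧ x.val.testBit b ≠ y.val.testBit b := by
  simp only [diffQubits, List.mem_append, List.mem_map, List.mem_filter, List.mem_finRange,
    true_and, decide_eq_true_eq]
  constructor
  · rintro (⟨c, hc, h⟩ | ⟨c, hc, h⟩)
    · obtain ⟨rfl, rfl⟩ := regQubit_injective h
      exact ⟨Or.inl rfl, hc⟩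
    · obtain ⟨rfl, rfl⟩ := regQubit_injective h
      exact ⟨Or.inr rfl, hc⟩
  · rintro ⟨rfl | rfl, h⟩
    · exact Or.inl ⟨b, h, rfl⟩
    · exact Or.inr ⟨b, h, rfl⟩

theorem natAdd_notMem_diffQubits (i : Fin (n - 1)) (x y : Fin k) (e : Fin (2 * n + 2)) :
    Fin.natAdd _ e ∉ diffQubits i x y := by
  simp only [diffQubits, List.mem_append, List.mem_map, not_or, not_exists, not_and]
  exact ⟨fun b _ h => regQubit_ne_natAdd _ _ _ h, fun b _ h => regQubit_ne_natAdd _ _ _ h⟩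

theorem flagQubit_notMem_diffQubits (i : Fin (n - 1)) (x y : Fin k) :
    flagQubit n k ∉ diffQubits i x y := natAdd_notMem_diffQubits _ _ _ _

theorem nodup_diffQubits (i : Fin (n - 1)) (x y : Fin k) : (diffQubits i x y).Nodup := by
  have h : ∀ p : Fin n, (((List.finRange (Nat.clog 2 k)).filter
      fun b : Fin _ => x.val.testBit b ≠ y.val.testBit b).map (regQubit p)).Nodup := fun p =>
    ((List.nodup_finRange _).filter _).map fun b b' h => (regQubit_injective h).2
  rw [diffQubits, List.nodup_append]
  refine ⟨h _, h _, ?_⟩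
  intro a ha b hb hab
  obtain ⟨c, -, rfl⟩ := List.mem_map.1 ha
  obtain ⟨d, -, rfl⟩ := List.mem_map.1 hb
  exact leftPos_ne_rightPos i (regQubit_injective hab).1

theorem tokenPlace_swapWord (x y : Fin k) (r : Fin n → Fin k) (i : Fin (n - 1)) :
    tokenPlace x y (swapWord r i) i = tokenPlace x y r i := by
  simp only [tokenPlace, letterCount_swapWord (i := i) (m := i) (Or.inl le_rfl)]

theorem runSteps_prepSteps_of_not {i : Fin (n - 1)} {x y : Fin k} (hxy : x ≠ y)
    {r : Fin n → Fin k} (h : ¬ (r (leftPos i) = y ∧ r (rightPos i) = x)) :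
    runSteps (prepSteps i x y) (encodeBits (2 * n + 2) r) = tokenState i x y r := by
  rw [prepSteps, runSteps_cons, runSteps_append, runSteps_prefix hxy, runSteps_cons, NotStep.run,
    if_neg (by rwa [matches_pairPattern_tokenState]),
    runSteps_map_target _ _ (nodup_diffQubits i x y) (flagQubit_notMem_diffQubits i x y),
    tokenState_flagQubit]
  simp

theorem runSteps_prepSteps {i : Fin (n - 1)} {x y : Fin k} (hxy : x ≠ y)
    {r : Fin n → Fin k} (h1 : r (leftPos i) = y) (h2 : r (rightPos i) = x) :
    runSteps (prepSteps i x y) (encodeBits (2 * n + 2) r) =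
      Function.update (tokenState i x y (swapWord r i)) (flagQubit n k) true := by
  rw [prepSteps, runSteps_cons, runSteps_append, runSteps_prefix hxy, runSteps_cons, NotStep.run,
    if_pos (by rw [matches_pairPattern_tokenState]; exact ⟨h1, h2⟩)]
  simp only [tokenState_flagQubit, Bool.not_false]
  rw [runSteps_map_target _ _ (nodup_diffQubits i x y) (flagQubit_notMem_diffQubits i x y),
    Function.update_self, if_pos rfl]
  refine ext_qubits (fun p b => ?_) fun e => ?_
  · simp only [tokenState, regQubit_mem_diffQubits,
      Function.update_of_ne (regQubit_ne_flagQubit _ _),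
      Function.update_of_ne (regQubit_ne_tokenQubit _ _ _), encodeBits_regQubit]
    by_cases hl : p = leftPos i
    · subst hl
      rw [swapWord_left, h1, h2]
      simp only [true_or, true_and]
      cases x.val.testBit b <;> cases y.val.testBit b <;> simp
    · by_cases hr : p = rightPos i
      · subst hr
        rw [swapWord_right, h1, h2]
        simp only [or_true, true_and]
        cases x.val.testBit b <;> cases y.val.testBit b <;> simp
      · simp [hl, hr, swapWord_of_ne]
  · rw [if_neg (natAdd_notMem_diffQubits _ _ _ _)]
    simp only [Function.update_apply, tokenState, encodeBits_natAdd, tokenPlace_swapWord]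

theorem length_prepSteps (i : Fin (n - 1)) (x y : Fin k) :
    (prepSteps i x y).length ≤ 2 + n * (2 * k) * (4 * n) + 2 * Nat.clog 2 k := by
  have hf : ((List.finRange (Nat.clog 2 k)).filter
      fun b : Fin _ => x.val.testBit b ≠ y.val.testBit b).length ≤ Nat.clog 2 k := by
    refine (List.length_filter_le _ _).trans ?_
    simp
  have hp : (prefixConditions (n := n) x y i).length ≤ n * (2 * k) :=
    (length_prefixConditions x y i).trans
      (Nat.mul_le_mul_right _ (by have := i.2; omega))
  have hs : ((prefixConditions (n := n) x y i).flatMap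
      (fun l => shiftSteps (tokenQubit n k) l (2 * n))).length ≤ n * (2 * k) * (4 * n) := by
    rw [List.length_flatMap]
    simp only [length_shiftSteps, List.map_const', List.sum_replicate, smul_eq_mul]
    refine Nat.mul_le_mul hp (by omega)
  rw [prepSteps, List.length_cons, List.length_append, List.length_cons, List.length_map,
    diffQubits, List.length_append, List.length_map, List.length_map]
  omega

theorem prepSteps_wellFormed (i : Fin (n - 1)) (x y : Fin k) :
    ∀ s ∈ prepSteps i x y, NotStep.WellFormed (2 * Nat.clog 2 k + 1) s := by
  intro s hs
  rw [prepSteps, List.mem_cons, List.mem_append, List.mem_cons] at hs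
  rcases hs with rfl | hs | rfl | hs
  · exact ⟨by simp, by simp, by simp⟩
  · obtain ⟨l, hl, hs⟩ := List.mem_flatMap.1 hs
    obtain ⟨q, z, rfl⟩ := mem_prefixConditions hl
    exact shiftSteps_wellFormed (M := 2 * n) tokenQubit_injOn
      (fun p _ => natAdd_notMem_letterPattern _ _ _) (nodup_letterPattern _ _)
      (by rw [length_letterPattern]; omega) _ le_rfl s hs
  · exact ⟨nodup_pairPattern _ _ _, natAdd_notMem_pairPattern _ _ _ _,
      by rw [length_pairPattern]; omega⟩
  · obtain ⟨q, hq, rfl⟩ := List.mem_map.1 hs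
    refine ⟨by simp, ?_, by simp⟩
    simp only [List.map_cons, List.map_nil, List.mem_singleton]
    rintro rfl
    exact natAdd_notMem_diffQubits _ _ _ _ hq

/-! ### The circuit of a generator -/

/-- The projection `π(e_i)` on the span of `|t⟩` and `|s_i(t)⟩`, for the axial distance `d`. -/
def blockProj (ℓ : ℕ) (d : ℤ) : Matrix Bool Bool ℂ :=
  .of fun a b => if a = b then (aCoeff ℓ (if a then -d else d) : ℂ) else sCoeff ℓ d

theorem isStarProjection_blockProj {ℓ : ℕ} (hℓ : 3 ≤ ℓ) (d : ℤ) :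
    IsStarProjection (blockProj ℓ d) := by
  have h1 : (aCoeff ℓ d * aCoeff ℓ d + sCoeff ℓ d * sCoeff ℓ d : ℂ) = aCoeff ℓ d := by
    exact_mod_cast aCoeff_mul_self_add hℓ d
  have h2 : (aCoeff ℓ (-d) * aCoeff ℓ (-d) + sCoeff ℓ d * sCoeff ℓ d : ℂ) = aCoeff ℓ (-d) := by
    have := aCoeff_mul_self_add hℓ (-d)
    rw [sCoeff_neg] at this
    exact_mod_cast this
  have h3 : (sCoeff ℓ d * (aCoeff ℓ d + aCoeff ℓ (-d)) : ℂ) = sCoeff ℓ d := by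
    exact_mod_cast sCoeff_mul_aCoeff_add hℓ d
  constructor
  · ext a b
    rw [Matrix.mul_apply, Fintype.sum_bool]
    cases a <;> cases b <;> simp [blockProj]
    · linear_combination h1
    · linear_combination h3
    · linear_combination h3
    · exact h2
  · ext a b
    rw [Matrix.star_apply]
    cases a <;> cases b <;> simp [blockProj]

/-- The operator that acts by `1 + (z - 1) π(e_i)` on the words with the letters `x`, `y` in some
order at `i`, `i + 1`, and trivially on all other words. -/
def pairOp (ℓ : ℕ) (z : ℂ) (i : Fin (n - 1)) (p : Fin k × Fin k) :
    Matrix (Fin (numQubits n k) → Bool) (Fin (numQubits n k) → Bool) ℂ :=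
  (stepsMatrix (prepSteps i p.1 p.2))ᴴ *
    (tokenCtrl (tokenQubit n k) (pairPattern i p.1 p.2) (flagQubit n k)
        (fun m => phaseGate (blockProj ℓ (m - i - (p.1 : ℕ) + (p.2 : ℕ))) z) (2 * n) *
      stepsMatrix (prepSteps i p.1 p.2))

theorem flagQubit_notMem_pairPattern (i : Fin (n - 1)) (x y : Fin k) :
    flagQubit n k ∉ (pairPattern i x y).map Prod.fst := natAdd_notMem_pairPattern _ _ _ _

theorem two_le_numQubits (n k : ℕ) : 2 ≤ numQubits n k := by simp [numQubits]; omega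

theorem stepsMatrix_prepSteps (i : Fin (n - 1)) (x y : Fin k) (v : Fin (numQubits n k) → Bool) :
    stepsMatrix (prepSteps i x y) *ᵥ ket v = ket (runSteps (prepSteps i x y) v) :=
  stepsMatrix_mulVec_ket _ (prepSteps_wellFormed i x y) v

theorem stepsMatrix_prepSteps_conjTranspose (i : Fin (n - 1)) (x y : Fin k)
    (v : Fin (numQubits n k) → Bool) :
    (stepsMatrix (prepSteps i x y))ᴴ *ᵥ ket (runSteps (prepSteps i x y) v) = ket v :=
  Matrix.conjTranspose_mulVec_of_unitary (realizable_stepsMatrix (two_le_numQubits n k) _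
    (prepSteps_wellFormed i x y)).mem_unitaryGroup (stepsMatrix_prepSteps i x y v)

/-- On a word without the letters `x`, `y` at `i`, `i + 1` the gates on the flag do not act, and the
classical computation is undone. -/
theorem pairOp_mulVec_of_not {ℓ : ℕ} {z : ℂ} {i : Fin (n - 1)} {p : Fin k × Fin k}
    (hp : p.1 ≠ p.2) {r : Fin n → Fin k}
    (h1 : ¬ (r (leftPos i) = p.1 ∧ r (rightPos i) = p.2))
    (h2 : ¬ (r (leftPos i) = p.2 ∧ r (rightPos i) = p.1)) :
    pairOp ℓ z i p *ᵥ ket (encodeBits (2 * n + 2) r) = ket (encodeBits (2 * n + 2) r) := by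
  have hrun := runSteps_prepSteps_of_not hp h2
  have hV := stepsMatrix_prepSteps i p.1 p.2 (encodeBits (2 * n + 2) r)
  have hV' := stepsMatrix_prepSteps_conjTranspose i p.1 p.2 (encodeBits (2 * n + 2) r)
  rw [hrun] at hV hV'
  rw [pairOp, ← Matrix.mulVec_mulVec, ← Matrix.mulVec_mulVec, hV,
    tokenCtrl_mulVec_of_not_matches (flagQubit_notMem_pairPattern _ _ _)
      (fun q _ => flagQubit_ne_tokenQubit q) (by rwa [matches_pairPattern_tokenState]), hV']

/-- The two words in question become the states `0` and `1` of the flag, on which the gate that is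
selected by the token acts. -/
theorem pairOp_mulVec_qubitState {ℓ : ℕ} {z : ℂ} {i : Fin (n - 1)} {p : Fin k × Fin k}
    (hp : p.1 ≠ p.2) {r : Fin n → Fin k} (h1 : r (leftPos i) = p.1) (h2 : r (rightPos i) = p.2)
    (b : Bool) :
    pairOp ℓ z i p *ᵥ ket (encodeBits (2 * n + 2) (if b then swapWord r i else r)) =
      phaseGate (blockProj ℓ (wordDist r i)) z false b • ket (encodeBits (2 * n + 2) r) +
      phaseGate (blockProj ℓ (wordDist r i)) z true b •
        ket (encodeBits (2 * n + 2) (swapWord r i)) := by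
  have hi := i.2
  have hrun : runSteps (prepSteps i p.1 p.2) (encodeBits (2 * n + 2) r) =
      Function.update (tokenState i p.1 p.2 r) (flagQubit n k) false := by
    rw [runSteps_prepSteps_of_not hp fun h => hp (h1 ▸ h.1),
      ← tokenState_flagQubit i p.1 p.2 r, Function.update_eq_self]
  have hrun' : runSteps (prepSteps i p.1 p.2) (encodeBits (2 * n + 2) (swapWord r i)) =
      Function.update (tokenState i p.1 p.2 r) (flagQubit n k) true := by
    rw [runSteps_prepSteps hp (by rw [swapWord_left, h2]) (by rw [swapWord_right, h1]),
      swapWord_swapWord]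
  have hV := stepsMatrix_prepSteps i p.1 p.2
    (encodeBits (2 * n + 2) (if b then swapWord r i else r))
  have hV0 := stepsMatrix_prepSteps_conjTranspose i p.1 p.2 (encodeBits (2 * n + 2) r)
  have hV1 := stepsMatrix_prepSteps_conjTranspose i p.1 p.2
    (encodeBits (2 * n + 2) (swapWord r i))
  have hb : ket (runSteps (prepSteps i p.1 p.2)
      (encodeBits (2 * n + 2) (if b then swapWord r i else r))) =
      qubitState (flagQubit n k) (tokenState i p.1 p.2 r) (ket b) := by
    cases b
    · simp [hrun, qubitState, ket_apply]
    · simp [hrun', qubitState, ket_apply]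
  have hd : ((tokenPlace p.1 p.2 r i : ℕ) : ℤ) - i - (p.1 : ℕ) + (p.2 : ℕ) = wordDist r i := by
    rw [tokenPlace_cast hp r (by omega), wordDist, wordContent, wordContent, h1, h2]
    ring
  rw [hrun] at hV0
  rw [hrun'] at hV1
  rw [pairOp, ← Matrix.mulVec_mulVec, ← Matrix.mulVec_mulVec, hV, hb,
    tokenCtrl_mulVec_of_matches (flagQubit_notMem_pairPattern _ _ _)
      (fun q _ => flagQubit_ne_tokenQubit q)
      (by rw [matches_pairPattern_tokenState]; exact ⟨h1, h2⟩)
      (tokenPlace_le p.1 p.2 r (by omega)) (fun q hq => tokenState_tokenQubit i p.1 p.2 r hq),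
    hd, qubitState, Matrix.mulVec_add, Matrix.mulVec_smul, Matrix.mulVec_smul, hV0, hV1,
    mulVec_ket_apply, mulVec_ket_apply]

theorem pairOp_mulVec {ℓ : ℕ} {z : ℂ} {i : Fin (n - 1)} {p : Fin k × Fin k}
    (hp : p.1 ≠ p.2) {r : Fin n → Fin k}
    (h : (r (leftPos i) = p.1 ∧ r (rightPos i) = p.2) ∨
      (r (leftPos i) = p.2 ∧ r (rightPos i) = p.1)) :
    pairOp ℓ z i p *ᵥ ket (encodeBits (2 * n + 2) r) = ket (encodeBits (2 * n + 2) r) +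
      (z - 1) • ((aCoeff ℓ (wordDist r i) : ℂ) • ket (encodeBits (2 * n + 2) r) +
        (sCoeff ℓ (wordDist r i) : ℂ) • ket (encodeBits (2 * n + 2) (swapWord r i))) := by
  rcases h with ⟨h1, h2⟩ | ⟨h1, h2⟩
  · have := pairOp_mulVec_qubitState (ℓ := ℓ) (z := z) hp h1 h2 false
    rw [if_neg (by simp)] at this
    rw [this]
    simp only [phaseGate, blockProj, Matrix.add_apply, Matrix.sub_apply, Matrix.smul_apply,
      Matrix.of_apply, Matrix.one_apply, smul_eq_mul, if_true, reduceCtorEq, if_false,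
      Bool.false_eq_true]
    module
  · have := pairOp_mulVec_qubitState (ℓ := ℓ) (z := z) (r := swapWord r i) hp
      (by rw [swapWord_left, h2]) (by rw [swapWord_right, h1]) true
    rw [if_pos rfl, swapWord_swapWord, wordDist_swapWord] at this
    rw [this]
    simp only [phaseGate, blockProj, Matrix.add_apply, Matrix.sub_apply, Matrix.smul_apply,
      Matrix.of_apply, Matrix.one_apply, smul_eq_mul, if_true, reduceCtorEq, if_false,
      neg_neg, sCoeff_neg]
    module

/-- The pairs `x < y` of letters. -/
def letterPairs (k : ℕ) : List (Fin k × Fin k) :=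
  (Finset.univ.filter fun p : Fin k × Fin k => p.1 < p.2).toList

/-- The operator `q ∏ (1 - (1 + q⁻¹) π(e_i))`, the product being over the pairs of letters, the
factor of a pair acting only on the words with these letters at `i` and `i + 1`. -/
def genOp (ℓ : ℕ) (i : Fin (n - 1)) :
    Matrix (Fin (numQubits n k) → Bool) (Fin (numQubits n k) → Bool) ℂ :=
  ctrl (Matches []) (flagQubit n k) (phaseGate 1 (qRoot ℓ)) *
    ((letterPairs k).map (pairOp ℓ (-star (qRoot ℓ)) i)).prod

theorem ctrl_nil_phaseGate_one_mulVec {N : ℕ} (f : Fin N) (z : ℂ) (v : (Fin N → Bool) → ℂ) :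
    ctrl (Matches []) f (phaseGate 1 z) *ᵥ v = z • v := by
  have : ctrl (Matches []) f (phaseGate 1 z) =
      z • (1 : Matrix (Fin N → Bool) (Fin N → Bool) ℂ) := by
    refine Matrix.ext_ket fun y => ?_
    rw [ket_eq_qubitState f, ctrl_mulVec_qubitState_pos _ (by simp [Matches]) (by simp [Matches])]
    simp [phaseGate, Matrix.smul_mulVec, qubitState, smul_smul]
  rw [this, Matrix.smul_mulVec, Matrix.one_mulVec]

theorem genOp_mulVec_of_eq {ℓ : ℕ} {i : Fin (n - 1)} {r : Fin n → Fin k}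
    (h : r (leftPos i) = r (rightPos i)) :
    genOp ℓ i *ᵥ ket (encodeBits (2 * n + 2) r) =
      qRoot ℓ • ket (encodeBits (2 * n + 2) r) := by
  rw [genOp, ← Matrix.mulVec_mulVec, listProd_mulVec_fixed, ctrl_nil_phaseGate_one_mulVec]
  intro p hp
  have hp' : p.1 ≠ p.2 := ne_of_lt (by simpa [letterPairs] using hp)
  refine pairOp_mulVec_of_not hp' ?_ ?_
  · rintro ⟨h1, h2⟩
    exact hp' (by rw [← h1, ← h2, h])
  · rintro ⟨h1, h2⟩
    exact hp' (by rw [← h1, ← h2, h])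

theorem genOp_mulVec_of_ne {ℓ : ℕ} {i : Fin (n - 1)} {r : Fin n → Fin k}
    (h : r (leftPos i) ≠ r (rightPos i)) :
    genOp ℓ i *ᵥ ket (encodeBits (2 * n + 2) r) =
      qRoot ℓ • ket (encodeBits (2 * n + 2) r) - (1 + qRoot ℓ) •
        ((aCoeff ℓ (wordDist r i) : ℂ) • ket (encodeBits (2 * n + 2) r) +
        (sCoeff ℓ (wordDist r i) : ℂ) • ket (encodeBits (2 * n + 2) (swapWord r i))) := by
  obtain ⟨p, hp, hpr⟩ : ∃ p : Fin k × Fin k, p.1 < p.2 ∧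
      ((r (leftPos i) = p.1 ∧ r (rightPos i) = p.2) ∨
        (r (leftPos i) = p.2 ∧ r (rightPos i) = p.1)) := by
    rcases lt_or_gt_of_ne h with h | h
    · exact ⟨(_, _), h, Or.inl ⟨rfl, rfl⟩⟩
    · exact ⟨(_, _), h, Or.inr ⟨rfl, rfl⟩⟩
  have hfix : ∀ p' ∈ letterPairs k, p' ≠ p → ∀ s : Fin n → Fin k,
      ((s (leftPos i) = p.1 ∧ s (rightPos i) = p.2) ∨
        (s (leftPos i) = p.2 ∧ s (rightPos i) = p.1)) →
      pairOp ℓ (-star (qRoot ℓ)) i p' *ᵥ ket (encodeBits (2 * n + 2) s) =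
        ket (encodeBits (2 * n + 2) s) := by
    intro p' hp' hne s hs
    have hlt : p'.1 < p'.2 := by simpa [letterPairs] using hp'
    refine pairOp_mulVec_of_not hlt.ne ?_ ?_
    · rintro ⟨h1, h2⟩
      rcases hs with ⟨h3, h4⟩ | ⟨h3, h4⟩
      · exact hne (Prod.ext (h1.symm.trans h3) (h2.symm.trans h4))
      · rw [← h1, ← h2, h3, h4] at hlt
        exact lt_asymm hlt hp
    · rintro ⟨h1, h2⟩
      rcases hs with ⟨h3, h4⟩ | ⟨h3, h4⟩
      · rw [← h1, ← h2, h3, h4] at hlt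
        exact lt_asymm hlt hp
      · exact hne (Prod.ext (h2.symm.trans h4) (h1.symm.trans h3))
  have hsw : (swapWord r i (leftPos i) = p.1 ∧ swapWord r i (rightPos i) = p.2) ∨
      (swapWord r i (leftPos i) = p.2 ∧ swapWord r i (rightPos i) = p.1) := by
    rw [swapWord_left, swapWord_right]
    exact hpr.symm.imp And.symm And.symm
  have hnd : (letterPairs k).Nodup := Finset.nodup_toList _
  have hmem : p ∈ letterPairs k := by simpa [letterPairs] using hp
  rw [genOp, ← Matrix.mulVec_mulVec, listProd_mulVec_of_mem hnd hmem (pairOp_mulVec hp.ne hpr)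
    (fun p' hp' hne => hfix p' hp' hne r hpr) (fun p' hp' hne => ?_),
    ctrl_nil_phaseGate_one_mulVec]
  · have hq := qRoot_mul_star ℓ
    linear_combination (norm := module)
      -hq • ((aCoeff ℓ (wordDist r i) : ℂ) • ket (encodeBits (2 * n + 2) r) +
        (sCoeff ℓ (wordDist r i) : ℂ) • ket (encodeBits (2 * n + 2) (swapWord r i)))
  · simp only [Matrix.mulVec_add, Matrix.mulVec_smul, hfix p' hp' hne r hpr,
      hfix p' hp' hne _ hsw]

theorem realizable_pairOp {ℓ : ℕ} (hℓ : 3 ≤ ℓ) {z : ℂ} (hz : ‖z‖ = 1) (i : Fin (n - 1))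
    (p : Fin k × Fin k) : Realizable ((2 * (2 + n * (2 * k) * (4 * n) + 2 * Nat.clog 2 k) +
      (2 * n + 1)) * (2 * numQubits n k * 3 ^ (2 * Nat.clog 2 k + 2))) (pairOp ℓ z i p) := by
  have hV := (realizable_stepsMatrix (two_le_numQubits n k) _
    (prepSteps_wellFormed i p.1 p.2)).mono (Nat.mul_le_mul_right _ (length_prepSteps i p.1 p.2))
  have hR := realizable_tokenCtrl (M := 2 * n) (two_le_numQubits n k)
    (flagQubit_notMem_pairPattern i p.1 p.2) (fun q _ => flagQubit_ne_tokenQubit q)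
    (fun q _ => natAdd_notMem_pairPattern i p.1 p.2 _) (nodup_pairPattern i p.1 p.2)
    (m := 2 * Nat.clog 2 k + 1) (by rw [length_pairPattern])
    (E := fun m => blockProj ℓ (m - i - (p.1 : ℕ) + (p.2 : ℕ)))
    (fun m => isStarProjection_blockProj hℓ _) hz
  refine (hV.conjTranspose.mul (hR.mul hV)).mono (le_of_eq ?_)
  ring

/-- The factor `3 ^ (2⌈log₂ k⌉ + 2)` for the controls is `O(k ^ 4)`, there are `O((n + k) ^ 2)`
qubits, and each of the fewer than `k ^ 2` factors of `genOp` takes `O((n + k) ^ 3)` multiply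
controlled operations. -/
theorem realizable_genOp {ℓ : ℕ} (hℓ : 3 ≤ ℓ) (hn : 2 ≤ n) (hk : 2 ≤ k) (i : Fin (n - 1)) :
    Realizable (23040 * (n + k) ^ 11) (genOp (k := k) ℓ i) := by
  have hG := Realizable.listProd (letterPairs k) _ fun p _ =>
    realizable_pairOp (n := n) hℓ (z := -star (qRoot ℓ)) (by simp [norm_qRoot]) i p
  have hQ := realizable_ctrl_of_length_le (m := 2 * Nat.clog 2 k + 1) (two_le_numQubits n k)
    (l := []) (f := flagQubit n k) (by simp) (by simp) (by simp) (IsStarProjection.one _)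
    (norm_qRoot ℓ)
  refine (hQ.mul hG).mono ?_
  have hpairs : (letterPairs k).length ≤ k ^ 2 := by
    rw [letterPairs, Finset.length_toList]
    refine (Finset.card_le_univ _).trans ?_
    simp [sq]
  have hlog : Nat.clog 2 k ≤ k := (Nat.clog_le_of_le_pow (Nat.lt_two_pow_self).le)
  have h3 : 3 ^ (2 * Nat.clog 2 k + 2) ≤ 144 * (n + k) ^ 4 := by
    have h2 : 2 ^ Nat.clog 2 k ≤ 2 * k := by
      have := Nat.pow_pred_clog_lt_self one_lt_two (x := k) (by omega)
      have hpos : 0 < Nat.clog 2 k := Nat.clog_pos one_lt_two hk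
      rw [← Nat.succ_pred_eq_of_pos hpos, pow_succ]
      omega
    calc 3 ^ (2 * Nat.clog 2 k + 2) = 9 * 9 ^ Nat.clog 2 k := by
          rw [pow_add, pow_mul]; norm_num [mul_comm]
      _ ≤ 9 * 16 ^ Nat.clog 2 k := Nat.mul_le_mul_left _ (Nat.pow_le_pow_left (by norm_num) _)
      _ = 9 * (2 ^ Nat.clog 2 k) ^ 4 := by rw [← pow_mul, mul_comm _ 4, pow_mul]; norm_num
      _ ≤ 9 * (2 * (n + k)) ^ 4 :=
          Nat.mul_le_mul_left _ (Nat.pow_le_pow_left (h2.trans (by omega)) _)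
      _ = 144 * (n + k) ^ 4 := by ring
  have hns : n ≤ n + k := Nat.le_add_right _ _
  have hks : k ≤ n + k := Nat.le_add_left _ _
  have hs4 : 4 ≤ n + k := by omega
  have hN : numQubits n k ≤ 4 * (n + k) ^ 2 := by
    have h1 : n * Nat.clog 2 k ≤ (n + k) * (n + k) := Nat.mul_le_mul hns (hlog.trans hks)
    rw [numQubits]
    generalize n + k = s at *
    nlinarith
  have hK : 2 * numQubits n k * 3 ^ (2 * Nat.clog 2 k + 2) ≤ 1152 * (n + k) ^ 6 :=
    calc _ ≤ 2 * (4 * (n + k) ^ 2) * (144 * (n + k) ^ 4) :=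
          Nat.mul_le_mul (Nat.mul_le_mul_left _ hN) h3
      _ = 1152 * (n + k) ^ 6 := by ring
  have hV : 2 * (2 + n * (2 * k) * (4 * n) + 2 * Nat.clog 2 k) + (2 * n + 1) ≤
      19 * (n + k) ^ 3 := by
    have h1 : n * (2 * k) * (4 * n) ≤ (n + k) * (2 * (n + k)) * (4 * (n + k)) :=
      Nat.mul_le_mul (Nat.mul_le_mul hns (Nat.mul_le_mul_left _ hks)) (Nat.mul_le_mul_left _ hns)
    have h2 : 16 * (n + k) ≤ (n + k) ^ 3 := by
      have : 4 * 4 ≤ (n + k) * (n + k) := Nat.mul_le_mul hs4 hs4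
      calc 16 * (n + k) ≤ (n + k) * (n + k) * (n + k) := Nat.mul_le_mul_right _ this
        _ = (n + k) ^ 3 := by ring
    have h4 : Nat.clog 2 k ≤ n + k := hlog.trans hks
    have h5 : (n + k) * (2 * (n + k)) * (4 * (n + k)) = 8 * (n + k) ^ 3 := by ring
    omega
  have h1 : 1 ≤ (n + k) ^ 5 := Nat.one_le_pow _ _ (by omega)
  calc _ ≤ 1152 * (n + k) ^ 6 + (n + k) ^ 2 * (19 * (n + k) ^ 3 * (1152 * (n + k) ^ 6)) :=
        Nat.add_le_add hK (Nat.mul_le_mul (hpairs.trans (Nat.pow_le_pow_left hks 2))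
          (Nat.mul_le_mul hV hK))
    _ = (1 + 19 * (n + k) ^ 5) * (1152 * (n + k) ^ 6) := by ring
    _ ≤ (20 * (n + k) ^ 5) * (1152 * (n + k) ^ 6) := Nat.mul_le_mul_right _ (by omega)
    _ = 23040 * (n + k) ^ 11 := by ring

/-! ### Encoded states -/

/-- The matrix of `encodeState`. -/
def encodeMatrix (n k a : ℕ) : Matrix (Fin (n * Nat.clog 2 k + a) → Bool) (Fin n → Fin k) ℂ :=
  .of fun x r => ket (encodeBits a r) x

theorem encodeMatrix_mulVec_ket (a : ℕ) (r : Fin n → Fin k) :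
    encodeMatrix n k a *ᵥ ket r = ket (encodeBits a r) := by
  ext x
  rw [mulVec_ket_apply, encodeMatrix, Matrix.of_apply]

theorem encodeState_eq (a : ℕ) (v : EuclideanSpace ℂ (Fin n → Fin k)) :
    encodeState a v = WithLp.toLp 2 (encodeMatrix n k a *ᵥ v.ofLp) := by
  ext x
  simp [encodeState, encodeMatrix, Matrix.mulVec, dotProduct, ket_apply, Pi.single_apply]

/-- On encoded words the operator `genOp` is `q - (1 + q) e_i`. -/
theorem genOp_mul_encodeMatrix (ℓ : ℕ) (i : Fin (n - 1)) :
    genOp (k := k) ℓ i * encodeMatrix n k (2 * n + 2) = encodeMatrix n k (2 * n + 2) *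
      (qRoot ℓ • (1 : Matrix (Fin n → Fin k) (Fin n → Fin k) ℂ) -
        (1 + qRoot ℓ) • wordProj k n ℓ i) := by
  refine Matrix.ext_ket fun r => ?_
  rw [← Matrix.mulVec_mulVec, ← Matrix.mulVec_mulVec, encodeMatrix_mulVec_ket, Matrix.sub_mulVec,
    Matrix.smul_mulVec, Matrix.smul_mulVec, Matrix.one_mulVec]
  by_cases h : r (leftPos i) = r (rightPos i)
  · rw [genOp_mulVec_of_eq h, wordProj_mulVec_ket_of_eq h, smul_zero, sub_zero,
      Matrix.mulVec_smul, encodeMatrix_mulVec_ket]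
  · rw [genOp_mulVec_of_ne h, wordProj_mulVec_ket_of_ne h]
    simp only [Matrix.mulVec_sub, Matrix.mulVec_add, Matrix.mulVec_smul, encodeMatrix_mulVec_ket]

theorem genOp_mul_encodeMatrix_mul_wordEmbedding {ℓ : ℕ} (hk : 1 < k) (hℓ : 3 ≤ ℓ)
    (i : Fin (n - 1)) :
    genOp (k := k) ℓ i * (encodeMatrix n k (2 * n + 2) * wordEmbedding k ℓ n) =
      encodeMatrix n k (2 * n + 2) * wordEmbedding k ℓ n * jwMatrix k ℓ n i := by
  rw [← Matrix.mul_assoc, genOp_mul_encodeMatrix, Matrix.mul_assoc, Matrix.mul_assoc, jwMatrix,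
    Matrix.sub_mul, Matrix.smul_mul, Matrix.smul_mul, Matrix.one_mul,
    wordProj_mul_wordEmbedding hk hℓ, Matrix.mul_sub (wordEmbedding k ℓ n), Matrix.mul_smul,
    Matrix.mul_smul, Matrix.mul_one]

theorem compEquiv_apply {ℓ : ℕ} (w : EuclideanSpace ℂ (KLTableau k ℓ n)) :
    (compEquiv k ℓ n w : EuclideanSpace ℂ (Fin n → Fin k)) =
      WithLp.toLp 2 (wordEmbedding k ℓ n *ᵥ w.ofLp) := by
  have h : (compSubspace k ℓ n).subtype ∘ₗ (compEquiv k ℓ n).toLinearEquiv.toLinearMap =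
      Matrix.toEuclideanLin (wordEmbedding k ℓ n) := by
    refine (EuclideanSpace.basisFun (KLTableau k ℓ n) ℂ).toBasis.ext fun t => ?_
    rw [OrthonormalBasis.coe_toBasis, EuclideanSpace.basisFun_apply]
    refine (compEquiv_single t).trans ?_
    ext r
    simp [wordEmbedding, ket_apply]
  exact LinearMap.congr_fun h w

/-- A circuit that implements the matrix of a generator implements `ρ` on encoded states. -/
theorem toEuclideanLin_encodeState {ℓ a : ℕ}
    (π : BraidGroup n →* Matrix.unitaryGroup (KLTableau k ℓ n) ℂ) (b : BraidGroup n)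
    {A : Matrix (Fin (n * Nat.clog 2 k + a) → Bool) (Fin (n * Nat.clog 2 k + a) → Bool) ℂ}
    (h : A * (encodeMatrix n k a * wordEmbedding k ℓ n) =
      encodeMatrix n k a * wordEmbedding k ℓ n *
        (π b : Matrix (KLTableau k ℓ n) (KLTableau k ℓ n) ℂ)) (v : compSubspace k ℓ n) :
    Matrix.toEuclideanLin A (encodeState a v) = encodeState a (compRep π b v) := by
  obtain ⟨w, rfl⟩ := (compEquiv k ℓ n).surjective v
  rw [compRep_compEquiv, compEquiv_apply, compEquiv_apply, encodeState_eq, encodeState_eq,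
    Matrix.toLpLin_apply, Matrix.toLpLin_apply]
  simp only [Matrix.mulVec_mulVec, ← Matrix.mul_assoc] at h ⊢
  rw [h]

theorem toEuclideanLin_mul_apply {ι : Type*} [Fintype ι] [DecidableEq ι] (A B : Matrix ι ι ℂ)
    (v : EuclideanSpace ℂ ι) : Matrix.toEuclideanLin (A * B) v =
      Matrix.toEuclideanLin A (Matrix.toEuclideanLin B v) := by
  simp only [Matrix.toLpLin_apply, Matrix.mulVec_mulVec]

theorem Circuit.toMatrix_append {N : ℕ} (c d : Circuit N) :
    Circuit.toMatrix (c ++ d) = Circuit.toMatrix d * Circuit.toMatrix c := by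
  simp [Circuit.toMatrix]

/-- Circuits that implement the generators of `ρ` on encoded states implement all braid words. -/
theorem toEuclideanLin_ofWord {ℓ a : ℕ} (c : Fin (n - 1) → Circuit (n * Nat.clog 2 k + a))
    (ρ : BraidGroup n →* (compSubspace k ℓ n ≃ₗᵢ[ℂ] compSubspace k ℓ n))
    (h : ∀ i (v : compSubspace k ℓ n), Matrix.toEuclideanLin (Circuit.toMatrix (c i))
      (encodeState a v) = encodeState a (ρ (BraidGroup.gen i) v))
    (w : List (Fin (n - 1) × Bool)) (v : compSubspace k ℓ n) :
    Matrix.toEuclideanLin (Circuit.toMatrix (Circuit.ofWord c w)) (encodeState a v) =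
      encodeState a (ρ (BraidGroup.ofWord w) v) := by
  induction w generalizing v with
  | nil =>
    simp [Circuit.ofWord, BraidGroup.ofWord, Circuit.toMatrix]
  | cons p w ih =>
    have h1 : Circuit.ofWord c (p :: w) =
        (if p.2 then c p.1 else Circuit.inverse (c p.1)) ++ Circuit.ofWord c w := by
      simp [Circuit.ofWord]
    have h2 : BraidGroup.ofWord (p :: w) = BraidGroup.ofWord w * BraidGroup.letter p := by
      simp [BraidGroup.ofWord]
    have h3 : Matrix.toEuclideanLin (Circuit.toMatrix
        (if p.2 then c p.1 else Circuit.inverse (c p.1))) (encodeState a v) =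
        encodeState a (ρ (BraidGroup.letter p) v) := by
      rw [BraidGroup.letter]
      split_ifs with hp
      · exact h p.1 v
      · have h4 := h p.1 (ρ (BraidGroup.gen p.1)⁻¹ v)
        have h5 : ρ (BraidGroup.gen p.1) (ρ (BraidGroup.gen p.1)⁻¹ v) = v := by
          change (ρ (BraidGroup.gen p.1) * ρ (BraidGroup.gen p.1)⁻¹) v = v
          rw [← map_mul, mul_inv_cancel, map_one]
          rfl
        rw [h5] at h4
        have h6 : (Circuit.toMatrix (c p.1))ᴴ * Circuit.toMatrix (c p.1) = 1 :=
          Matrix.mem_unitaryGroup_iff'.1 (Circuit.toMatrix_mem_unitaryGroup _)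
        rw [← h4, ← toEuclideanLin_mul_apply, Circuit.toMatrix_inverse, h6]
        simp
    rw [h1, h2, Circuit.toMatrix_append, toEuclideanLin_mul_apply, h3, ih, map_mul]
    rfl

theorem mainTheorem2 :
    ∃ C D : ℕ, ∀ n k ℓ : ℕ, 1 < k → k < ℓ →
      -- the Jones–Wenzl representation `π` of `B_n`
      ∃ π : BraidGroup n →* Matrix.unitaryGroup (KLTableau k ℓ n) ℂ,
        (∀ i, (π (BraidGroup.gen i) : Matrix (KLTableau k ℓ n) (KLTableau k ℓ n) ℂ)
          = jwMatrix k ℓ n i) ∧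
      -- its embedding `|t⟩ ↦ |r(t)⟩` as the computational subspace
      ∃ Φ : EuclideanSpace ℂ (KLTableau k ℓ n) ≃ₗᵢ[ℂ] compSubspace k ℓ n,
        (∀ t, (Φ (EuclideanSpace.single t 1) : EuclideanSpace ℂ (Fin n → Fin k))
          = EuclideanSpace.single t.rowWord 1) ∧
      -- the number of ancillas and the circuits of the generators
      ∃ a : ℕ, (a : ℝ) ≤ C * (n * Real.log n) ∧
      ∃ c : Fin (n - 1) → Circuit (n * Nat.clog 2 k + a),
        (∀ i, (c i).length ≤ C * (n + k) ^ D) ∧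
      -- the unitary representation `ρ` on the computational subspace
      ∃ ρ : BraidGroup n →* (compSubspace k ℓ n ≃ₗᵢ[ℂ] compSubspace k ℓ n),
        (∀ (i : Fin (n - 1)) (v : compSubspace k ℓ n),
          Matrix.toEuclideanLin (Circuit.toMatrix (c i)) (encodeState a v)
            = encodeState a (ρ (BraidGroup.gen i) v)) ∧
        (∀ (w : List (Fin (n - 1) × Bool)) (v : compSubspace k ℓ n),
          Matrix.toEuclideanLin (Circuit.toMatrix (Circuit.ofWord c w)) (encodeState a v)
            = encodeState a (ρ (BraidGroup.ofWord w) v)) ∧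
        (∀ (b : BraidGroup n) (v : EuclideanSpace ℂ (KLTableau k ℓ n)),
          ρ b (Φ v) = Φ (Matrix.toEuclideanLin
            (π b : Matrix (KLTableau k ℓ n) (KLTableau k ℓ n) ℂ) v)) := by
  refine ⟨23040, 11, fun n k ℓ hk hkℓ => ?_⟩
  have hℓ : 3 ≤ ℓ := by omega
  refine ⟨jwRep hk hℓ, jwRep_gen hk hℓ, compEquiv k ℓ n, compEquiv_single, ?_⟩
  -- For `n < 2` there are no generators, and the bound leaves no room for ancillas.
  obtain ⟨a, ha, c, hc, hA⟩ : ∃ a : ℕ, (a : ℝ) ≤ (23040 : ℕ) * (n * Real.log n) ∧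
      ∃ c : Fin (n - 1) → Circuit (n * Nat.clog 2 k + a),
        (∀ i, (c i).length ≤ 23040 * (n + k) ^ 11) ∧
        ∀ i, Circuit.toMatrix (c i) * (encodeMatrix n k a * wordEmbedding k ℓ n) =
          encodeMatrix n k a * wordEmbedding k ℓ n * jwMatrix k ℓ n i := by
    rcases Nat.lt_or_ge n 2 with hn | hn
    · refine ⟨0, ?_, fun i => [], fun i => by simp, fun i => absurd i.2 (by omega)⟩
      have : 0 ≤ Real.log n := Real.log_natCast_nonneg n
      push_cast
      positivity
    · choose c hc hA using fun i => realizable_genOp (k := k) hℓ hn hk i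
      refine ⟨2 * n + 2, ?_, c, hc, fun i => ?_⟩
      · have hn' : (2 : ℝ) ≤ n := by exact_mod_cast hn
        have h1 : Real.log 2 ≤ Real.log n := Real.log_le_log (by norm_num) hn'
        have h2 : (1 / 2 : ℝ) ≤ Real.log n := by linarith [Real.log_two_gt_d9]
        push_cast
        nlinarith
      · rw [hA i]
        exact genOp_mul_encodeMatrix_mul_wordEmbedding hk hℓ i
  have hgen : ∀ (i : Fin (n - 1)) (v : compSubspace k ℓ n),
      Matrix.toEuclideanLin (Circuit.toMatrix (c i)) (encodeState a v) =
        encodeState a (compRep (jwRep hk hℓ) (BraidGroup.gen i) v) := fun i v =>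
    toEuclideanLin_encodeState _ _ (by rw [jwRep_gen]; exact hA i) v
  exact ⟨a, ha, c, hc, compRep (jwRep hk hℓ), hgen, toEuclideanLin_ofWord c _ hgen,
    compRep_compEquiv _⟩

end
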